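/- Let $n\ge 0$, $\varepsilon>0$, let $V_0:\mathbb R^n\to\mathbb R$ be smooth and let $\mathbf e:[0,\infty)\to\mathbb R^n$ be twice continuously differentiable. Put $\mathcal A(t)=i\varepsilon\Delta-i\varepsilon^{-1}\big(V_0(x)+\mathbf e(t)^\top x\big)$ and, for $t\ge0$, $h>0$, let $\Theta_4=\Theta_4(t+h,t)$ be the power-truncated sixth-order Magnus expansion $$\begin{aligned}\Theta_4={}&\int_0^h\!\mathcal A_\zeta\,d\zeta-\tfrac12\int_0^h\!\!\int_0^\zeta[\mathcal A_\xi,\mathcal A_\zeta]\,d\xi\,d\zeta+\tfrac1{12}\int_0^h\!\!\int_0^\zeta\!\!\int_0^\zeta[\mathcal A_\xi,[\mathcal A_\chi,\mathcal A_\zeta]]\,d\chi\,d\xi\,d\zeta+\tfrac14\int_0^h\!\!\int_0^\zeta\!\!\int_0^\xi[[\mathcal A_\chi,\mathcal A_\xi],\mathcal A_\zeta]\,d\chi\,d\xi\,d\zeta\\&-\tfrac1{24}\int_0^h\!\!\int_0^\zeta\!\!\int_0^\zeta\!\!\int_0^\chi[\mathcal A_\xi,[[\mathcal A_\nu,\mathcal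 A_\chi],\mathcal A_\zeta]]\,d\nu\,d\chi\,d\xi\,d\zeta-\tfrac1{24}\int_0^h\!\!\int_0^\zeta\!\!\int_0^\xi\!\!\int_0^\xi[[\mathcal A_\chi,[\mathcal A_\nu,\mathcal A_\xi]],\mathcal A_\zeta]\,d\nu\,d\chi\,d\xi\,d\zeta\\&-\tfrac18\int_0^h\!\!\int_0^\zeta\!\!\int_0^\xi\!\!\int_0^\chi[[[\mathcal A_\nu,\mathcal A_\chi],\mathcal A_\xi],\mathcal A_\zeta]\,d\nu\,d\chi\,d\xi\,d\zeta,\qquad \mathcal A_\zeta:=\mathcal A(t+\zeta).\end{aligned}$$ With the Bernoulli polynomials $B_k$ let $\mu_k=\int_0^h h^kB_k(\zeta/h)\,\mathbf e(t+\zeta)\,d\zeta$, $\mathbf r=h^{-1}\mu_0$, $\mathbf s=2\mu_1$, $\mathbf q=\mu_2$, $\mathbf p=\tfrac13\mu_3$, let $$c=i\varepsilon^{-1}\Big(2\int_0^h\zeta\,\mathbf e(t+\zeta)^\top\!\int_0^\zeta\mathbf e(t+\xi)\,d\xi\,d\zeta-\Big(\int_0^h\mathbf e(t+\zeta)\,d\zeta\Big)^{\!\top}\!\int_0^h\zeta\,\mathbf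 e(t+\zeta)\,d\zeta-\tfrac h6\Big|\int_0^h\mathbf e(t+\zeta)\,d\zeta\Big|^2\Big),$$ and set $$\tilde{\mathbf s}=\mathbf s-12h^{-2}\mathbf p,\quad C_2=-12h^{-2}\mathbf p^\top\nabla,\quad T_2=ih\varepsilon\Delta-\tilde{\mathbf s}^\top\nabla,\quad W_1=-ih\varepsilon^{-1}\big(V_0+\mathbf r^\top x\big)+i\varepsilon^{-1}\mathbf q^\top(\nabla V_0)+c .$$ Then: 1. $[C_2,T_2]f=0$ for all smooth $f:\mathbb R^n\to\mathbb C$. 2. $e^{\frac12C_2}e^{T_2+W_1}e^{\frac12C_2}=e^{\Theta_4}+O(h^7)$ strongly on $C_c^\infty(\mathbb R^n;\mathbb C)$: for every $u\in C_c^\infty(\mathbb R^n;\mathbb C)$ and $T$ there is $K$ such that for all $t\in[0,T]$ and $h\in(0,1]$ $$\big\|e^{\frac12C_2}e^{T_2+W_1}e^{\frac12C_2}u-e^{\Theta_4}u\big\|_{L^2(\mathbb R^n)}\le K h^7 .$$ Here $e^{A}$ denotes the value at time $1$ of any strongly continuous one-parameter unitary group on $L^2(\mathbb R^n;\mathbb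 C)$ whose generator extends $A|_{C_c^\infty}$; if there are several such groups, the bound holds for each choice of them, with the same $K$. 3. The same holds for the exponential series: for every smooth $f:\mathbb R^n\to\mathbb C$, every $N\ge7$, every compact $S\subset\mathbb R^n$ and every $T$ there is $K$ such that, with $E_N(A)=\sum_{k<N}A^k/k!$, $$\sup_{x\in S}\Big|\big(E_N(\tfrac12C_2)\,E_N(T_2+W_1)\,E_N(\tfrac12C_2)f-E_N(\Theta_4)f\big)(x)\Big|\le Kh^7\qquad(t\in[0,T],\ h\in(0,1]).$$ -/

import Mathlib

open scoped ContDiff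

namespace Laser

noncomputable section

/-! ### Operators -/

/-- Physical space `ℝⁿ` with the Euclidean norm. -/
abbrev Space (n : ℕ) := EuclideanSpace ℝ (Fin n)

/-- Operators acting on complex-valued functions on `ℝⁿ`. -/
abbrev Op (n : ℕ) := (Space n → ℂ) → (Space n → ℂ)

/-- The Laplacian. -/
def lap {n : ℕ} : Op n := fun f => Laplacian.laplacian f

/-- The directional derivative `aᵀ∇`. -/
def dirD {n : ℕ} (a : Space n) : Op n := fun f x => fderiv ℝ f x a

/-- Multiplication by the function `g`. -/
def mulOp {n : ℕ} (g : Space n → ℂ) : Op n := fun f x => g x * f x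

/-- The commutator `[A, B] = A B - B A`. -/
def comm {n : ℕ} (A B : Op n) : Op n := fun f => A (B f) - B (A f)

/-- The integral `∫₀ᵃ F(ζ) dζ` of a family of operators,
`(∫₀ᵃ F(ζ) dζ) f (x) = ∫₀ᵃ (F(ζ) f)(x) dζ`. -/
def intOp {n : ℕ} (a : ℝ) (F : ℝ → Op n) : Op n := fun f x => ∫ ζ in (0 : ℝ)..a, F ζ f x

/-! ### The Schrödinger operator and its power-truncated sixth-order Magnus expansion -/

/-- `𝒜(t) = iεΔ - iε⁻¹ (V₀(x) + e(t)ᵀx)`. -/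
def schr {n : ℕ} (ε : ℝ) (V₀ : Space n → ℝ) (e : ℝ → Space n) (t : ℝ) : Op n :=
  (Complex.I * ε) • lap +
    mulOp (fun x => -(Complex.I * (ε : ℂ)⁻¹ * ((V₀ x + inner ℝ (e t) x : ℝ) : ℂ)))

/-- `Θ^{[1]} = ∫₀ʰ A(t+ζ) dζ`. -/
def theta1 {n : ℕ} (A : ℝ → Op n) (t h : ℝ) : Op n :=
  intOp h fun ζ => A (t + ζ)

/-- `Θ^{[2]} = -1/2 ∫₀ʰ ∫₀^ζ [A(t+ξ), A(t+ζ)] dξ dζ`. -/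
def theta2 {n : ℕ} (A : ℝ → Op n) (t h : ℝ) : Op n :=
  (-(1 / 2) : ℂ) • intOp h fun ζ => intOp ζ fun ξ => comm (A (t + ξ)) (A (t + ζ))

/-- `Θ^{[3,1]} = 1/12 ∫₀ʰ ∫₀^ζ ∫₀^ζ [A(t+ξ), [A(t+χ), A(t+ζ)]] dχ dξ dζ`. -/
def theta31 {n : ℕ} (A : ℝ → Op n) (t h : ℝ) : Op n :=
  (1 / 12 : ℂ) • intOp h fun ζ => intOp ζ fun ξ => intOp ζ fun χ =>
    comm (A (t + ξ)) (comm (A (t + χ)) (A (t + ζ)))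

/-- `Θ^{[3,2]} = 1/4 ∫₀ʰ ∫₀^ζ ∫₀^ξ [[A(t+χ), A(t+ξ)], A(t+ζ)] dχ dξ dζ`. -/
def theta32 {n : ℕ} (A : ℝ → Op n) (t h : ℝ) : Op n :=
  (1 / 4 : ℂ) • intOp h fun ζ => intOp ζ fun ξ => intOp ξ fun χ =>
    comm (comm (A (t + χ)) (A (t + ξ))) (A (t + ζ))

/-- `Θ^{[4,1]} = -1/24 ∫₀ʰ ∫₀^ζ ∫₀^ζ ∫₀^χ [A(t+ξ), [[A(t+ν), A(t+χ)], A(t+ζ)]] dν dχ dξ dζ`. -/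
def theta41 {n : ℕ} (A : ℝ → Op n) (t h : ℝ) : Op n :=
  (-(1 / 24) : ℂ) • intOp h fun ζ => intOp ζ fun ξ => intOp ζ fun χ => intOp χ fun ν =>
    comm (A (t + ξ)) (comm (comm (A (t + ν)) (A (t + χ))) (A (t + ζ)))

/-- `Θ^{[4,2]} = -1/24 ∫₀ʰ ∫₀^ζ ∫₀^ξ ∫₀^ξ [[A(t+χ), [A(t+ν), A(t+ξ)]], A(t+ζ)] dν dχ dξ dζ`. -/
def theta42 {n : ℕ} (A : ℝ → Op n) (t h : ℝ) : Op n :=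
  (-(1 / 24) : ℂ) • intOp h fun ζ => intOp ζ fun ξ => intOp ξ fun χ => intOp ξ fun ν =>
    comm (comm (A (t + χ)) (comm (A (t + ν)) (A (t + ξ)))) (A (t + ζ))

/-- `Θ^{[4,3]} = -1/8 ∫₀ʰ ∫₀^ζ ∫₀^ξ ∫₀^χ [[[A(t+ν), A(t+χ)], A(t+ξ)], A(t+ζ)] dν dχ dξ dζ`. -/
def theta43 {n : ℕ} (A : ℝ → Op n) (t h : ℝ) : Op n :=
  (-(1 / 8) : ℂ) • intOp h fun ζ => intOp ζ fun ξ => intOp ξ fun χ => intOp χ fun ν =>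
    comm (comm (comm (A (t + ν)) (A (t + χ))) (A (t + ξ))) (A (t + ζ))

/-- The power-truncated sixth-order Magnus expansion `Θ₄(t+h,t)` of `u' = 𝒜(t) u`. -/
def Theta4 {n : ℕ} (ε : ℝ) (V₀ : Space n → ℝ) (e : ℝ → Space n) (t h : ℝ) : Op n :=
  theta1 (schr ε V₀ e) t h + theta2 (schr ε V₀ e) t h + theta31 (schr ε V₀ e) t h +
    theta32 (schr ε V₀ e) t h + theta41 (schr ε V₀ e) t h + theta42 (schr ε V₀ e) t h +
    theta43 (schr ε V₀ e) t h

/-! ### The coefficients of the splitting -/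

/-- `μ_k(t,h) = ∫₀ʰ hᵏ B_k(ζ/h) e(t+ζ) dζ`, with `B_k` the Bernoulli polynomial. -/
def mu {n : ℕ} (k : ℕ) (e : ℝ → Space n) (t h : ℝ) : Space n :=
  ∫ ζ in (0 : ℝ)..h, (h ^ k * bernoulliFun k (ζ / h)) • e (t + ζ)

/-- `r = h⁻¹ μ₀`. -/
def rvec {n : ℕ} (e : ℝ → Space n) (t h : ℝ) : Space n := h⁻¹ • mu 0 e t h

/-- `s = 2 μ₁`. -/
def svec {n : ℕ} (e : ℝ → Space n) (t h : ℝ) : Space n := (2 : ℝ) • mu 1 e t h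

/-- `q = μ₂`. -/
def qvec {n : ℕ} (e : ℝ → Space n) (t h : ℝ) : Space n := mu 2 e t h

/-- `p = μ₃ / 3`. -/
def pvec {n : ℕ} (e : ℝ → Space n) (t h : ℝ) : Space n := (1 / 3 : ℝ) • mu 3 e t h

/-- `s̃ = s - 12 h⁻² p`. -/
def stilde {n : ℕ} (e : ℝ → Space n) (t h : ℝ) : Space n :=
  svec e t h - (12 * (h ^ 2)⁻¹) • pvec e t h

/-- The scalar phase
`c = iε⁻¹ (2 ∫₀ʰ ζ e(t+ζ)ᵀ ∫₀^ζ e(t+ξ) dξ dζ - (∫₀ʰ e(t+ζ) dζ)ᵀ (∫₀ʰ ζ e(t+ζ) dζ)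
  - (h/6) |∫₀ʰ e(t+ζ) dζ|²)`. -/
def cphase {n : ℕ} (ε : ℝ) (e : ℝ → Space n) (t h : ℝ) : ℂ :=
  Complex.I * (ε : ℂ)⁻¹ *
    ((2 * (∫ ζ in (0 : ℝ)..h, ζ * inner ℝ (e (t + ζ)) (∫ ξ in (0 : ℝ)..ζ, e (t + ξ)))
      - inner ℝ (∫ ζ in (0 : ℝ)..h, e (t + ζ)) (∫ ζ in (0 : ℝ)..h, ζ • e (t + ζ))
      - h / 6 * ‖∫ ζ in (0 : ℝ)..h, e (t + ζ)‖ ^ 2 : ℝ) : ℂ)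

/-- The modified kinetic term `T₂ = ihεΔ - s̃ᵀ∇`. -/
def kin {n : ℕ} (ε : ℝ) (e : ℝ → Space n) (t h : ℝ) : Op n :=
  (Complex.I * h * ε) • lap - dirD (stilde e t h)

/-- The modified potential term
`W₁ = -ihε⁻¹ (V₀(x) + rᵀx) + iε⁻¹ qᵀ(∇V₀)(x) + c` (a multiplication operator). -/
def pot {n : ℕ} (ε : ℝ) (V₀ : Space n → ℝ) (e : ℝ → Space n) (t h : ℝ) : Op n :=
  mulOp fun x =>
    -(Complex.I * h * (ε : ℂ)⁻¹ * ((V₀ x + inner ℝ (rvec e t h) x : ℝ) : ℂ))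
      + Complex.I * (ε : ℂ)⁻¹ * ((inner ℝ (qvec e t h) (gradient V₀ x) : ℝ) : ℂ)
      + cphase ε e t h

/-- `C₂ = -12 h⁻² pᵀ∇`. -/
def C2 {n : ℕ} (e : ℝ → Space n) (t h : ℝ) : Op n :=
  (-12 * ((h : ℂ) ^ 2)⁻¹) • dirD (pvec e t h)

/-- The `N`-term exponential series `∑_{k<N} Aᵏ / k!` of an operator. -/
def expSum {n : ℕ} (N : ℕ) (A : Op n) : Op n :=
  fun f => ∑ k ∈ Finset.range N, ((k.factorial : ℂ)⁻¹) • A^[k] f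

/-! ### Exponentials of skew-symmetric differential operators on `L²(ℝⁿ; ℂ)` -/

/-- The Hilbert space `L²(ℝⁿ; ℂ)`. -/
abbrev L2 (n : ℕ) := MeasureTheory.Lp ℂ 2 (MeasureTheory.volume : MeasureTheory.Measure (Space n))

/-- Test functions: smooth and compactly supported. -/
def IsTest {n : ℕ} (f : Space n → ℂ) : Prop := ContDiff ℝ ∞ f ∧ HasCompactSupport f

/-- A strongly continuous one-parameter group of unitary operators on `L²(ℝⁿ; ℂ)`. -/
structure IsUnitaryGroup {n : ℕ} (G : ℝ → (L2 n ≃ₗᵢ[ℂ] L2 n)) : Prop where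
  zero : G 0 = LinearIsometryEquiv.refl ℂ (L2 n)
  add : ∀ (a b : ℝ) (v : L2 n), G (a + b) v = G a (G b v)
  cont : ∀ v : L2 n, Continuous fun τ => G τ v

/-- The infinitesimal generator of `G` extends the restriction of `A` to test functions: every
test function `f` has `A f ∈ L²` and `d/dτ G(τ) f = A f` at `τ = 0`, in the norm of `L²`. -/
def Generates {n : ℕ} (A : Op n) (G : ℝ → (L2 n ≃ₗᵢ[ℂ] L2 n)) : Prop :=
  ∀ f : Space n → ℂ, IsTest f → ∃ v w : L2 n,
    v =ᵐ[MeasureTheory.volume] f ∧ w =ᵐ[MeasureTheory.volume] A f ∧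
      HasDerivAt (fun τ => G τ v) w 0

/-- `U = e^A`: the unitary operator `U` is the value at time one of a strongly continuous
unitary group whose generator extends `A`. -/
def IsExp {n : ℕ} (A : Op n) (U : L2 n ≃ₗᵢ[ℂ] L2 n) : Prop :=
  ∃ G : ℝ → (L2 n ≃ₗᵢ[ℂ] L2 n), IsUnitaryGroup G ∧ Generates A G ∧ U = G 1

end

end Laser

open scoped ContDiff

namespace Laser

noncomputable section

/-! ### Directional derivatives of smooth functions -/

/-! Write `B = T₂ + W₁`, `C = C₂`. The theorem combines an exact closed form of `Θ₄` with a
symmetric Baker–Campbell–Hausdorff formula in which `B` has weight 1 and `C` weight 3 in `h`.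

Closed form. Two Schrödinger operators at different times differ by multiplication by a linear
function, so their commutator is a directional derivative with constant coefficients
(`comm_schr_schr`). A triple commutator is then a multiplication (`comm_dirD_schr`), and a quadruple
one is `±[Δ, aᵀ∇V₀]` with `a` linear in the field (`comm_schr_forceFn`). The iterated integrals
reduce to moments of the field, and the Magnus coefficients assemble these into Bernoulli moments:
on smooth functions `Θ₄ = B + C + [Δ, pᵀ∇V₀]` (`Theta4_apply`). The shift `-12h⁻²p` moved from `s`
into `C₂` cancels in the sum.

Splitting. Modulo weight 7 the logarithm of `e^{C/2} e^B e^{C/2}` is `B + C + [B,[B,C]]/12`: by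
symmetry only commutators of odd degree occur, and the others already have weight at least 7
(`IsFiltration.splitting`). Since `C` commutes with `T₂`, `[B,C]` is minus multiplication by `C W₁`,
whose leading part is `12iε⁻¹h⁻¹ pᵀ∇V₀` plus a constant. Commuting with `ihεΔ` gives `[B,[B,C]] =
12[Δ, pᵀ∇V₀]` modulo weight 7 (`nested_commutator_mem`), exactly the last term of `Θ₄`.

Weights. Bernoulli polynomials of positive degree have mean zero and the field is Lipschitz on
bounded intervals, so `μ_k = O(h^{k+2})` (`exists_norm_mu_le`). Weights are made rigorous on
families of smooth functions indexed by `(t, h)`: operators that raise the order in `h`, locally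
uniformly with all derivatives, form a filtration of the endomorphism algebra
(`isFiltration_orderOp`). The bound for the exponential series is the algebraic identity evaluated
on a constant family.

Unitary groups. The operators are local, so all iterates on a test function remain supported in one
compact set. The generator therefore acts on each iterate, and Taylor's formula bounds the
difference between group and series by the first omitted iterate
(`IsUnitaryGroup.norm_sub_taylor_le`). A telescoping sum of isometries finishes the proof. Only the
action on test functions enters, hence the same constant for every choice of groups. -/

/-- The standard basis vectors. -/
def basisVec {n : ℕ} (i : Fin n) : Space n := EuclideanSpace.single i 1

theorem sum_smul_basisVec {n : ℕ} (a : Space n) : ∑ i, a i • basisVec i = a := by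
  have := (EuclideanSpace.basisFun (Fin n) ℝ).sum_repr a
  simpa [basisVec] using this

theorem contDiff_dirD {n : ℕ} (a : Space n) {f : Space n → ℂ} (hf : ContDiff ℝ ∞ f) :
    ContDiff ℝ ∞ (dirD a f) :=
  (hf.fderiv_right (m := ∞) le_rfl).clm_apply contDiff_const

theorem dirD_eq_sum {n : ℕ} (a : Space n) (f : Space n → ℂ) (x : Space n) :
    dirD a f x = ∑ i, (a i : ℂ) * dirD (basisVec i) f x := by
  conv_lhs => rw [dirD, ← sum_smul_basisVec a]
  simp [dirD, map_sum]

theorem dirD_add {n : ℕ} (a : Space n) {f g : Space n → ℂ} (hf : ContDiff ℝ ∞ f)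
    (hg : ContDiff ℝ ∞ g) : dirD a (f + g) = dirD a f + dirD a g := by
  funext x
  simp [dirD, fderiv_add (hf.differentiable (by simp) x) (hg.differentiable (by simp) x)]

theorem dirD_sub {n : ℕ} (a : Space n) {f g : Space n → ℂ} (hf : ContDiff ℝ ∞ f)
    (hg : ContDiff ℝ ∞ g) : dirD a (f - g) = dirD a f - dirD a g := by
  funext x
  simp [dirD, fderiv_sub (hf.differentiable (by simp) x) (hg.differentiable (by simp) x)]

theorem dirD_smul {n : ℕ} (a : Space n) (c : ℂ) {f : Space n → ℂ} (hf : ContDiff ℝ ∞ f) :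
    dirD a (c • f) = c • dirD a f := by
  funext x
  simp [dirD, fderiv_const_smul (hf.differentiable (by simp) x) c]

theorem dirD_mul {n : ℕ} (a : Space n) {f g : Space n → ℂ} (hf : ContDiff ℝ ∞ f)
    (hg : ContDiff ℝ ∞ g) : dirD a (f * g) = dirD a f * g + f * dirD a g := by
  funext x
  simp [dirD, fderiv_mul (hf.differentiable (by simp) x) (hg.differentiable (by simp) x)]
  ring

theorem dirD_const {n : ℕ} (a : Space n) (c : ℂ) : dirD a (fun _ : Space n => c) = 0 := by
  funext x
  simp [dirD]

theorem dirD_dirD {n : ℕ} (a b : Space n) {f : Space n → ℂ} (hf : ContDiff ℝ ∞ f) (x : Space n) :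
    dirD a (dirD b f) x = fderiv ℝ (fderiv ℝ f) x a b := by
  have h : DifferentiableAt ℝ (fderiv ℝ f) x :=
    (hf.fderiv_right (m := ∞) le_rfl).differentiable (by simp) x
  change fderiv ℝ (fun y => fderiv ℝ f y b) x a = _
  rw [fderiv_clm_apply h (differentiableAt_const b)]
  simp

theorem dirD_comm {n : ℕ} (a b : Space n) {f : Space n → ℂ} (hf : ContDiff ℝ ∞ f) :
    dirD a (dirD b f) = dirD b (dirD a f) := by
  funext x
  rw [dirD_dirD a b hf, dirD_dirD b a hf]
  have h2 : (2 : WithTop ℕ∞) ≤ ∞ := WithTop.coe_le_coe.2 (le_top : (2 : ℕ∞) ≤ ⊤)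
  exact (hf.contDiffAt.isSymmSndFDerivAt (by simpa using h2)) a b

theorem lap_eq_sum {n : ℕ} {f : Space n → ℂ} (hf : ContDiff ℝ ∞ f) (x : Space n) :
    lap f x = ∑ i, dirD (basisVec i) (dirD (basisVec i) f) x := by
  rw [lap, InnerProductSpace.laplacian_eq_iteratedFDeriv_orthonormalBasis f
    (EuclideanSpace.basisFun (Fin n) ℝ)]
  refine Finset.sum_congr rfl fun i _ => ?_
  rw [dirD_dirD _ _ hf, iteratedFDeriv_two_apply]
  simp [basisVec]

/-! ### Families of smooth functions -/

/-- Families of smooth functions on `ℝⁿ` with index set `ι`. -/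
def SmoothFam (ι : Type*) (n : ℕ) : Subalgebra ℂ (ι → Space n → ℂ) where
  carrier := {F | ∀ p, ContDiff ℝ ∞ (F p)}
  mul_mem' hf hg p := (hf p).mul (hg p)
  add_mem' hf hg p := (hf p).add (hg p)
  algebraMap_mem' _ _ := contDiff_const

variable {ι : Type*} {n : ℕ}

/-- The partial derivative `∂ᵢ` of families of smooth functions. -/
def pd (i : Fin n) : Derivation ℂ (SmoothFam ι n) (SmoothFam ι n) :=
  Derivation.mk'
    { toFun := fun F => ⟨fun p => dirD (basisVec i) (F.1 p), fun p => contDiff_dirD _ (F.2 p)⟩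
      map_add' := fun F G => Subtype.ext <| funext fun p => dirD_add _ (F.2 p) (G.2 p)
      map_smul' := fun c F => Subtype.ext <| funext fun p => dirD_smul _ c (F.2 p) }
    fun F G => Subtype.ext <| funext fun p => by
      change dirD _ (F.1 p * G.1 p) = F.1 p * dirD _ (G.1 p) + G.1 p * dirD _ (F.1 p)
      rw [dirD_mul _ (F.2 p) (G.2 p)]
      ring

theorem pd_comm (i j : Fin n) (F : SmoothFam ι n) : pd i (pd j F) = pd j (pd i F) :=
  Subtype.ext <| funext fun p => dirD_comm _ _ (F.2 p)

/-- A family of constants. -/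
def cst (c : ι → ℂ) : SmoothFam ι n := ⟨fun p _ => c p, fun _ => contDiff_const⟩

@[simp] theorem pd_cst (i : Fin n) (c : ι → ℂ) : pd i (cst c : SmoothFam ι n) = 0 :=
  Subtype.ext <| funext fun p => dirD_const _ (c p)

theorem cst_mul (c d : ι → ℂ) : (cst (c * d) : SmoothFam ι n) = cst c * cst d := rfl

/-- The family `F` is `O(hᵏ)` locally uniformly in `x`. -/
def LocBound (h : ι → ℝ) (k : ℕ) (F : SmoothFam ι n) : Prop :=
  ∀ S : Set (Space n), IsCompact S → ∃ K : ℝ, ∀ p, ∀ x ∈ S, ‖F.1 p x‖ ≤ K * h p ^ k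

/-- The family `F` is `O(hᵏ)` locally uniformly in `x`, with its first `m` derivatives. -/
def OrderUpTo (h : ι → ℝ) (k : ℕ) : ℕ → SmoothFam ι n → Prop
  | 0, F => LocBound h k F
  | m + 1, F => LocBound h k F ∧ ∀ i, OrderUpTo h k m (pd i F)

theorem OrderUpTo.of_succ {h : ι → ℝ} {k : ℕ} : ∀ {m : ℕ} {F : SmoothFam ι n},
    OrderUpTo h k (m + 1) F → OrderUpTo h k m F
  | 0, _, hF => hF.1
  | _ + 1, _, hF => ⟨hF.1, fun i => (hF.2 i).of_succ⟩

theorem OrderUpTo.add {h : ι → ℝ} {k : ℕ} : ∀ {m : ℕ} {F G : SmoothFam ι n},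
    OrderUpTo h k m F → OrderUpTo h k m G → OrderUpTo h k m (F + G)
  | 0, F, G, hF, hG => fun S hS => by
    obtain ⟨K, hK⟩ := hF S hS
    obtain ⟨L, hL⟩ := hG S hS
    refine ⟨K + L, fun p x hx => ?_⟩
    rw [add_mul]
    exact (norm_add_le _ _).trans (add_le_add (hK p x hx) (hL p x hx))
  | m + 1, F, G, hF, hG => by
    refine ⟨OrderUpTo.add (m := 0) hF.1 hG.1, fun i => ?_⟩
    rw [map_add]
    exact (hF.2 i).add (hG.2 i)

theorem OrderUpTo.smul {h : ι → ℝ} {k : ℕ} (c : ℂ) : ∀ {m : ℕ} {F : SmoothFam ι n},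
    OrderUpTo h k m F → OrderUpTo h k m (c • F)
  | 0, F, hF => fun S hS => by
    obtain ⟨K, hK⟩ := hF S hS
    refine ⟨‖c‖ * K, fun p x hx => ?_⟩
    change ‖c * F.1 p x‖ ≤ _
    rw [norm_mul, mul_assoc]
    exact mul_le_mul_of_nonneg_left (hK p x hx) (norm_nonneg c)
  | m + 1, F, hF => by
    refine ⟨OrderUpTo.smul (m := 0) c hF.1, fun i => ?_⟩
    rw [Derivation.map_smul]
    exact (hF.2 i).smul c

theorem orderUpTo_zero {h : ι → ℝ} {k : ℕ} : ∀ {m : ℕ}, OrderUpTo h k m (0 : SmoothFam ι n)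
  | 0 => fun S _ => ⟨0, fun p x _ => by
      change ‖(0 : ℂ)‖ ≤ _
      simp⟩
  | m + 1 => ⟨orderUpTo_zero (m := 0), fun i => by rw [map_zero]; exact orderUpTo_zero⟩

theorem OrderUpTo.mul {h : ι → ℝ} {j k : ℕ} : ∀ {m : ℕ} {F G : SmoothFam ι n},
    OrderUpTo h j m F → OrderUpTo h k m G → OrderUpTo h (j + k) m (F * G)
  | 0, F, G, hF, hG => fun S hS => by
    obtain ⟨K, hK⟩ := hF S hS
    obtain ⟨L, hL⟩ := hG S hS
    refine ⟨K * L, fun p x hx => ?_⟩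
    change ‖F.1 p x * G.1 p x‖ ≤ _
    rw [norm_mul, pow_add, mul_mul_mul_comm]
    exact mul_le_mul (hK p x hx) (hL p x hx) (norm_nonneg _) ((norm_nonneg _).trans (hK p x hx))
  | m + 1, F, G, hF, hG => by
    refine ⟨OrderUpTo.mul (m := 0) hF.1 hG.1, fun i => ?_⟩
    -- Each Leibniz term has one underived factor, whose hypothesis is lowered from `m + 1` to `m`
    -- derivatives by `of_succ`.
    rw [Derivation.leibniz, smul_eq_mul, smul_eq_mul, mul_comm G]
    exact (hF.of_succ.mul (hG.2 i)).add ((hF.2 i).mul hG.of_succ)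

theorem OrderUpTo.mono {h : ι → ℝ} (hh : ∀ p, h p ∈ Set.Ioc (0 : ℝ) 1) {j k : ℕ} (hjk : j ≤ k) :
    ∀ {m : ℕ} {F : SmoothFam ι n}, OrderUpTo h k m F → OrderUpTo h j m F
  | 0, F, hF => fun S hS => by
    obtain ⟨K, hK⟩ := hF S hS
    refine ⟨|K|, fun p x hx => (hK p x hx).trans ?_⟩
    have h1 := (hh p).1.le
    exact mul_le_mul (le_abs_self K) (pow_le_pow_of_le_one h1 (hh p).2 hjk) (pow_nonneg h1 k)
      (abs_nonneg K)
  | m + 1, F, hF => ⟨OrderUpTo.mono (m := 0) hh hjk hF.1, fun i => (hF.2 i).mono hh hjk⟩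

/-- The families that are `O(hᵏ)` locally uniformly in `x`, with all their derivatives. -/
def orderFam (h : ι → ℝ) (n k : ℕ) : Submodule ℂ (SmoothFam ι n) where
  carrier := {F | ∀ m, OrderUpTo h k m F}
  add_mem' hF hG m := (hF m).add (hG m)
  zero_mem' _ := orderUpTo_zero
  smul_mem' c _ hF m := (hF m).smul c

theorem mul_mem_orderFam {h : ι → ℝ} {j k : ℕ} {F G : SmoothFam ι n} (hF : F ∈ orderFam h n j)
    (hG : G ∈ orderFam h n k) : F * G ∈ orderFam h n (j + k) := fun m => (hF m).mul (hG m)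

theorem pd_mem_orderFam {h : ι → ℝ} {k : ℕ} {F : SmoothFam ι n} (i : Fin n)
    (hF : F ∈ orderFam h n k) : pd i F ∈ orderFam h n k := fun m => (hF (m + 1)).2 i

theorem orderFam_mono {h : ι → ℝ} (hh : ∀ p, h p ∈ Set.Ioc (0 : ℝ) 1) {j k : ℕ} (hjk : j ≤ k) :
    orderFam h n k ≤ orderFam h n j := fun _ hF m => (hF m).mono hh hjk

theorem cst_mem_orderFam {h : ι → ℝ} {k : ℕ} {c : ι → ℂ} {K : ℝ}
    (hc : ∀ p, ‖c p‖ ≤ K * h p ^ k) : cst c ∈ orderFam h n k := by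
  have h0 : LocBound h k (cst c : SmoothFam ι n) := fun S _ => ⟨K, fun p x _ => hc p⟩
  intro m
  cases m with
  | zero => exact h0
  | succ m =>
    refine ⟨h0, fun i => ?_⟩
    rw [pd_cst]
    exact orderUpTo_zero

/-- The family with all members equal to `f`. -/
def constFam (ι : Type*) (f : Space n → ℂ) (hf : ContDiff ℝ ∞ f) : SmoothFam ι n :=
  ⟨fun _ => f, fun _ => hf⟩

theorem constFam_mem_orderFam (h : ι → ℝ) {f : Space n → ℂ} (hf : ContDiff ℝ ∞ f) :
    constFam ι f hf ∈ orderFam h n 0 := by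
  -- The induction must range over all smooth `f`, since a derivative of a constant family is the
  -- constant family of another function.
  have key : ∀ m (f : Space n → ℂ) (hf : ContDiff ℝ ∞ f), OrderUpTo h 0 m (constFam ι f hf) := by
    intro m
    induction m with
    | zero =>
      intro f hf S hS
      obtain ⟨K, hK⟩ := hS.exists_bound_of_continuousOn hf.continuous.continuousOn
      exact ⟨K, fun p x hx => by simpa [constFam] using hK x hx⟩
    | succ m ih =>
      intro f hf
      refine ⟨fun S hS => ?_, fun i => ih _ (contDiff_dirD (basisVec i) hf)⟩
      obtain ⟨K, hK⟩ := hS.exists_bound_of_continuousOn hf.continuous.continuousOn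
      exact ⟨K, fun p x hx => by simpa [constFam] using hK x hx⟩
  exact fun m => key m f hf

/-! ### Filtered operators on families -/

/-- `F` vanishes outside `S`. -/
def VanishesOff (S : Set (Space n)) (F : SmoothFam ι n) : Prop := ∀ p, ∀ x ∉ S, F.1 p x = 0

/-- Off a closed set the function is zero on a whole neighbourhood, so its derivative vanishes too.
This is why the locality clause in `orderOp` is about closed sets. -/
theorem VanishesOff.pd {S : Set (Space n)} (hS : IsClosed S) {F : SmoothFam ι n}
    (hF : VanishesOff S F) (i : Fin n) : VanishesOff S (pd i F) := fun p x hx => by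
  have h : F.1 p =ᶠ[nhds x] fun _ => 0 :=
    Filter.eventually_of_mem (hS.isOpen_compl.mem_nhds hx) fun y hy => hF p y hy
  change fderiv ℝ (F.1 p) x _ = 0
  rw [h.fderiv_eq]
  simp

/-- Linear subspaces of an algebra. -/
abbrev AlgSubspace (R : Type*) [Ring R] [Algebra ℂ R] := Submodule ℂ R

/-- The local operators that raise the order in `h` by `k`. -/
def orderOp (h : ι → ℝ) (n k : ℕ) : AlgSubspace (Module.End ℂ (SmoothFam ι n)) where
  carrier := {A | (∀ j, ∀ F ∈ orderFam h n j, A F ∈ orderFam h n (k + j)) ∧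
    ∀ S, IsClosed S → ∀ F, VanishesOff S F → VanishesOff S (A F)}
  add_mem' hA hB := ⟨fun j F hF => add_mem (hA.1 j F hF) (hB.1 j F hF), fun S hS F hF p x hx => by
    have h1 := hA.2 S hS F hF p x hx
    have h2 := hB.2 S hS F hF p x hx
    exact (congrArg₂ (· + ·) h1 h2).trans (add_zero 0)⟩
  zero_mem' := ⟨fun _ _ _ => zero_mem _, fun _ _ _ _ _ _ _ => rfl⟩
  smul_mem' c A hA := ⟨fun j F hF => Submodule.smul_mem _ c (hA.1 j F hF),
    fun S hS F hF p x hx => (congrArg (c * ·) (hA.2 S hS F hF p x hx)).trans (mul_zero c)⟩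

theorem orderOp_mono {h : ι → ℝ} (hh : ∀ p, h p ∈ Set.Ioc (0 : ℝ) 1) {j k : ℕ} (hjk : j ≤ k) :
    orderOp h n k ≤ orderOp h n j := fun _ hA =>
  ⟨fun l F hF => orderFam_mono hh (by omega) (hA.1 l F hF), hA.2⟩

theorem mul_mem_orderOp {h : ι → ℝ} {j k : ℕ} {A B : Module.End ℂ (SmoothFam ι n)}
    (hA : A ∈ orderOp h n j) (hB : B ∈ orderOp h n k) : A * B ∈ orderOp h n (j + k) :=
  ⟨fun l F hF => by
    rw [add_assoc]
    exact hA.1 _ _ (hB.1 l F hF), fun S hS F hF => hA.2 S hS _ (hB.2 S hS F hF)⟩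

theorem one_mem_orderOp {h : ι → ℝ} : (1 : Module.End ℂ (SmoothFam ι n)) ∈ orderOp h n 0 :=
  ⟨fun j F hF => by rwa [zero_add], fun _ _ _ hF => hF⟩

/-- The partial derivative as a linear operator. -/
def pdOp (i : Fin n) : Module.End ℂ (SmoothFam ι n) := (pd i).toLinearMap

theorem pdOp_mem_orderOp {h : ι → ℝ} (i : Fin n) : pdOp i ∈ orderOp h n 0 :=
  ⟨fun j F hF => by
    rw [zero_add]
    exact pd_mem_orderFam i hF, fun _ hS _ hF => hF.pd hS i⟩

theorem mulLeft_mem_orderOp {h : ι → ℝ} {k : ℕ} {g : SmoothFam ι n} (hg : g ∈ orderFam h n k) :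
    LinearMap.mulLeft ℂ g ∈ orderOp h n k :=
  ⟨fun _ _ hF => mul_mem_orderFam hg hF, fun _ _ _ hF p x hx =>
    (congrArg (g.1 p x * ·) (hF p x hx)).trans (mul_zero _)⟩

/-! ### The symmetric splitting in a filtered algebra -/

/-- The `N`-term exponential series in an algebra. -/
def expTrunc {R : Type*} [Ring R] [Algebra ℂ R] (N : ℕ) (A : R) : R :=
  ∑ k ∈ Finset.range N, ((k.factorial : ℂ)⁻¹) • A ^ k

/-- A decreasing multiplicative filtration of an algebra. -/
structure IsFiltration {R : Type*} [Ring R] [Algebra ℂ R] (I : ℕ → Submodule ℂ R) : Prop where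
  mono : ∀ j k, j ≤ k → I k ≤ I j
  one : (1 : R) ∈ I 0
  mul : ∀ j k A B, A ∈ I j → B ∈ I k → A * B ∈ I (j + k)

section
variable {R : Type*} [Ring R] [Algebra ℂ R] {I : ℕ → Submodule ℂ R}

/-- The target weight `m` is free and the default argument checks it numerically, so products can be
placed at once in the weight at which they are needed. -/
theorem IsFiltration.mul_mem (hI : IsFiltration I) {j k m : ℕ} {A B : R} (hA : A ∈ I j)
    (hB : B ∈ I k) (h : m ≤ j + k := by norm_num) : A * B ∈ I m :=
  hI.mono _ _ h (hI.mul j k A B hA hB)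

theorem IsFiltration.commutator_mem (hI : IsFiltration I) {j k m : ℕ} {A B : R} (hA : A ∈ I j)
    (hB : B ∈ I k) (h : m ≤ j + k := by norm_num) : A * B - B * A ∈ I m :=
  sub_mem (hI.mul_mem hA hB h) (hI.mul_mem hB hA (by rwa [add_comm]))

theorem IsFiltration.mem_sub (_ : IsFiltration I) {m : ℕ} {A B : R} (hA : A ∈ I m)
    (hB : B ∈ I m) : A - B ∈ I m :=
  sub_mem hA hB

theorem IsFiltration.smul_sub_mem (_ : IsFiltration I) {m : ℕ} {A B : R} (c : ℂ) (hA : A ∈ I m)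
    (hB : B ∈ I m) : c • (A - B) ∈ I m :=
  Submodule.smul_mem _ _ (sub_mem hA hB)

theorem IsFiltration.pow_mem (hI : IsFiltration I) {j : ℕ} {A : R} (hA : A ∈ I j) (k : ℕ) :
    A ^ k ∈ I (k * j) := by
  induction k with
  | zero => simpa using hI.one
  | succ k ih =>
    rw [pow_succ]
    exact hI.mul_mem ih hA (by rw [Nat.succ_mul])

theorem IsFiltration.expTrunc_mem (hI : IsFiltration I) {A : R} (hA : A ∈ I 0) (N : ℕ) :
    expTrunc N A ∈ I 0 :=
  Submodule.sum_mem _ fun k _ => Submodule.smul_mem _ _ <| by simpa using hI.pow_mem hA k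

theorem IsFiltration.expTrunc_sub_mem (hI : IsFiltration I) {A : R} {j m M N : ℕ} (hA : A ∈ I j)
    (hMN : M ≤ N) (hm : m ≤ M * j) : expTrunc N A - expTrunc M A ∈ I m := by
  rw [expTrunc, expTrunc, ← Finset.sum_Ico_eq_sub _ hMN]
  refine Submodule.sum_mem _ fun k hk => Submodule.smul_mem _ _ ?_
  refine hI.mono _ _ ?_ (hI.pow_mem hA k)
  exact hm.trans (Nat.mul_le_mul_right j (Finset.mem_Ico.1 hk).1)

theorem IsFiltration.mul_sub_mul_mem (hI : IsFiltration I) {A A' B B' : R} {m : ℕ}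
    (hA : A ∈ I 0) (hB' : B' ∈ I 0) (h1 : A - A' ∈ I m) (h2 : B - B' ∈ I m) :
    A * B - A' * B' ∈ I m := by
  have : A * B - A' * B' = A * (B - B') + (A - A') * B' := by noncomm_ring
  rw [this]
  exact add_mem (hI.mul_mem hA h2 (by simp)) (hI.mul_mem h1 hB' (by simp))

/-- The powers of `B + C + D`, modulo weight seven, where `B`, `C`, `D` have weights one, three
and five. -/
theorem IsFiltration.pow_sub_mem (hI : IsFiltration I) {B C D : R} (hB : B ∈ I 1) (hC : C ∈ I 3)
    (hD : D ∈ I 5) :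
    (B + C + D) ^ 2 - (B ^ 2 + (B * C + C * B) + (B * D + D * B + C ^ 2)) ∈ I 7 ∧
    (B + C + D) ^ 3 - (B ^ 3 + (B ^ 2 * C + B * C * B + C * B ^ 2)) ∈ I 7 ∧
    (B + C + D) ^ 4 - (B ^ 4 + (B ^ 3 * C + B ^ 2 * C * B + B * C * B ^ 2 + C * B ^ 3)) ∈ I 7 ∧
    (B + C + D) ^ 5 - B ^ 5 ∈ I 7 ∧ (B + C + D) ^ 6 - B ^ 6 ∈ I 7 := by
  have hX : B + C + D ∈ I 1 :=
    add_mem (add_mem hB (hI.mono 1 3 (by norm_num) hC)) (hI.mono 1 5 (by norm_num) hD)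
  have hCD : C + D ∈ I 3 := add_mem hC (hI.mono 3 5 (by norm_num) hD)
  have hB2 : B ^ 2 ∈ I 2 := hI.pow_mem hB 2
  have hB3 : B ^ 3 ∈ I 3 := hI.pow_mem hB 3
  have hB4 : B ^ 4 ∈ I 4 := hI.pow_mem hB 4
  have hB5 : B ^ 5 ∈ I 5 := hI.pow_mem hB 5
  have hC2 : C ^ 2 ∈ I 6 := hI.pow_mem hC 2
  have hBC : B * C ∈ I 4 := hI.mul_mem hB hC
  have hCB : C * B ∈ I 4 := hI.mul_mem hC hB
  have hBD : B * D ∈ I 6 := hI.mul_mem hB hD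
  have hDB : D * B ∈ I 6 := hI.mul_mem hD hB
  have hB2C : B ^ 2 * C ∈ I 5 := hI.mul_mem hB2 hC
  have hBCB : B * C * B ∈ I 5 := hI.mul_mem hBC hB
  have hCB2 : C * B ^ 2 ∈ I 5 := hI.mul_mem hC hB2
  have hB3C : B ^ 3 * C ∈ I 6 := hI.mul_mem hB3 hC
  have hB2CB : B ^ 2 * C * B ∈ I 6 := hI.mul_mem hB2C hB
  have hBCB2 : B * C * B ^ 2 ∈ I 6 := hI.mul_mem hBC hB2
  have hCB3 : C * B ^ 3 ∈ I 6 := hI.mul_mem hC hB3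
  have e2 : (B + C + D) ^ 2 - (B ^ 2 + (B * C + C * B) + (B * D + D * B + C ^ 2)) ∈ I 7 := by
    have : (B + C + D) ^ 2 - (B ^ 2 + (B * C + C * B) + (B * D + D * B + C ^ 2))
        = C * D + D * (C + D) := by noncomm_ring
    rw [this]
    exact add_mem (hI.mul_mem hC hD) (hI.mul_mem hD hCD)
  have e3 : (B + C + D) ^ 3 - (B ^ 3 + (B ^ 2 * C + B * C * B + C * B ^ 2)) ∈ I 7 := by
    -- The next power is `B + C + D` times the previous one. The inherited error gains a weight; the
    -- other discarded words pair `B`, `C`, `D` with factors of weight 6, 4, 2.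
    have : (B + C + D) ^ 3 - (B ^ 3 + (B ^ 2 * C + B * C * B + C * B ^ 2))
        = (B + C + D) * ((B + C + D) ^ 2 - (B ^ 2 + (B * C + C * B) + (B * D + D * B + C ^ 2)))
          + (B * (B * D + D * B + C ^ 2)
          + C * ((B * C + C * B) + (B * D + D * B + C ^ 2))
          + D * (B ^ 2 + (B * C + C * B) + (B * D + D * B + C ^ 2))) := by noncomm_ring
    rw [this]
    have h6 : B * D + D * B + C ^ 2 ∈ I 6 := add_mem (add_mem hBD hDB) hC2
    have h4 : (B * C + C * B) + (B * D + D * B + C ^ 2) ∈ I 4 :=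
      add_mem (add_mem hBC hCB) (hI.mono 4 6 (by norm_num) h6)
    have h2 : B ^ 2 + (B * C + C * B) + (B * D + D * B + C ^ 2) ∈ I 2 := by
      rw [add_assoc]
      exact add_mem hB2 (hI.mono 2 4 (by norm_num) h4)
    exact add_mem (hI.mul_mem hX e2) (add_mem (add_mem (hI.mul_mem hB h6) (hI.mul_mem hC h4))
      (hI.mul_mem hD h2))
  have e4 : (B + C + D) ^ 4 - (B ^ 4 + (B ^ 3 * C + B ^ 2 * C * B + B * C * B ^ 2 + C * B ^ 3))
      ∈ I 7 := by
    have : (B + C + D) ^ 4 - (B ^ 4 + (B ^ 3 * C + B ^ 2 * C * B + B * C * B ^ 2 + C * B ^ 3))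
        = (B + C + D) * ((B + C + D) ^ 3 - (B ^ 3 + (B ^ 2 * C + B * C * B + C * B ^ 2)))
          + (C * (B ^ 2 * C + B * C * B + C * B ^ 2)
          + D * (B ^ 3 + (B ^ 2 * C + B * C * B + C * B ^ 2))) := by noncomm_ring
    rw [this]
    have h5 : B ^ 2 * C + B * C * B + C * B ^ 2 ∈ I 5 := add_mem (add_mem hB2C hBCB) hCB2
    exact add_mem (hI.mul_mem hX e3) (add_mem (hI.mul_mem hC h5)
      (hI.mul_mem hD (add_mem hB3 (hI.mono 3 5 (by norm_num) h5))))
  -- Here `P` is the pure power of `B` in `Y` and `s` its correction of weight 6, which becomes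
  -- negligible after one more factor. For the sixth power there is no correction left, so `s = 0`.
  have step : ∀ Y P s : R, (B + C + D) * Y - B * P
      = (B + C + D) * (Y - (P + s)) + ((B + C + D) * s + (C + D) * P) := fun Y P s => by
    noncomm_ring
  have e5 : (B + C + D) ^ 5 - B ^ 5 ∈ I 7 := by
    rw [pow_succ' _ 4, pow_succ' B 4,
      step _ _ (B ^ 3 * C + B ^ 2 * C * B + B * C * B ^ 2 + C * B ^ 3)]
    exact add_mem (hI.mul_mem hX e4) (add_mem
      (hI.mul_mem hX (add_mem (add_mem (add_mem hB3C hB2CB) hBCB2) hCB3)) (hI.mul_mem hCD hB4))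
  refine ⟨e2, e3, e4, e5, ?_⟩
  rw [pow_succ' _ 5, pow_succ' B 5, step _ _ 0, add_zero, mul_zero, zero_add]
  exact add_mem (hI.mul_mem hX e5) (hI.mul_mem hCD hB5)

theorem expTrunc_seven (A : R) : expTrunc 7 A = 1 + A + (2 : ℂ)⁻¹ • A ^ 2 + (6 : ℂ)⁻¹ • A ^ 3
    + (24 : ℂ)⁻¹ • A ^ 4 + (120 : ℂ)⁻¹ • A ^ 5 + (720 : ℂ)⁻¹ • A ^ 6 := by
  simp [expTrunc, Finset.sum_range_succ, Nat.factorial]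

theorem expTrunc_three (A : R) : expTrunc 3 A = 1 + A + (2 : ℂ)⁻¹ • A ^ 2 := by
  simp [expTrunc, Finset.sum_range_succ, Nat.factorial]

theorem IsFiltration.pow_sub_pow_mem (hI : IsFiltration I) {A A' : R} {m : ℕ} (hA : A ∈ I 0)
    (hA' : A' ∈ I 0) (h : A - A' ∈ I m) (k : ℕ) : A ^ k - A' ^ k ∈ I m := by
  induction k with
  | zero => simp
  | succ k ih =>
    rw [pow_succ, pow_succ]
    exact hI.mul_sub_mul_mem (by simpa using hI.pow_mem hA k) hA' ih h

theorem IsFiltration.expTrunc_sub_expTrunc_mem (hI : IsFiltration I) {A A' : R} {m : ℕ}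
    (hA : A ∈ I 0) (hA' : A' ∈ I 0) (h : A - A' ∈ I m) (N : ℕ) :
    expTrunc N A - expTrunc N A' ∈ I m := by
  rw [expTrunc, expTrunc, ← Finset.sum_sub_distrib]
  refine Submodule.sum_mem _ fun k _ => ?_
  rw [← smul_sub]
  exact Submodule.smul_mem _ _ (hI.pow_sub_pow_mem hA hA' h k)

/-- The part of weight below seven of the exponential of `B + C + [B, [B, C]] / 12`. -/
theorem IsFiltration.expTrunc_add_sub_mem (hI : IsFiltration I) {B C D : R} (hB : B ∈ I 1)
    (hC : C ∈ I 3) (hD : D ∈ I 5) :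
    expTrunc 7 (B + C + D) - (expTrunc 7 B + (C + D
      + (2 : ℂ)⁻¹ • ((B * C + C * B) + (B * D + D * B + C ^ 2))
      + (6 : ℂ)⁻¹ • (B ^ 2 * C + B * C * B + C * B ^ 2)
      + (24 : ℂ)⁻¹ • (B ^ 3 * C + B ^ 2 * C * B + B * C * B ^ 2 + C * B ^ 3))) ∈ I 7 := by
  obtain ⟨e2, e3, e4, e5, e6⟩ := hI.pow_sub_mem hB hC hD
  have := add_mem (add_mem (add_mem (add_mem (Submodule.smul_mem _ (2 : ℂ)⁻¹ e2)
    (Submodule.smul_mem _ (6 : ℂ)⁻¹ e3)) (Submodule.smul_mem _ (24 : ℂ)⁻¹ e4))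
    (Submodule.smul_mem _ (120 : ℂ)⁻¹ e5)) (Submodule.smul_mem _ (720 : ℂ)⁻¹ e6)
  convert this using 1
  rw [expTrunc_seven, expTrunc_seven]
  -- With the powers of the sum made opaque, the claim is linear in them.
  generalize (B + C + D) ^ 2 = X2
  generalize (B + C + D) ^ 3 = X3
  generalize (B + C + D) ^ 4 = X4
  generalize (B + C + D) ^ 5 = X5
  generalize (B + C + D) ^ 6 = X6
  module

/-- The part of weight below seven of `e^c e^B e^c`. -/
theorem IsFiltration.expTrunc_mul_mul_sub_mem (hI : IsFiltration I) {B c : R} (hB : B ∈ I 1)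
    (hc : c ∈ I 3) :
    expTrunc 3 c * expTrunc 7 B * expTrunc 3 c - (expTrunc 7 B
      + (c * (1 + B + (2 : ℂ)⁻¹ • B ^ 2 + (6 : ℂ)⁻¹ • B ^ 3)
      + (1 + B + (2 : ℂ)⁻¹ • B ^ 2 + (6 : ℂ)⁻¹ • B ^ 3) * c + (2 : ℂ) • c ^ 2)) ∈ I 7 := by
  have hB0 : B ∈ I 0 := hI.mono 0 1 (by norm_num) hB
  have hE0 := hI.expTrunc_mem hB0 7
  -- As `c` has weight 3, the exponential of `B` is needed only modulo weight 4 beside one factor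
  -- `c` and modulo weight 1 beside two; three factors already weigh nine.
  have hE1 : expTrunc 7 B - 1 ∈ I 1 := by
    simpa [expTrunc] using hI.expTrunc_sub_mem (M := 1) (N := 7) (m := 1) hB (by norm_num)
      (by norm_num)
  have hE4 : expTrunc 7 B - (1 + B + (2 : ℂ)⁻¹ • B ^ 2 + (6 : ℂ)⁻¹ • B ^ 3) ∈ I 4 := by
    have := hI.expTrunc_sub_mem (M := 4) (N := 7) (m := 4) hB (by norm_num) (by norm_num)
    convert this using 2
    simp [expTrunc, Finset.sum_range_succ, Nat.factorial]
  rw [expTrunc_three]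
  generalize expTrunc 7 B = E at *
  generalize 1 + B + (2 : ℂ)⁻¹ • B ^ 2 + (6 : ℂ)⁻¹ • B ^ 3 = T at *
  have hc2 : c ^ 2 ∈ I 6 := hI.pow_mem hc 2
  have hcE : c * E ∈ I 3 := hI.mul_mem hc hE0
  have hc2E : c ^ 2 * E ∈ I 6 := hI.mul_mem hc2 hE0
  have key := add_mem (add_mem (add_mem (add_mem (hI.mul_mem (m := 7) hc hE4)
    (hI.mul_mem (m := 7) hE4 hc)) (Submodule.smul_mem _ (2 : ℂ)⁻¹ (add_mem
      (hI.mul_mem (m := 7) hc2 hE1) (hI.mul_mem (m := 7) hE1 hc2))))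
    (hI.mul_mem (m := 7) (hI.mul_mem (m := 4) hc hE1) hc))
    (add_mem (Submodule.smul_mem _ (2 : ℂ)⁻¹ (add_mem (hI.mul_mem (m := 7) hcE hc2)
      (hI.mul_mem (m := 7) hc2E hc))) (Submodule.smul_mem _ (4 : ℂ)⁻¹
      (hI.mul_mem (m := 7) hc2E hc2)))
  convert key using 1
  simp only [mul_add, add_mul, mul_sub, sub_mul, smul_mul_assoc, mul_smul_comm, mul_one, one_mul,
    smul_add, smul_sub, smul_smul, pow_two, mul_assoc]
  module

/-- The symmetric Baker–Campbell–Hausdorff formula for weights one and three, modulo weight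
seven. -/
theorem IsFiltration.splitting (hI : IsFiltration I) {B C Θ : R} (hB : B ∈ I 1) (hC : C ∈ I 3)
    (hΘ : Θ - (B + C + (12 : ℂ)⁻¹ • (B * (B * C - C * B) - (B * C - C * B) * B)) ∈ I 7)
    {N : ℕ} (hN : 7 ≤ N) :
    expTrunc N ((1 / 2 : ℂ) • C) * expTrunc N B * expTrunc N ((1 / 2 : ℂ) • C)
      - expTrunc N Θ ∈ I 7 := by
  have hc : (1 / 2 : ℂ) • C ∈ I 3 := Submodule.smul_mem _ _ hC
  have hcomm : B * C - C * B ∈ I 4 := sub_mem (hI.mul_mem hB hC) (hI.mul_mem hC hB)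
  have hD : (12 : ℂ)⁻¹ • (B * (B * C - C * B) - (B * C - C * B) * B) ∈ I 5 :=
    Submodule.smul_mem _ _ (sub_mem (hI.mul_mem hB hcomm) (hI.mul_mem hcomm hB))
  have hX : B + C + (12 : ℂ)⁻¹ • (B * (B * C - C * B) - (B * C - C * B) * B) ∈ I 1 :=
    add_mem (add_mem hB (hI.mono 1 3 (by norm_num) hC)) (hI.mono 1 5 (by norm_num) hD)
  have h1 := hI.expTrunc_mul_mul_sub_mem hB hc
  have h2 := hI.expTrunc_add_sub_mem hB hC hD
  have hΘ1 : Θ ∈ I 1 := by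
    have := add_mem (hI.mono 1 7 (by norm_num) hΘ) hX
    rwa [sub_add_cancel] at this
  have h3 := hI.expTrunc_sub_expTrunc_mem (hI.mono 0 1 (by norm_num) hΘ1)
    (hI.mono 0 1 (by norm_num) hX) hΘ 7
  have h4 := hI.expTrunc_sub_mem (m := 7) hΘ1 hN (by norm_num)
  have hB0 : B ∈ I 0 := hI.mono 0 1 (by norm_num) hB
  have hc0 := hI.mono 0 3 (by norm_num) hc
  -- Three terms suffice for the outer factors, since the cube of `C/2` has weight nine.
  have hcN := hI.expTrunc_sub_mem (M := 3) (N := N) (m := 7) hc (by omega) (by norm_num)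
  have hBN := hI.expTrunc_sub_mem (m := 7) hB hN (by norm_num)
  have h5 := hI.mul_sub_mul_mem (by
    simpa using hI.mul_mem (m := 0) (hI.expTrunc_mem hc0 N) (hI.expTrunc_mem hB0 N))
    (hI.expTrunc_mem hc0 3) (hI.mul_sub_mul_mem (hI.expTrunc_mem hc0 N) (hI.expTrunc_mem hB0 7)
      hcN hBN) hcN
  have key := sub_mem (sub_mem (sub_mem (add_mem h5 h1) h2) h3) h4
  convert key using 1
  generalize expTrunc N Θ = X1
  generalize expTrunc 7 Θ = X2
  generalize expTrunc 7 (_ : R) = X3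
  generalize expTrunc N ((1 / 2 : ℂ) • C) * expTrunc N B * expTrunc N ((1 / 2 : ℂ) • C) = X4
  -- What remains is an exact identity between the words of weight below seven on the two sides; it
  -- is here that the coefficient 1/12 of `[B, [B, C]]` is verified.
  simp only [mul_add, add_mul, mul_sub, sub_mul, smul_mul_assoc, mul_smul_comm, mul_one, one_mul,
    smul_add, smul_sub, smul_smul, pow_succ, pow_zero, mul_assoc]
  module

end

/-! ### Differential operators on families -/

section
variable {ι : Type*} {n : ℕ}

theorem isFiltration_orderOp {h : ι → ℝ} (hh : ∀ p, h p ∈ Set.Ioc (0 : ℝ) 1) :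
    IsFiltration (orderOp h n) :=
  ⟨fun _ _ hjk => orderOp_mono hh hjk, one_mem_orderOp, fun _ _ _ _ => mul_mem_orderOp⟩

/-- Multiplication by a family of functions. -/
def mulFam (g : SmoothFam ι n) : Module.End ℂ (SmoothFam ι n) := LinearMap.mulLeft ℂ g

theorem mulFam_mul (f g : SmoothFam ι n) : mulFam (f * g) = mulFam f * mulFam g :=
  LinearMap.mulLeft_mul ..

theorem mulFam_add (f g : SmoothFam ι n) : mulFam (f + g) = mulFam f + mulFam g :=
  LinearMap.ext fun F => add_mul f g F

theorem mulFam_comm (f g : SmoothFam ι n) : mulFam f * mulFam g = mulFam g * mulFam f := by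
  rw [← mulFam_mul, mul_comm, mulFam_mul]

/-- The first-order operator `∑ aᵢ ∂ᵢ`. -/
def dirOp (a : Fin n → SmoothFam ι n) : Module.End ℂ (SmoothFam ι n) :=
  ∑ i, mulFam (a i) * pdOp i

/-- The Laplacian on families. -/
def lapOp : Module.End ℂ (SmoothFam ι n) := ∑ i, pdOp i * pdOp i

theorem pdOp_mul_mulFam (i : Fin n) (g : SmoothFam ι n) :
    pdOp i * mulFam g = mulFam g * pdOp i + mulFam (pd i g) :=
  LinearMap.ext fun F => by
    change pd i (g * F) = g * pd i F + pd i g * F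
    rw [Derivation.leibniz, smul_eq_mul, smul_eq_mul, mul_comm F]

theorem pdOp_comm (i j : Fin n) :
    (pdOp i * pdOp j : Module.End ℂ (SmoothFam ι n)) = pdOp j * pdOp i :=
  LinearMap.ext fun F => pd_comm i j F

theorem pdOp_commute_cst (i : Fin n) (c : ι → ℂ) : Commute (pdOp i) (mulFam (cst c)) := by
  have := pdOp_mul_mulFam i (cst c : SmoothFam ι n)
  rw [pd_cst] at this
  rw [Commute, SemiconjBy, this]
  ext1 F
  change _ + 0 * F = _
  rw [zero_mul, add_zero]

theorem dirOp_mul_mulFam (a : Fin n → SmoothFam ι n) (g : SmoothFam ι n) :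
    dirOp a * mulFam g = mulFam g * dirOp a + mulFam (∑ i, a i * pd i g) := by
  ext1 F
  simp only [dirOp, Module.End.mul_apply, LinearMap.add_apply, LinearMap.sum_apply]
  change ∑ i, a i * pd i (g * F) = g * ∑ i, a i * pd i F + (∑ i, a i * pd i g) * F
  simp only [Derivation.leibniz, smul_eq_mul, Finset.mul_sum, Finset.sum_mul,
    ← Finset.sum_add_distrib]
  exact Finset.sum_congr rfl fun i _ => by ring

theorem pdOp_commute_lapOp (i : Fin n) :
    Commute (pdOp i) (lapOp : Module.End ℂ (SmoothFam ι n)) := by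
  refine Commute.sum_right _ _ _ fun j _ => ?_
  have h : Commute (pdOp i) (pdOp j : Module.End ℂ (SmoothFam ι n)) := pdOp_comm i j
  exact h.mul_right h

theorem lapOp_commute_cst (c : ι → ℂ) :
    Commute lapOp (mulFam (cst c) : Module.End ℂ (SmoothFam ι n)) :=
  Commute.sum_left _ _ _ fun j _ => (pdOp_commute_cst j c).mul_left (pdOp_commute_cst j c)

theorem lapOp_commute_dirOp (a : Fin n → ι → ℂ) :
    Commute lapOp (dirOp fun i => (cst (a i) : SmoothFam ι n)) :=
  Commute.sum_right _ _ _ fun i _ =>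
    Commute.mul_right (lapOp_commute_cst (a i)) (pdOp_commute_lapOp i).symm

theorem pdOp_commute_dirOp (i : Fin n) (a : Fin n → ι → ℂ) :
    Commute (pdOp i) (dirOp fun i => (cst (a i) : SmoothFam ι n)) :=
  Commute.sum_right _ _ _ fun j _ => (pdOp_commute_cst i (a j)).mul_right (pdOp_comm i j)

theorem cst_commute_dirOp (c : ι → ℂ) (a : Fin n → ι → ℂ) :
    Commute (mulFam (cst c)) (dirOp fun i => (cst (a i) : SmoothFam ι n)) :=
  Commute.sum_right _ _ _ fun j _ =>
    Commute.mul_right (mulFam_comm _ _) (pdOp_commute_cst j c).symm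

theorem dirOp_commute_dirOp (a b : Fin n → ι → ℂ) :
    Commute (dirOp fun i => (cst (a i) : SmoothFam ι n)) (dirOp fun i => cst (b i)) :=
  Commute.sum_left _ _ _ fun j _ =>
    (cst_commute_dirOp (a j) b).mul_left (pdOp_commute_dirOp j b)

variable {h : ι → ℝ}

theorem lapOp_mem_orderOp : lapOp ∈ orderOp h n 0 :=
  Submodule.sum_mem _ fun i _ => mul_mem_orderOp (pdOp_mem_orderOp i) (pdOp_mem_orderOp i)

theorem dirOp_mem_orderOp {k : ℕ} {a : Fin n → SmoothFam ι n} (ha : ∀ i, a i ∈ orderFam h n k) :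
    dirOp a ∈ orderOp h n k :=
  Submodule.sum_mem _ fun i _ => mul_mem_orderOp (mulLeft_mem_orderOp (ha i)) (pdOp_mem_orderOp i)

/-- The algebra behind the nested commutator `[B, [B, C]]`. -/
theorem nested_commutator_eq {R : Type*} [Ring R] [Algebra ℂ R] {K L S W C Y A G A' M Z : R}
    (hLC : L * C = C * L) (hKC : K * C = C * K) (hSC : S * C = C * S) (hCW : C * W = W * C + Y)
    (hWY : W * Y = Y * W) (hKY : K * Y = Y * K) (hSY : S * Y = Y * S + Z)
    (hY : Y = A * G + A' + M) (hLA : L * A = A * L) (hLA' : L * A' = A' * L)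
    (hKA : K * A = (-12 : ℂ) • 1) {B : R} (hB : B = K * L - S + W) :
    (B + C + (L * G - G * L)) - (B + C + (12 : ℂ)⁻¹ • (B * (B * C - C * B) - (B * C - C * B) * B))
      = (12 : ℂ)⁻¹ • (K * (L * M - M * L) - Z) := by
  -- In the application `K` is multiplication by `ihε`, `L` the Laplacian, `S` the drift, `W` the
  -- potential, and `A`, `A'` are multiplications by constants in `x`. Of the parts of `B`, only `W`
  -- fails to commute with `C`.
  have hBC : B * C - C * B = -Y := by
    rw [hB]
    simp only [add_mul, sub_mul, mul_add, mul_sub, hSC, hCW]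
    rw [mul_assoc, hLC, ← mul_assoc, hKC, ← mul_assoc]
    abel
  have hLY : L * Y - Y * L = A * (L * G - G * L) + (L * M - M * L) := by
    rw [hY]
    simp only [mul_add, add_mul, mul_sub, ← mul_assoc, hLA, hLA']
    abel
  have hKLY : K * (L * Y - Y * L) = (-12 : ℂ) • (L * G - G * L) + K * (L * M - M * L) := by
    rw [hLY, mul_add, ← mul_assoc, hKA, smul_mul_assoc, one_mul]
  -- Now `W` and `K` commute with `Y`, so only the Laplacian and the drift contribute; the drift
  -- yields the error `Z`.
  have hBY : B * Y - Y * B = K * (L * Y - Y * L) - Z := by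
    rw [hB]
    simp only [add_mul, sub_mul, mul_add, mul_sub, hSY, hWY, ← mul_assoc, hKY]
    abel
  have h2 : B * (B * C - C * B) - (B * C - C * B) * B = -(B * Y - Y * B) := by
    rw [hBC]
    noncomm_ring
  rw [h2, hBY, hKLY]
  generalize K * (L * M - M * L) = X1
  generalize L * G - G * L = X2
  module

/-- The nested commutator `[B, [B, C]]`, to leading order, for `B = κΔ - sᵀ∇ + w` and
`C = cᵀ∇`. -/
theorem nested_commutator_mem (hh : ∀ p, h p ∈ Set.Ioc (0 : ℝ) 1) {κ α β : ι → ℂ}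
    {s c : Fin n → ι → ℂ} {w g m : SmoothFam ι n} {B C : Module.End ℂ (SmoothFam ι n)}
    (hB : B = mulFam (cst κ) * lapOp - dirOp (fun i => cst (s i)) + mulFam w)
    (hC : C = dirOp fun i => cst (c i))
    (hκ : cst κ ∈ orderFam h n 1) (hs : ∀ i, cst (s i) ∈ orderFam h n 3)
    (hc : ∀ i, cst (c i) ∈ orderFam h n 3) (hw : w ∈ orderFam h n 1) (hm : m ∈ orderFam h n 6)
    (hy : ∑ i, cst (c i) * pd i w = cst α * g + cst β + m) (hκα : ∀ p, κ p * α p = -12) :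
    (B + C + (lapOp * mulFam g - mulFam g * lapOp))
      - (B + C + (12 : ℂ)⁻¹ • (B * (B * C - C * B) - (B * C - C * B) * B)) ∈ orderOp h n 7 := by
  have hI := isFiltration_orderOp (n := n) hh
  obtain ⟨y, hy'⟩ : ∃ y, y = ∑ i, cst (c i) * pd i w := ⟨_, rfl⟩
  have hyF : y ∈ orderFam h n 4 := by
    rw [hy']
    exact Submodule.sum_mem _ fun i _ => mul_mem_orderFam (hc i) (pd_mem_orderFam i hw)
  have hκα' : mulFam (cst κ) * mulFam (cst α)
      = (-12 : ℂ) • (1 : Module.End ℂ (SmoothFam ι n)) := by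
    rw [← mulFam_mul, ← cst_mul]
    refine LinearMap.ext fun F => Subtype.ext <| funext fun p => funext fun x => ?_
    change (κ p * α p) * F.1 p x = (-12) * F.1 p x
    rw [hκα]
  -- Both error terms have weight seven: the drift acting on `y` gives 3 + 4, and the remainder `m`
  -- of weight 6 gains one from `κ`.
  have hS : mulFam (∑ i, cst (s i) * pd i y) ∈ orderOp h n 7 :=
    mulLeft_mem_orderOp <| Submodule.sum_mem _ fun i _ =>
      mul_mem_orderFam (hs i) (pd_mem_orderFam i hyF)
  have hMm : mulFam m ∈ orderOp h n 6 := mulLeft_mem_orderOp hm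
  have hLM : lapOp * mulFam m - mulFam m * lapOp ∈ orderOp h n 6 :=
    hI.commutator_mem lapOp_mem_orderOp hMm
  have hR : mulFam (cst κ) * (lapOp * mulFam m - mulFam m * lapOp) ∈ orderOp h n 7 :=
    hI.mul_mem (mulLeft_mem_orderOp hκ) hLM
  have hY : mulFam y = mulFam (cst α) * mulFam g + mulFam (cst β) + mulFam m := by
    rw [hy', hy, mulFam_add, mulFam_add, mulFam_mul]
  have hCw : C * mulFam w = mulFam w * C + mulFam y := by
    rw [hC, dirOp_mul_mulFam, hy']
  have hLC : lapOp * C = C * lapOp := hC ▸ (lapOp_commute_dirOp c).eq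
  have hκC : mulFam (cst κ) * C = C * mulFam (cst κ) := hC ▸ (cst_commute_dirOp κ c).eq
  have hSC : dirOp (fun i => cst (s i)) * C = C * dirOp fun i => cst (s i) :=
    hC ▸ (dirOp_commute_dirOp s c).eq
  have key := nested_commutator_eq (R := Module.End ℂ (SmoothFam ι n)) hLC hκC hSC hCw
    (mulFam_comm w y) (mulFam_comm _ y) (dirOp_mul_mulFam (fun i => cst (s i)) y) hY
    (lapOp_commute_cst (n := n) α).eq (lapOp_commute_cst (n := n) β).eq hκα' hB
  exact (congrArg (· ∈ orderOp h n 7) key).mpr (hI.smul_sub_mem _ hR hS)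

/-! ### Operators realized on families -/

/-- The operator `A` on families acts on the member with index `p` as the operator `a p`. -/
def Realizes (A : Module.End ℂ (SmoothFam ι n)) (a : ι → Op n) : Prop :=
  ∀ F p, (A F).1 p = a p (F.1 p)

theorem Realizes.smul {A : Module.End ℂ (SmoothFam ι n)} {a : ι → Op n} (hA : Realizes A a)
    (c : ℂ) : Realizes (c • A) (c • a) := fun F p => congrArg (c • ·) (hA F p)

theorem Realizes.pow {A : Module.End ℂ (SmoothFam ι n)} {a : ι → Op n} (hA : Realizes A a)
    (k : ℕ) (F : SmoothFam ι n) (p : ι) : ((A ^ k) F).1 p = (a p)^[k] (F.1 p) := by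
  induction k with
  | zero => rfl
  | succ k ih =>
    rw [pow_succ', Function.iterate_succ_apply', ← ih]
    exact hA _ p

theorem SmoothFam.sum_apply {κ : Type*} (s : Finset κ) (F : κ → SmoothFam ι n) (p : ι) :
    (∑ i ∈ s, F i).1 p = ∑ i ∈ s, (F i).1 p := by
  rw [← Finset.sum_apply]
  exact congrFun (map_sum (SmoothFam ι n).val F s) p

theorem Realizes.expSum {A : Module.End ℂ (SmoothFam ι n)} {a : ι → Op n} (hA : Realizes A a)
    (N : ℕ) : Realizes (expTrunc N A) fun p => Laser.expSum N (a p) := fun F p => by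
  change _ = Laser.expSum N (a p) (F.1 p)
  rw [expTrunc, LinearMap.sum_apply, SmoothFam.sum_apply, Laser.expSum]
  exact Finset.sum_congr rfl fun k _ => congrArg (((k.factorial : ℂ)⁻¹) • ·) (hA.pow k F p)

theorem realizes_lapOp : Realizes (lapOp : Module.End ℂ (SmoothFam ι n)) fun _ => lap :=
  fun F p => funext fun x => by
    change _ = lap (F.1 p) x
    rw [lapOp, LinearMap.sum_apply, SmoothFam.sum_apply, lap_eq_sum (F.2 p), Finset.sum_apply]
    rfl

theorem realizes_dirOp (a : ι → Space n) :
    Realizes (dirOp fun i => (cst fun p => (a p i : ℂ) : SmoothFam ι n)) fun p => dirD (a p) :=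
  fun F p => funext fun x => by
    change _ = dirD (a p) (F.1 p) x
    rw [dirOp, LinearMap.sum_apply, SmoothFam.sum_apply, dirD_eq_sum, Finset.sum_apply]
    rfl

end

/-! ### The operators of the splitting on families -/

section
variable {ι : Type*} {n : ℕ}

theorem contDiff_ofReal_comp {V₀ : Space n → ℝ} (hV₀ : ContDiff ℝ ∞ V₀) :
    ContDiff ℝ ∞ fun x => (V₀ x : ℂ) :=
  Complex.ofRealCLM.contDiff.comp hV₀

theorem dirD_ofReal {V₀ : Space n → ℝ} (hV₀ : ContDiff ℝ ∞ V₀) (a x : Space n) :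
    dirD a (fun y => (V₀ y : ℂ)) x = ((inner ℝ a (gradient V₀ x) : ℝ) : ℂ) := by
  have h1 : HasFDerivAt V₀ (fderiv ℝ V₀ x) x := (hV₀.differentiable (by simp) x).hasFDerivAt
  have h2 := (Complex.ofRealCLM.hasFDerivAt (x := V₀ x)).comp x h1
  have h3 : inner ℝ (gradient V₀ x) a = fderiv ℝ V₀ x a := by
    rw [← toDual_gradient, InnerProductSpace.toDual_apply_apply]
  rw [real_inner_comm, h3, dirD]
  change fderiv ℝ (Complex.ofRealCLM ∘ V₀) x a = _
  rw [h2.fderiv]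
  rfl

theorem dirD_inner (a b : Space n) (x : Space n) :
    dirD a (fun y => ((inner ℝ b y : ℝ) : ℂ)) x = ((inner ℝ b a : ℝ) : ℂ) := by
  have h : (fun y => ((inner ℝ b y : ℝ) : ℂ)) = Complex.ofRealCLM.comp (innerSL ℝ b) := rfl
  rw [dirD, h, ContinuousLinearMap.fderiv]
  rfl

/-- The family of linear functions `rᵀx`. -/
def linFam (r : ι → Space n) : SmoothFam ι n :=
  ⟨fun p x => ((inner ℝ (r p) x : ℝ) : ℂ), fun p => contDiff_ofReal_comp (innerSL ℝ (r p)).contDiff⟩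

/-- The coordinates of a family of vectors, as families of constants. -/
def coordFam (a : ι → Space n) (i : Fin n) : SmoothFam ι n := cst fun p => (a p i : ℂ)

theorem pd_linFam (r : ι → Space n) (i : Fin n) : pd i (linFam r) = coordFam r i :=
  Subtype.ext <| funext fun p => funext fun x => by
    change dirD (basisVec i) (fun y => ((inner ℝ (r p) y : ℝ) : ℂ)) x = (r p i : ℂ)
    rw [dirD_inner]
    simp [basisVec, EuclideanSpace.inner_single_right]

theorem coordFam_mem_orderFam {h : ι → ℝ} {k : ℕ} {a : ι → Space n} {K : ℝ}
    (ha : ∀ p, ‖a p‖ ≤ K * h p ^ k) (i : Fin n) : coordFam a i ∈ orderFam h n k :=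
  cst_mem_orderFam (K := K) fun p => by
    rw [Complex.norm_real]
    exact (PiLp.norm_apply_le (a p) i).trans (ha p)

theorem linFam_mem_orderFam {h : ι → ℝ} {k : ℕ} {r : ι → Space n} {K : ℝ}
    (hr : ∀ p, ‖r p‖ ≤ K * h p ^ k) : linFam r ∈ orderFam h n k := by
  have h0 : LocBound h k (linFam r) := fun S hS => by
    obtain ⟨L, hL⟩ := hS.isBounded.exists_norm_le
    refine ⟨K * L, fun p x hx => ?_⟩
    change ‖((inner ℝ (r p) x : ℝ) : ℂ)‖ ≤ _
    rw [Complex.norm_real, mul_right_comm]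
    exact (norm_inner_le_norm _ _).trans (mul_le_mul (hr p) (hL x hx) (norm_nonneg _)
      ((norm_nonneg _).trans (hr p)))
  intro m
  cases m with
  | zero => exact h0
  | succ m =>
    refine ⟨h0, fun i => ?_⟩
    rw [pd_linFam]
    exact coordFam_mem_orderFam hr i m

theorem realizes_dirOp_coordFam (a : ι → Space n) :
    Realizes (dirOp (coordFam a)) fun p => dirD (a p) :=
  realizes_dirOp a

/-- The potential `V₀` as a constant family. -/
def potentialFam (ι : Type*) (V₀ : Space n → ℝ) (hV₀ : ContDiff ℝ ∞ V₀) : SmoothFam ι n :=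
  constFam ι (fun x => (V₀ x : ℂ)) (contDiff_ofReal_comp hV₀)

/-- The family of modified potentials `-ihε⁻¹ (V₀(x) + rᵀx) + iε⁻¹ qᵀ(∇V₀)(x) + c`. -/
def modPotFam (ε : ℝ) (V₀ : Space n → ℝ) (hV₀ : ContDiff ℝ ∞ V₀) (h : ι → ℝ)
    (r q : ι → Space n) (c : ι → ℂ) : SmoothFam ι n :=
  cst (fun p => -(Complex.I * h p * (ε : ℂ)⁻¹)) * (potentialFam ι V₀ hV₀ + linFam r)
    + cst (fun _ => Complex.I * (ε : ℂ)⁻¹) * dirOp (coordFam q) (potentialFam ι V₀ hV₀) + cst c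

theorem modPotFam_apply (ε : ℝ) (V₀ : Space n → ℝ) (hV₀ : ContDiff ℝ ∞ V₀) (h : ι → ℝ)
    (r q : ι → Space n) (c : ι → ℂ) (p : ι) (x : Space n) :
    (modPotFam ε V₀ hV₀ h r q c).1 p x
      = -(Complex.I * h p * (ε : ℂ)⁻¹ * ((V₀ x + inner ℝ (r p) x : ℝ) : ℂ))
        + Complex.I * (ε : ℂ)⁻¹ * ((inner ℝ (q p) (gradient V₀ x) : ℝ) : ℂ) + c p := by
  change -(Complex.I * h p * (ε : ℂ)⁻¹) * ((V₀ x : ℂ) + ((inner ℝ (r p) x : ℝ) : ℂ))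
    + Complex.I * (ε : ℂ)⁻¹ * (dirOp (coordFam q) (potentialFam ι V₀ hV₀)).1 p x + c p = _
  rw [realizes_dirOp_coordFam q (potentialFam ι V₀ hV₀) p]
  change _ + _ * dirD (q p) (fun x => (V₀ x : ℂ)) x + _ = _
  rw [dirD_ofReal hV₀]
  push_cast
  ring

theorem cst_sum {κ : Type*} (s : Finset κ) (c : κ → ι → ℂ) :
    (∑ i ∈ s, cst (c i) : SmoothFam ι n) = cst (∑ i ∈ s, c i) :=
  Subtype.ext <| funext fun p => funext fun x => by
    rw [SmoothFam.sum_apply, Finset.sum_apply]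
    change _ = (∑ i ∈ s, c i) p
    rw [Finset.sum_apply]
    rfl

/-- The splitting of the exponential series for families of operators. -/
theorem exists_realizes_splitting {h : ι → ℝ} (hh : ∀ p, h p ∈ Set.Ioc (0 : ℝ) 1) {ε : ℝ}
    (hε : 0 < ε) (V₀ : Space n → ℝ) (hV₀ : ContDiff ℝ ∞ V₀) (s r q v : ι → Space n) (c : ι → ℂ)
    {K : ℝ} (hs : ∀ p, ‖s p‖ ≤ K * h p ^ 3) (hr : ∀ p, ‖r p‖ ≤ K) (hq : ∀ p, ‖q p‖ ≤ K * h p ^ 3)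
    (hv : ∀ p, ‖v p‖ ≤ K * h p ^ 5) (hc : ∀ p, ‖c p‖ ≤ K * h p) :
    ∃ B C Θ : Module.End ℂ (SmoothFam ι n),
      Realizes B (fun p => ((Complex.I * h p * ε) • lap - dirD (s p)) + mulOp fun x =>
        -(Complex.I * h p * (ε : ℂ)⁻¹ * ((V₀ x + inner ℝ (r p) x : ℝ) : ℂ))
        + Complex.I * (ε : ℂ)⁻¹ * ((inner ℝ (q p) (gradient V₀ x) : ℝ) : ℂ) + c p) ∧
      Realizes C (fun p => (-12 * ((h p : ℂ) ^ 2)⁻¹) • dirD (v p)) ∧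
      (∀ F p x, (Θ F).1 p x = (B F).1 p x + (C F).1 p x
        + comm lap (mulOp fun x => ((inner ℝ (v p) (gradient V₀ x) : ℝ) : ℂ)) (F.1 p) x) ∧
      B ∈ orderOp h n 1 ∧ C ∈ orderOp h n 3 ∧ Θ ∈ orderOp h n 1 ∧
      ∀ N, 7 ≤ N → expTrunc N ((1 / 2 : ℂ) • C) * expTrunc N B * expTrunc N ((1 / 2 : ℂ) • C)
        - expTrunc N Θ ∈ orderOp h n 7 := by
  set V := potentialFam ι V₀ hV₀ with hV
  set w := modPotFam ε V₀ hV₀ h r q c with hw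
  set c' : Fin n → ι → ℂ := fun i p => -12 * ((h p : ℂ) ^ 2)⁻¹ * (v p i : ℂ) with hc'
  set B : Module.End ℂ (SmoothFam ι n) := mulFam (cst fun p => Complex.I * h p * ε) * lapOp
    - dirOp (coordFam s) + mulFam w with hB
  set C : Module.End ℂ (SmoothFam ι n) := dirOp fun i => cst (c' i) with hC
  set g := dirOp (coordFam v) V with hg
  have hI := isFiltration_orderOp (n := n) hh
  have hV0 : V ∈ orderFam h n 0 := constFam_mem_orderFam h _
  have hκ1 : (cst fun p => Complex.I * h p * ε) ∈ orderFam h n 1 :=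
    cst_mem_orderFam (K := ε) fun p => by
      simp [abs_of_pos hε, abs_of_pos (hh p).1, mul_comm]
  have hq3 := coordFam_mem_orderFam hq
  have hqV : dirOp (coordFam q) V ∈ orderFam h n 3 := (dirOp_mem_orderOp hq3).1 0 V hV0
  have hb0 : (cst fun _ => Complex.I * (ε : ℂ)⁻¹) ∈ orderFam h n 0 :=
    cst_mem_orderFam (K := ε⁻¹) fun p => by simp [abs_of_pos hε]
  have hw1 : w ∈ orderFam h n 1 := by
    refine add_mem (add_mem (mul_mem_orderFam (j := 1) (k := 0) (cst_mem_orderFam (K := ε⁻¹)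
      fun p => ?_) (add_mem hV0 (linFam_mem_orderFam (K := K) (by simpa using hr)))) ?_)
      (cst_mem_orderFam (K := K) (by simpa using hc))
    · simp [abs_of_pos hε, abs_of_pos (hh p).1, mul_comm]
    · exact orderFam_mono hh (by norm_num) (mul_mem_orderFam hb0 hqV)
  -- The factor `h⁻²` lowers the order of `v` from five to three.
  have hc3 : ∀ i, cst (c' i) ∈ orderFam h n 3 := fun i =>
    cst_mem_orderFam (K := 12 * K) fun p => by
      have h1 := (PiLp.norm_apply_le (v p) i).trans (hv p)
      have h2 := (hh p).1
      rw [hc']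
      simp only [norm_mul, norm_neg, norm_inv, norm_pow, Complex.norm_real, Real.norm_eq_abs,
        abs_of_pos h2]
      rw [show ‖(12 : ℂ)‖ = 12 by simp, mul_assoc, mul_assoc]
      refine mul_le_mul_of_nonneg_left ?_ (by norm_num)
      rw [inv_mul_le_iff₀ (by positivity)]
      refine h1.trans (le_of_eq ?_)
      ring
  have hg5 : g ∈ orderFam h n 5 := (dirOp_mem_orderOp (coordFam_mem_orderFam hv)).1 0 V hV0
  -- The remainder `m` is the derivative of the `q`-term of the potential along `C`; its order is 3
  -- + 3.
  set m := ∑ i, cst (c' i) * (cst (fun _ => Complex.I * (ε : ℂ)⁻¹)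
    * pd i (dirOp (coordFam q) V)) with hm
  have hm6 : m ∈ orderFam h n 6 := Submodule.sum_mem _ fun i _ =>
    mul_mem_orderFam (hc3 i) (mul_mem_orderFam hb0 (pd_mem_orderFam i hqV))
  have hpw : ∀ i, pd i w = cst (fun p => -(Complex.I * h p * (ε : ℂ)⁻¹))
      * (pd i V + coordFam r i) + cst (fun _ => Complex.I * (ε : ℂ)⁻¹)
        * pd i (dirOp (coordFam q) V) := fun i => by
    rw [hw, modPotFam, map_add, map_add, Derivation.leibniz, Derivation.leibniz, pd_cst, pd_cst,
      pd_cst, map_add, pd_linFam]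
    simp only [mul_zero, add_zero, smul_eq_mul, hV]
  -- The term `rᵀx` has constant derivatives and yields the second, constant summand, which
  -- disappears on commuting with the Laplacian; the `V₀` term yields the multiple of `g`.
  have hy : ∑ i, cst (c' i) * pd i w
      = cst (fun p => 12 * Complex.I * (h p : ℂ)⁻¹ * (ε : ℂ)⁻¹) * g
        + cst (∑ i, fun p => c' i p * -(Complex.I * h p * (ε : ℂ)⁻¹) * (r p i : ℂ)) + m := by
    simp only [hpw, mul_add, Finset.sum_add_distrib]
    rw [← cst_sum]
    congr 2
    · change _ = _ * (dirOp (coordFam v) V)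
      rw [dirOp, LinearMap.sum_apply, Finset.mul_sum]
      refine Finset.sum_congr rfl fun i _ => ?_
      refine Subtype.ext <| funext fun p => funext fun x => ?_
      change (-12 * ((h p : ℂ) ^ 2)⁻¹ * (v p i : ℂ)) * (-(Complex.I * h p * (ε : ℂ)⁻¹)
        * (pd i V).1 p x) = (12 * Complex.I * (h p : ℂ)⁻¹ * (ε : ℂ)⁻¹)
        * ((v p i : ℂ) * (pd i V).1 p x)
      have h2 : (h p : ℂ) ≠ 0 := Complex.ofReal_ne_zero.2 (hh p).1.ne'
      field_simp
    · exact Finset.sum_congr rfl fun i _ => Subtype.ext <| funext fun p => funext fun x =>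
        (mul_assoc (c' i p) _ _).symm
  -- The required normalisation is `ihε · 12ih⁻¹ε⁻¹ = -12`: this is what the factor 12 in `C₂` is
  -- chosen for.
  have key := nested_commutator_mem hh (s := fun i p => (s p i : ℂ)) hB hC hκ1
    (coordFam_mem_orderFam hs) hc3 hw1 hm6 hy fun p => by
      have h2 : (h p : ℂ) ≠ 0 := Complex.ofReal_ne_zero.2 (hh p).1.ne'
      have h3 : (ε : ℂ) ≠ 0 := Complex.ofReal_ne_zero.2 hε.ne'
      field_simp
      exact Complex.I_sq
  have hB1 : B ∈ orderOp h n 1 := by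
    refine add_mem (hI.mem_sub (hI.mul_mem (mulLeft_mem_orderOp hκ1) lapOp_mem_orderOp) ?_)
      (mulLeft_mem_orderOp hw1)
    exact orderOp_mono hh (by norm_num) (dirOp_mem_orderOp (coordFam_mem_orderFam hs))
  have hC3 : C ∈ orderOp h n 3 := dirOp_mem_orderOp hc3
  have hΘ1 : B + C + (lapOp * mulFam g - mulFam g * lapOp) ∈ orderOp h n 1 :=
    add_mem (add_mem hB1 (orderOp_mono hh (by norm_num) hC3))
      (hI.commutator_mem lapOp_mem_orderOp (mulLeft_mem_orderOp hg5))
  have hgp : ∀ p, g.1 p = fun x => ((inner ℝ (v p) (gradient V₀ x) : ℝ) : ℂ) := fun p =>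
    funext fun x => by
      rw [hg, realizes_dirOp_coordFam v V p]
      exact dirD_ofReal hV₀ _ _
  refine ⟨B, C, _, fun F p => funext fun x => ?_, fun F p => funext fun x => ?_,
    fun F p x => ?_, hB1, hC3, hΘ1, fun N hN => hI.splitting hB1 hC3 key hN⟩
  · change Complex.I * h p * ε * (lapOp F).1 p x - (dirOp (coordFam s) F).1 p x
      + w.1 p x * F.1 p x = Complex.I * h p * ε * lap (F.1 p) x - dirD (s p) (F.1 p) x + _ * F.1 p x
    rw [realizes_lapOp F p, realizes_dirOp_coordFam s F p, hw, modPotFam_apply]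
  · change _ = -12 * ((h p : ℂ) ^ 2)⁻¹ * dirD (v p) (F.1 p) x
    rw [dirD_eq_sum, hC, dirOp, LinearMap.sum_apply, SmoothFam.sum_apply, Finset.sum_apply,
      Finset.mul_sum]
    exact Finset.sum_congr rfl fun i _ => mul_assoc (-12 * ((h p : ℂ) ^ 2)⁻¹) (v p i : ℂ) _
  · change _ + _ + ((lapOp (g * F)).1 p x - g.1 p x * (lapOp F).1 p x) = _
    rw [realizes_lapOp (g * F) p, realizes_lapOp F p, ← hgp]
    rfl

end

/-! ### Iterated integrals -/

section
variable {E : Type*} [NormedAddCommGroup E] [NormedSpace ℝ E]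

/-- The moment `∫₀^ζ ξᵏ φ(ξ) dξ`. -/
def moment (k : ℕ) (φ : ℝ → E) (ζ : ℝ) : E := ∫ ξ in (0 : ℝ)..ζ, ξ ^ k • φ ξ

@[simp] theorem moment_at_zero (k : ℕ) (φ : ℝ → E) : moment k φ 0 = 0 := by simp [moment]

variable [CompleteSpace E]

theorem hasDerivAt_moment (k : ℕ) {φ : ℝ → E} (hφ : Continuous φ) (ζ : ℝ) :
    HasDerivAt (moment k φ) (ζ ^ k • φ ζ) ζ := by
  have h : Continuous fun ξ : ℝ => ξ ^ k • φ ξ := by fun_prop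
  exact intervalIntegral.integral_hasDerivAt_right (h.intervalIntegrable _ _)
    h.aestronglyMeasurable.stronglyMeasurableAtFilter h.continuousAt

theorem continuous_moment (k : ℕ) {φ : ℝ → E} (hφ : Continuous φ) : Continuous (moment k φ) :=
  continuous_iff_continuousAt.2 fun ζ => (hasDerivAt_moment k hφ ζ).continuousAt

/-- The iterated integrals below are evaluated from the inside out: a candidate in terms of moments
vanishes at zero and differentiates to the integrand, so the order of integration never has to be
exchanged. -/
theorem integral_eq_of_hasDerivAt {F F' : ℝ → E} (h : ∀ x, HasDerivAt F (F' x) x)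
    (hF' : Continuous F') (h0 : F 0 = 0) (a : ℝ) : ∫ x in (0 : ℝ)..a, F' x = F a := by
  rw [intervalIntegral.integral_eq_sub_of_hasDerivAt (fun x _ => h x)
    (hF'.intervalIntegrable _ _), h0, sub_zero]

theorem moment_clm {F : Type*} [NormedAddCommGroup F] [NormedSpace ℝ F] [CompleteSpace F]
    (ℓ : E →L[ℝ] F) (k : ℕ) {φ : ℝ → E} (hφ : Continuous φ) (ζ : ℝ) :
    moment k (fun ξ => ℓ (φ ξ)) ζ = ℓ (moment k φ ζ) := by
  have h : Continuous fun ξ : ℝ => ξ ^ k • φ ξ := by fun_prop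
  rw [moment, moment, ← ℓ.intervalIntegral_comp_comm (h.intervalIntegrable _ _)]
  simp

variable {φ : ℝ → E}

theorem integral_sub_const_left (hφ : Continuous φ) (v : E) (χ : ℝ) :
    ∫ ν in (0 : ℝ)..χ, (v - φ ν) = χ • v - moment 0 φ χ := by
  refine integral_eq_of_hasDerivAt (F := fun χ => χ • v - moment 0 φ χ) (fun x => ?_)
    (by fun_prop) (by simp) χ
  refine HasDerivAt.congr_deriv (((hasDerivAt_id x).smul_const v).sub (hasDerivAt_moment 0 hφ x)) ?_
  simp

theorem integral_smul_sub_moment (hφ : Continuous φ) (ζ : ℝ) :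
    ∫ χ in (0 : ℝ)..ζ, (χ • φ χ - moment 0 φ χ) = (2 : ℝ) • moment 1 φ ζ - ζ • moment 0 φ ζ := by
  have h0 := continuous_moment 0 hφ
  refine integral_eq_of_hasDerivAt (F := fun ζ => (2 : ℝ) • moment 1 φ ζ - ζ • moment 0 φ ζ)
    (fun x => ?_) (by fun_prop) (by simp) ζ
  refine HasDerivAt.congr_deriv (((hasDerivAt_moment 1 hφ x).const_smul (2 : ℝ)).sub
    ((hasDerivAt_id x).smul (hasDerivAt_moment 0 hφ x))) ?_
  simp only [id]
  module

theorem integral_sq_smul_sub (hφ : Continuous φ) (ζ : ℝ) :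
    ∫ ξ in (0 : ℝ)..ζ, ξ • (ξ • φ ξ - moment 0 φ ξ)
      = (3 / 2 : ℝ) • moment 2 φ ζ - (ζ ^ 2 / 2) • moment 0 φ ζ := by
  have h0 := continuous_moment 0 hφ
  refine integral_eq_of_hasDerivAt
    (F := fun ζ => (3 / 2 : ℝ) • moment 2 φ ζ - (ζ ^ 2 / 2) • moment 0 φ ζ)
    (fun x => ?_) (by fun_prop) (by simp) ζ
  refine HasDerivAt.congr_deriv (((hasDerivAt_moment 2 hφ x).const_smul (3 / 2 : ℝ)).sub
    (((hasDerivAt_pow 2 x).div_const 2).smul (hasDerivAt_moment 0 hφ x))) ?_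
  simp only [Nat.cast_ofNat, Nat.reduceSub]
  module

theorem integral_two_smul_sub (hφ : Continuous φ) (ζ : ℝ) :
    ∫ ξ in (0 : ℝ)..ζ, ((2 : ℝ) • moment 1 φ ξ - ξ • moment 0 φ ξ)
      = (2 * ζ) • moment 1 φ ζ - (3 / 2 : ℝ) • moment 2 φ ζ - (ζ ^ 2 / 2) • moment 0 φ ζ := by
  have h0 := continuous_moment 0 hφ
  have h1 := continuous_moment 1 hφ
  refine integral_eq_of_hasDerivAt (F := fun ζ => (2 * ζ) • moment 1 φ ζ
    - (3 / 2 : ℝ) • moment 2 φ ζ - (ζ ^ 2 / 2) • moment 0 φ ζ) (fun x => ?_) (by fun_prop)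
    (by simp) ζ
  refine HasDerivAt.congr_deriv (((((hasDerivAt_id x).const_mul 2).smul
    (hasDerivAt_moment 1 hφ x)).sub ((hasDerivAt_moment 2 hφ x).const_smul (3 / 2 : ℝ))).sub
    (((hasDerivAt_pow 2 x).div_const 2).smul (hasDerivAt_moment 0 hφ x))) ?_
  simp only [id, Nat.cast_ofNat, Nat.reduceSub]
  module

theorem integral_magnus41 (hφ : Continuous φ) (h : ℝ) :
    (∫ ζ in (0 : ℝ)..h, ∫ _ξ in (0 : ℝ)..ζ, ∫ χ in (0 : ℝ)..ζ, ∫ ν in (0 : ℝ)..χ, (φ χ - φ ν))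
      = h ^ 2 • moment 1 φ h - (2 / 3 : ℝ) • moment 3 φ h - (h ^ 3 / 3) • moment 0 φ h := by
  have h0 := continuous_moment 0 hφ
  have h1 := continuous_moment 1 hφ
  simp only [integral_sub_const_left hφ, integral_smul_sub_moment hφ,
    intervalIntegral.integral_const, sub_zero]
  refine integral_eq_of_hasDerivAt (F := fun h => h ^ 2 • moment 1 φ h
    - (2 / 3 : ℝ) • moment 3 φ h - (h ^ 3 / 3) • moment 0 φ h) (fun x => ?_) (by fun_prop)
    (by simp) h
  refine HasDerivAt.congr_deriv ((((hasDerivAt_pow 2 x).smul (hasDerivAt_moment 1 hφ x)).sub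
    ((hasDerivAt_moment 3 hφ x).const_smul (2 / 3 : ℝ))).sub
    (((hasDerivAt_pow 3 x).div_const 3).smul (hasDerivAt_moment 0 hφ x))) ?_
  simp only [Nat.cast_ofNat, Nat.reduceSub]
  module

theorem integral_magnus42 (hφ : Continuous φ) (h : ℝ) :
    (∫ ζ in (0 : ℝ)..h, ∫ ξ in (0 : ℝ)..ζ, ∫ _χ in (0 : ℝ)..ξ, ∫ ν in (0 : ℝ)..ξ, (φ ξ - φ ν))
      = (3 / 2 * h) • moment 2 φ h - (4 / 3 : ℝ) • moment 3 φ h - (h ^ 3 / 6) • moment 0 φ h := by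
  have h0 := continuous_moment 0 hφ
  have h2 := continuous_moment 2 hφ
  simp only [integral_sub_const_left hφ, intervalIntegral.integral_const, sub_zero,
    integral_sq_smul_sub hφ]
  refine integral_eq_of_hasDerivAt (F := fun h => (3 / 2 * h) • moment 2 φ h
    - (4 / 3 : ℝ) • moment 3 φ h - (h ^ 3 / 6) • moment 0 φ h) (fun x => ?_) (by fun_prop)
    (by simp) h
  refine HasDerivAt.congr_deriv (((((hasDerivAt_id x).const_mul (3 / 2 : ℝ)).smul
    (hasDerivAt_moment 2 hφ x)).sub ((hasDerivAt_moment 3 hφ x).const_smul (4 / 3 : ℝ))).sub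
    (((hasDerivAt_pow 3 x).div_const 6).smul (hasDerivAt_moment 0 hφ x))) ?_
  simp only [id, Nat.cast_ofNat, Nat.reduceSub]
  module

theorem integral_magnus43 (hφ : Continuous φ) (h : ℝ) :
    (∫ ζ in (0 : ℝ)..h, ∫ ξ in (0 : ℝ)..ζ, ∫ χ in (0 : ℝ)..ξ, ∫ ν in (0 : ℝ)..χ, (φ χ - φ ν))
      = h ^ 2 • moment 1 φ h - (3 / 2 * h) • moment 2 φ h + (2 / 3 : ℝ) • moment 3 φ h
        - (h ^ 3 / 6) • moment 0 φ h := by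
  have h0 := continuous_moment 0 hφ
  have h1 := continuous_moment 1 hφ
  have h2 := continuous_moment 2 hφ
  simp only [integral_sub_const_left hφ, integral_smul_sub_moment hφ, integral_two_smul_sub hφ]
  refine integral_eq_of_hasDerivAt (F := fun h => h ^ 2 • moment 1 φ h
    - (3 / 2 * h) • moment 2 φ h + (2 / 3 : ℝ) • moment 3 φ h - (h ^ 3 / 6) • moment 0 φ h)
    (fun x => ?_) (by fun_prop) (by simp) h
  refine HasDerivAt.congr_deriv (((((hasDerivAt_pow 2 x).smul (hasDerivAt_moment 1 hφ x)).sub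
    (((hasDerivAt_id x).const_mul (3 / 2 : ℝ)).smul (hasDerivAt_moment 2 hφ x))).add
    ((hasDerivAt_moment 3 hφ x).const_smul (2 / 3 : ℝ))).sub
    (((hasDerivAt_pow 3 x).div_const 6).smul (hasDerivAt_moment 0 hφ x))) ?_
  simp only [id, Nat.cast_ofNat, Nat.reduceSub]
  module

/-- The fourth-order iterated integrals combine to the Bernoulli moment of order three. -/
theorem integral_magnus4 (hφ : Continuous φ) (h : ℝ) :
    -(1 / 12 : ℝ) • (∫ ζ in (0 : ℝ)..h, ∫ _ξ in (0 : ℝ)..ζ, ∫ χ in (0 : ℝ)..ζ,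
        ∫ ν in (0 : ℝ)..χ, (φ χ - φ ν))
      - (1 / 12 : ℝ) • (∫ ζ in (0 : ℝ)..h, ∫ ξ in (0 : ℝ)..ζ, ∫ _χ in (0 : ℝ)..ξ,
        ∫ ν in (0 : ℝ)..ξ, (φ ξ - φ ν))
      + (1 / 4 : ℝ) • (∫ ζ in (0 : ℝ)..h, ∫ ξ in (0 : ℝ)..ζ, ∫ χ in (0 : ℝ)..ξ,
        ∫ ν in (0 : ℝ)..χ, (φ χ - φ ν))
      = (1 / 3 : ℝ) • (moment 3 φ h - (3 / 2 * h) • moment 2 φ h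
        + (h ^ 2 / 2) • moment 1 φ h) := by
  -- The zeroth moments cancel, `1/36 + 1/72 - 1/24 = 0`, in accordance with the vanishing constant
  -- term of `B₃`.
  rw [integral_magnus41 hφ, integral_magnus42 hφ, integral_magnus43 hφ]
  module

theorem integral_magnus2 (hφ : Continuous φ) (h : ℝ) :
    (∫ ζ in (0 : ℝ)..h, ∫ ξ in (0 : ℝ)..ζ, (φ ζ - φ ξ))
      = (2 : ℝ) • moment 1 φ h - h • moment 0 φ h := by
  simp only [integral_sub_const_left hφ, integral_smul_sub_moment hφ]

end

/-! ### Iterated integrals of inner products, for the third-order terms -/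

section
variable {E : Type*} [NormedAddCommGroup E] [InnerProductSpace ℝ E] [CompleteSpace E]
  {φ : ℝ → E}

theorem integral_inner_left (u : E) (v : E) (hφ : Continuous φ) (ζ : ℝ) :
    ∫ χ in (0 : ℝ)..ζ, inner ℝ (u - φ χ) v = inner ℝ (ζ • u - moment 0 φ ζ) v := by
  refine integral_eq_of_hasDerivAt (F := fun ζ => inner ℝ (ζ • u - moment 0 φ ζ) v)
    (fun x => ?_) (by fun_prop) (by simp) ζ
  refine HasDerivAt.congr_deriv ((((hasDerivAt_id x).smul_const u).sub
    (hasDerivAt_moment 0 hφ x)).inner ℝ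
    (hasDerivAt_const x v)) ?_
  simp

theorem integral_inner_right (u : E) (v : E) (hφ : Continuous φ) (ζ : ℝ) :
    ∫ χ in (0 : ℝ)..ζ, inner ℝ u (v + φ χ) = inner ℝ u (ζ • v + moment 0 φ ζ) := by
  refine integral_eq_of_hasDerivAt (F := fun ζ => inner ℝ u (ζ • v + moment 0 φ ζ))
    (fun x => ?_) (by fun_prop) (by simp) ζ
  refine HasDerivAt.congr_deriv ((hasDerivAt_const x u).inner ℝ
    (((hasDerivAt_id x).smul_const v).add (hasDerivAt_moment 0 hφ x))) ?_
  simp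

/-- The primitive `∫₀^ζ τ φ(τ)ᵀ ∫₀^τ φ dτ`. -/
def corr (φ : ℝ → E) (ζ : ℝ) : ℝ := ∫ τ in (0 : ℝ)..ζ, τ * inner ℝ (φ τ) (moment 0 φ τ)

theorem hasDerivAt_corr (hφ : Continuous φ) (ζ : ℝ) :
    HasDerivAt (corr φ) (ζ * inner ℝ (φ ζ) (moment 0 φ ζ)) ζ := by
  have h0 := continuous_moment 0 hφ
  have h : Continuous fun τ => τ * inner ℝ (φ τ) (moment 0 φ τ) := by fun_prop
  exact intervalIntegral.integral_hasDerivAt_right (h.intervalIntegrable _ _)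
    h.aestronglyMeasurable.stronglyMeasurableAtFilter h.continuousAt

/-- The vector `N` stands for `∇V₀(x)`: terms with `N` go into `q`, terms without it into the phase
`c`. The quadratic integral `corr` is kept as a separate primitive besides the moments. -/
theorem integral_magnus31 (hφ : Continuous φ) (N : E) (h : ℝ) :
    (∫ ζ in (0 : ℝ)..h, ∫ ξ in (0 : ℝ)..ζ, ∫ χ in (0 : ℝ)..ζ, inner ℝ (φ ζ - φ χ) (N + φ ξ))
      = inner ℝ ((3 / 2 : ℝ) • moment 2 φ h - (h ^ 2 / 2) • moment 0 φ h) N + 3 * corr φ h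
        - h * inner ℝ (moment 0 φ h) (moment 0 φ h) := by
  have h0 := continuous_moment 0 hφ
  simp only [integral_inner_left _ _ hφ, integral_inner_right _ _ hφ]
  refine integral_eq_of_hasDerivAt (F := fun h =>
    inner ℝ ((3 / 2 : ℝ) • moment 2 φ h - (h ^ 2 / 2) • moment 0 φ h) N + 3 * corr φ h
        - h * inner ℝ (moment 0 φ h) (moment 0 φ h)) (fun x => ?_) (by fun_prop)
    (by simp [corr]) h
  have d0 := hasDerivAt_moment 0 hφ x
  refine HasDerivAt.congr_deriv ((((((hasDerivAt_moment 2 hφ x).const_smul (3 / 2 : ℝ)).sub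
    (((hasDerivAt_pow 2 x).div_const 2).smul d0)).inner ℝ (hasDerivAt_const x N)).add
    ((hasDerivAt_corr hφ x).const_mul 3)).sub ((hasDerivAt_id x).mul (d0.inner ℝ d0))) ?_
  simp only [inner_add_left, inner_sub_left, inner_add_right, real_inner_smul_left,
    real_inner_smul_right, id, inner_zero_right, real_inner_comm (φ x) (moment 0 φ x),
    Nat.cast_ofNat]
  ring

theorem integral_magnus32 (hφ : Continuous φ) (N : E) (h : ℝ) :
    (∫ ζ in (0 : ℝ)..h, ∫ ξ in (0 : ℝ)..ζ, ∫ χ in (0 : ℝ)..ξ, inner ℝ (φ ξ - φ χ) (N + φ ζ))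
      = inner ℝ ((2 * h) • moment 1 φ h - (3 / 2 : ℝ) • moment 2 φ h
        - (h ^ 2 / 2) • moment 0 φ h) N
        + 2 * inner ℝ (moment 1 φ h) (moment 0 φ h) - 3 * corr φ h := by
  have h0 := continuous_moment 0 hφ
  have h1 := continuous_moment 1 hφ
  have hin : ∀ ζ v, ∫ ξ in (0 : ℝ)..ζ, inner ℝ (ξ • φ ξ - moment 0 φ ξ) v
      = inner ℝ ((2 : ℝ) • moment 1 φ ζ - ζ • moment 0 φ ζ) v := fun ζ v => by
    refine integral_eq_of_hasDerivAt
      (F := fun ζ => inner ℝ ((2 : ℝ) • moment 1 φ ζ - ζ • moment 0 φ ζ) v)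
      (fun x => ?_) (by fun_prop) (by simp) ζ
    refine HasDerivAt.congr_deriv ((((hasDerivAt_moment 1 hφ x).const_smul (2 : ℝ)).sub
      ((hasDerivAt_id x).smul (hasDerivAt_moment 0 hφ x))).inner ℝ (hasDerivAt_const x v)) ?_
    rw [inner_zero_right, zero_add]
    congr 1
    simp only [id]
    module
  simp only [integral_inner_left _ _ hφ, hin]
  refine integral_eq_of_hasDerivAt (F := fun h => inner ℝ ((2 * h) • moment 1 φ h
    - (3 / 2 : ℝ) • moment 2 φ h - (h ^ 2 / 2) • moment 0 φ h) N
    + 2 * inner ℝ (moment 1 φ h) (moment 0 φ h) - 3 * corr φ h) (fun x => ?_) (by fun_prop)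
    (by simp [corr]) h
  have d0 := hasDerivAt_moment 0 hφ x
  have d1 := hasDerivAt_moment 1 hφ x
  refine HasDerivAt.congr_deriv ((((((((hasDerivAt_id x).const_mul 2).smul d1).sub
    ((hasDerivAt_moment 2 hφ x).const_smul (3 / 2 : ℝ))).sub
    (((hasDerivAt_pow 2 x).div_const 2).smul d0)).inner ℝ (hasDerivAt_const x N)).add
    ((d1.inner ℝ d0).const_mul 2)).sub ((hasDerivAt_corr hφ x).const_mul 3)) ?_
  simp only [inner_add_left, inner_sub_left, inner_add_right, real_inner_smul_left,
    real_inner_smul_right, id, inner_zero_right, real_inner_comm (φ x) (moment 0 φ x),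
    Nat.cast_ofNat]
  ring

end

/-! ### Commutators of Schrödinger operators -/

section
variable {n : ℕ}

theorem smooth_add {f g : Space n → ℂ} (hf : ContDiff ℝ ∞ f) (hg : ContDiff ℝ ∞ g) :
    ContDiff ℝ ∞ (f + g) := hf.add hg

theorem smooth_mul {f g : Space n → ℂ} (hf : ContDiff ℝ ∞ f) (hg : ContDiff ℝ ∞ g) :
    ContDiff ℝ ∞ (f * g) := hf.mul hg

theorem smooth_smul (c : ℂ) {f : Space n → ℂ} (hf : ContDiff ℝ ∞ f) : ContDiff ℝ ∞ (c • f) :=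
  hf.const_smul c

theorem lap_eq_fun_sum {f : Space n → ℂ} (hf : ContDiff ℝ ∞ f) :
    lap f = ∑ i, dirD (basisVec i) (dirD (basisVec i) f) :=
  funext fun x => by rw [lap_eq_sum hf, Finset.sum_apply]

theorem contDiff_lap {f : Space n → ℂ} (hf : ContDiff ℝ ∞ f) : ContDiff ℝ ∞ (lap f) := by
  have h : lap f = fun x => ∑ i, dirD (basisVec i) (dirD (basisVec i) f) x :=
    funext (lap_eq_sum hf)
  rw [h]
  exact ContDiff.sum fun i _ => contDiff_dirD _ (contDiff_dirD _ hf)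

theorem lap_add {f g : Space n → ℂ} (hf : ContDiff ℝ ∞ f) (hg : ContDiff ℝ ∞ g) :
    lap (f + g) = lap f + lap g := by
  rw [lap_eq_fun_sum hf, lap_eq_fun_sum hg, lap_eq_fun_sum (smooth_add hf hg),
    ← Finset.sum_add_distrib]
  refine Finset.sum_congr rfl fun i _ => ?_
  rw [dirD_add _ hf hg, dirD_add _ (contDiff_dirD _ hf) (contDiff_dirD _ hg)]

theorem lap_smul (c : ℂ) {f : Space n → ℂ} (hf : ContDiff ℝ ∞ f) : lap (c • f) = c • lap f := by
  rw [lap_eq_fun_sum hf, lap_eq_fun_sum (smooth_smul c hf), Finset.smul_sum]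
  refine Finset.sum_congr rfl fun i _ => ?_
  rw [dirD_smul _ c hf, dirD_smul _ c (contDiff_dirD _ hf)]

theorem lap_dirD (a : Space n) {f : Space n → ℂ} (hf : ContDiff ℝ ∞ f) :
    lap (dirD a f) = dirD a (lap f) := by
  have h : ∀ s : Finset (Fin n), dirD a (∑ i ∈ s, dirD (basisVec i) (dirD (basisVec i) f))
      = ∑ i ∈ s, dirD a (dirD (basisVec i) (dirD (basisVec i) f)) := fun s => by
    induction s using Finset.cons_induction with
    | empty => exact dirD_const a 0
    | cons i s hi ih =>
      rw [Finset.sum_cons, Finset.sum_cons, dirD_add _ (contDiff_dirD _ (contDiff_dirD _ hf)), ih]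
      have : (∑ i ∈ s, dirD (basisVec i) (dirD (basisVec i) f))
          = fun x => ∑ i ∈ s, dirD (basisVec i) (dirD (basisVec i) f) x :=
        funext fun x => Finset.sum_apply ..
      rw [this]
      exact ContDiff.sum fun i _ => contDiff_dirD _ (contDiff_dirD _ hf)
  rw [lap_eq_fun_sum hf, lap_eq_fun_sum (contDiff_dirD a hf), h]
  refine Finset.sum_congr rfl fun i _ => ?_
  rw [dirD_comm _ a hf, dirD_comm _ a (contDiff_dirD _ hf)]

theorem mulOp_eq_mul (g f : Space n → ℂ) : mulOp g f = g * f := rfl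

theorem comm_lap_mulOp_apply {f g : Space n → ℂ} (hf : ContDiff ℝ ∞ f) (hg : ContDiff ℝ ∞ g)
    (x : Space n) : comm lap (mulOp g) f x
      = lap g x * f x + 2 * ∑ i, dirD (basisVec i) g x * dirD (basisVec i) f x := by
  change lap (g * f) x - g x * lap f x = _
  have h : ∀ i, dirD (basisVec i) (dirD (basisVec i) (g * f)) x
      = dirD (basisVec i) (dirD (basisVec i) g) x * f x
        + 2 * (dirD (basisVec i) g x * dirD (basisVec i) f x)
        + g x * dirD (basisVec i) (dirD (basisVec i) f) x := fun i => by
    have hfi := contDiff_dirD (basisVec i) hf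
    have hgi := contDiff_dirD (basisVec i) hg
    rw [dirD_mul _ hg hf, dirD_add _ (smooth_mul hgi hf) (smooth_mul hg hfi), dirD_mul _ hgi hf,
      dirD_mul _ hg hfi]
    simp only [Pi.add_apply, Pi.mul_apply]
    ring
  rw [lap_eq_sum (smooth_mul hg hf), lap_eq_sum hf, lap_eq_sum hg,
    Finset.sum_congr rfl fun i _ => h i,
    Finset.sum_add_distrib, Finset.sum_add_distrib, Finset.sum_mul, Finset.mul_sum, Finset.mul_sum]
  ring

theorem comm_lap_mulOp_add {f g g' : Space n → ℂ} (hf : ContDiff ℝ ∞ f) (hg : ContDiff ℝ ∞ g)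
    (hg' : ContDiff ℝ ∞ g') :
    comm lap (mulOp (g + g')) f = comm lap (mulOp g) f + comm lap (mulOp g') f := by
  have h : mulOp (g + g') f = g * f + g' * f := add_mul g g' f
  have h' : mulOp (g + g') (lap f) = g * lap f + g' * lap f := add_mul g g' _
  rw [comm, h, h', lap_add (smooth_mul hg hf) (smooth_mul hg' hf)]
  exact add_sub_add_comm _ _ _ _

theorem comm_lap_mulOp_smul {f g : Space n → ℂ} (c : ℂ) (hf : ContDiff ℝ ∞ f)
    (hg : ContDiff ℝ ∞ g) : comm lap (mulOp (c • g)) f = c • comm lap (mulOp g) f := by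
  have h : mulOp (c • g) f = c • (g * f) := smul_mul_assoc c g f
  have h' : mulOp (c • g) (lap f) = c • (g * lap f) := smul_mul_assoc c g _
  rw [comm, h, h', lap_smul c (smooth_mul hg hf), ← smul_sub]
  rfl

theorem comm_lap_mulOp_const {f : Space n → ℂ} (c : ℂ) (hf : ContDiff ℝ ∞ f) :
    comm lap (mulOp fun _ => c) f = 0 := by
  have h : mulOp (fun _ => c) f = c • f := rfl
  have h' : mulOp (fun _ => c) (lap f) = c • lap f := rfl
  rw [comm, h, h', lap_smul c hf, sub_self]

/-- The complexified linear function `bᵀx`. -/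
def lin (b : Space n) : Space n → ℂ := fun x => ((inner ℝ b x : ℝ) : ℂ)

theorem contDiff_lin (b : Space n) : ContDiff ℝ ∞ (lin b) :=
  contDiff_ofReal_comp (innerSL ℝ b).contDiff

theorem comm_lap_lin (b : Space n) {f : Space n → ℂ} (hf : ContDiff ℝ ∞ f) :
    comm lap (mulOp (lin b)) f = dirD ((2 : ℝ) • b) f := by
  funext x
  have h : ∀ i, dirD (basisVec i) (lin b) = fun _ => (b i : ℂ) := fun i => funext fun y => by
    refine (dirD_inner _ _ _).trans ?_
    simp [basisVec, EuclideanSpace.inner_single_right]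
  rw [comm_lap_mulOp_apply hf (contDiff_lin b), lap_eq_sum (contDiff_lin b), dirD_eq_sum]
  simp only [h, dirD_const, Pi.zero_apply, Finset.sum_const_zero, zero_mul, zero_add,
    Finset.mul_sum]
  refine Finset.sum_congr rfl fun i _ => ?_
  simp [mul_assoc]

theorem comm_neg_swap (A B : Op n) (f : Space n → ℂ) : comm A B f = -comm B A f :=
  (neg_sub _ _).symm

/-- Commutator identities are available on smooth functions only. To substitute one inside another
commutator, the remaining operator must preserve smoothness. -/
theorem comm_congr_left {A A' B : Op n} (hA : ∀ f, ContDiff ℝ ∞ f → A f = A' f)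
    (hB : ∀ f, ContDiff ℝ ∞ f → ContDiff ℝ ∞ (B f)) {f : Space n → ℂ} (hf : ContDiff ℝ ∞ f) :
    comm A B f = comm A' B f := by
  rw [comm, comm, hA _ (hB f hf), hA f hf]

theorem comm_congr_right {A B B' : Op n} (hB : ∀ f, ContDiff ℝ ∞ f → B f = B' f)
    (hA : ∀ f, ContDiff ℝ ∞ f → ContDiff ℝ ∞ (A f)) {f : Space n → ℂ} (hf : ContDiff ℝ ∞ f) :
    comm A B f = comm A B' f := by
  rw [comm, comm, hB _ (hA f hf), hB f hf]

variable {ε : ℝ} {V₀ : Space n → ℝ} {e : ℝ → Space n}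

theorem schr_eq (ε : ℝ) (V₀ : Space n → ℝ) (e : ℝ → Space n) (s : ℝ) (f : Space n → ℂ) :
    schr ε V₀ e s f = (Complex.I * ε) • lap f
      + -(Complex.I * (ε : ℂ)⁻¹) • (mulOp (fun x => (V₀ x : ℂ)) f + mulOp (lin (e s)) f) := by
  funext x
  simp only [schr, mulOp, lin, Pi.add_apply, Pi.smul_apply, smul_eq_mul]
  push_cast
  ring

theorem contDiff_schr (hV₀ : ContDiff ℝ ∞ V₀) (s : ℝ) (f : Space n → ℂ) (hf : ContDiff ℝ ∞ f) :
    ContDiff ℝ ∞ (schr ε V₀ e s f) := by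
  rw [schr_eq]
  exact smooth_add (smooth_smul _ (contDiff_lap hf)) (smooth_smul _ (smooth_add
    (smooth_mul (contDiff_ofReal_comp hV₀) hf) (smooth_mul (contDiff_lin _) hf)))

theorem I_mul_mul_I_mul_inv (hε : 0 < ε) :
    (Complex.I * ε) * -(Complex.I * (ε : ℂ)⁻¹) = 1 := by
  have h : (ε : ℂ) ≠ 0 := Complex.ofReal_ne_zero.2 hε.ne'
  calc (Complex.I * ε) * -(Complex.I * (ε : ℂ)⁻¹)
      = -(Complex.I * Complex.I) * (ε * (ε : ℂ)⁻¹) := by ring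
    _ = 1 := by rw [mul_inv_cancel₀ h, Complex.I_mul_I]; norm_num

theorem comm_schr_mulOp (s : ℝ) (f g : Space n → ℂ) :
    comm (schr ε V₀ e s) (mulOp g) f = (Complex.I * ε) • comm lap (mulOp g) f := by
  funext x
  change schr ε V₀ e s (g * f) x - g x * schr ε V₀ e s f x
    = Complex.I * ε * (lap (g * f) x - g x * lap f x)
  simp only [schr, mulOp, Pi.add_apply, Pi.smul_apply, smul_eq_mul, Pi.mul_apply]
  ring

/-- The second operator is the first plus multiplication by a linear function, and the Laplacian
sends that to a constant-coefficient derivative. The factors `iε` and `-iε⁻¹` multiply to one, so no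
`ε` survives. -/
theorem comm_schr_schr (hε : 0 < ε) (hV₀ : ContDiff ℝ ∞ V₀) (s s' : ℝ) {f : Space n → ℂ}
    (hf : ContDiff ℝ ∞ f) :
    comm (schr ε V₀ e s) (schr ε V₀ e s') f = dirD ((2 : ℝ) • (e s' - e s)) f := by
  set k := -(Complex.I * (ε : ℂ)⁻¹) with hk
  have hδ : ∀ f, schr ε V₀ e s' f = schr ε V₀ e s f + mulOp (k • lin (e s' - e s)) f := by
    intro f
    funext x
    simp only [schr_eq, mulOp, lin, Pi.add_apply, Pi.smul_apply, smul_eq_mul, inner_sub_left, ← hk]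
    push_cast
    ring
  have hs : ContDiff ℝ ∞ (k • lin (e s' - e s)) := (contDiff_lin _).const_smul k
  have hadd : ∀ f g, ContDiff ℝ ∞ f → ContDiff ℝ ∞ g →
      schr ε V₀ e s (f + g) = schr ε V₀ e s f + schr ε V₀ e s g := by
    intro f g hf hg
    funext x
    simp only [schr, mulOp, Pi.add_apply, Pi.smul_apply, smul_eq_mul, lap_add hf hg]
    ring
  have h1 : comm (schr ε V₀ e s) (schr ε V₀ e s') f
      = comm (schr ε V₀ e s) (mulOp (k • lin (e s' - e s))) f := by
    rw [comm, comm, hδ, hδ, hadd _ (mulOp (k • lin (e s' - e s)) f) (contDiff_schr hV₀ s f hf)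
      (smooth_mul hs hf)]
    abel
  rw [h1, comm_schr_mulOp s f, comm_lap_mulOp_smul k hf (contDiff_lin _), smul_smul,
    I_mul_mul_I_mul_inv hε, one_smul, comm_lap_lin _ hf]

/-- The multiplier `-iε⁻¹ (aᵀ(∇V₀)(x) + aᵀb)`. -/
def forceFn (ε : ℝ) (V₀ : Space n → ℝ) (a b : Space n) : Space n → ℂ :=
  -(Complex.I * (ε : ℂ)⁻¹) • (dirD a (fun x => (V₀ x : ℂ)) + fun _ => ((inner ℝ a b : ℝ) : ℂ))

/-- The Laplacian commutes with `aᵀ∇`, so only the derivative of the potential remains. -/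
theorem comm_dirD_schr (hV₀ : ContDiff ℝ ∞ V₀) (a : Space n) (s : ℝ) {f : Space n → ℂ}
    (hf : ContDiff ℝ ∞ f) :
    comm (dirD a) (schr ε V₀ e s) f = mulOp (forceFn ε V₀ a (e s)) f := by
  have hV := contDiff_ofReal_comp hV₀
  have hL := contDiff_lin (e s)
  have hlin : dirD a (lin (e s)) = fun _ => ((inner ℝ a (e s) : ℝ) : ℂ) := funext fun x => by
    exact (dirD_inner _ _ _).trans (by rw [real_inner_comm])
  have h : dirD a (schr ε V₀ e s f) = (Complex.I * ε) • lap (dirD a f)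
      + -(Complex.I * (ε : ℂ)⁻¹) • ((dirD a (fun x => (V₀ x : ℂ)) * f
        + (fun x => (V₀ x : ℂ)) * dirD a f) + ((fun _ => ((inner ℝ a (e s) : ℝ) : ℂ)) * f
        + lin (e s) * dirD a f)) := by
    have hVf := smooth_mul hV hf
    have hLf := smooth_mul hL hf
    rw [schr_eq, mulOp_eq_mul, mulOp_eq_mul,
      dirD_add _ (smooth_smul _ (contDiff_lap hf)) (smooth_smul _ (smooth_add hVf hLf)),
      dirD_smul _ _ (contDiff_lap hf), lap_dirD a hf]
    congr 1
    refine (dirD_smul a _ (smooth_add hVf hLf)).trans ?_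
    congr 1
    refine (dirD_add a hVf hLf).trans ?_
    rw [← hlin]
    exact congrArg₂ (· + ·) (dirD_mul a hV hf) (dirD_mul a hL hf)
  rw [comm, h, schr_eq]
  funext x
  simp only [mulOp, forceFn, Pi.add_apply, Pi.sub_apply, Pi.smul_apply, Pi.mul_apply, smul_eq_mul]
  ring

/-- The second-order commutator `[Δ, aᵀ∇V₀]`. -/
def secOp (V₀ : Space n → ℝ) (a : Space n) : Op n :=
  comm lap (mulOp (dirD a fun x => (V₀ x : ℂ)))

/-- The potential of the Schrödinger operator commutes with a multiplication and the constant `aᵀb`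
commutes with the Laplacian. Hence neither `s` nor `b` matters, and each fourth-order commutator
depends on just two of its four times. -/
theorem comm_schr_forceFn (hε : 0 < ε) (hV₀ : ContDiff ℝ ∞ V₀) (a b : Space n) (s : ℝ)
    {f : Space n → ℂ} (hf : ContDiff ℝ ∞ f) :
    comm (schr ε V₀ e s) (mulOp (forceFn ε V₀ a b)) f = secOp V₀ a f := by
  have h := contDiff_dirD a (contDiff_ofReal_comp hV₀)
  rw [comm_schr_mulOp s f, forceFn,
    comm_lap_mulOp_smul _ hf (smooth_add h contDiff_const), smul_smul, I_mul_mul_I_mul_inv hε,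
    one_smul, comm_lap_mulOp_add hf h contDiff_const, comm_lap_mulOp_const _ hf, add_zero, secOp]

/-- At fixed `f` and `x` the value is linear in `a`, hence continuous in finite dimension. This lets
the fourfold time integrals pass to the field itself. -/
theorem exists_clm_secOp (hV₀ : ContDiff ℝ ∞ V₀) {f : Space n → ℂ} (hf : ContDiff ℝ ∞ f)
    (x : Space n) : ∃ ℓ : Space n →L[ℝ] ℂ, ∀ a, secOp V₀ a f x = ℓ a := by
  have hV := contDiff_ofReal_comp hV₀
  let L : Space n →ₗ[ℝ] ℂ :=
    { toFun := fun a => secOp V₀ a f x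
      map_add' := fun a b => by
        have : dirD (a + b) (fun x => (V₀ x : ℂ))
            = dirD a (fun x => (V₀ x : ℂ)) + dirD b fun x => (V₀ x : ℂ) :=
          funext fun y => map_add _ a b
        rw [secOp, this, comm_lap_mulOp_add hf (contDiff_dirD a hV) (contDiff_dirD b hV)]
        rfl
      map_smul' := fun c a => by
        have : dirD (c • a) (fun x => (V₀ x : ℂ)) = (c : ℂ) • dirD a (fun x => (V₀ x : ℂ)) :=
          funext fun y => (map_smul _ c a).trans (Complex.real_smul ..)
        rw [secOp, this, comm_lap_mulOp_smul _ hf (contDiff_dirD a hV)]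
        exact (Complex.real_smul ..).symm }
  exact ⟨LinearMap.toContinuousLinearMap L, fun a => rfl⟩

theorem secOp_neg (hV₀ : ContDiff ℝ ∞ V₀) {f : Space n → ℂ} (hf : ContDiff ℝ ∞ f) (a : Space n) :
    secOp V₀ (-a) f = -secOp V₀ a f := funext fun x => by
  obtain ⟨ℓ, hℓ⟩ := exists_clm_secOp hV₀ hf x
  rw [Pi.neg_apply, hℓ, hℓ, map_neg]

theorem forceFn_neg (a b : Space n) : forceFn ε V₀ (-a) b = -forceFn ε V₀ a b := funext fun x => by
  simp only [forceFn, dirD, Pi.smul_apply, Pi.add_apply, Pi.neg_apply, map_neg, inner_neg_left,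
    smul_eq_mul]
  push_cast
  ring

theorem comm_comm_schr_right (hε : 0 < ε) (hV₀ : ContDiff ℝ ∞ V₀) {f : Space n → ℂ}
    (hf : ContDiff ℝ ∞ f) (a b c : ℝ) :
    comm (schr ε V₀ e a) (comm (schr ε V₀ e b) (schr ε V₀ e c)) f
      = mulOp (forceFn ε V₀ ((2 : ℝ) • (e b - e c)) (e a)) f := by
  rw [comm_congr_right (fun f hf => comm_schr_schr hε hV₀ b c hf) (contDiff_schr hV₀ a) hf,
    comm_neg_swap, comm_dirD_schr hV₀ _ a hf, ← neg_sub (e c), smul_neg, forceFn_neg]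
  exact (neg_mul _ f).symm

theorem comm_comm_schr_left (hε : 0 < ε) (hV₀ : ContDiff ℝ ∞ V₀) {f : Space n → ℂ}
    (hf : ContDiff ℝ ∞ f) (a b c : ℝ) :
    comm (comm (schr ε V₀ e a) (schr ε V₀ e b)) (schr ε V₀ e c) f
      = mulOp (forceFn ε V₀ ((2 : ℝ) • (e b - e a)) (e c)) f := by
  rw [comm_congr_left (fun f hf => comm_schr_schr hε hV₀ a b hf) (contDiff_schr hV₀ c) hf,
    comm_dirD_schr hV₀ _ c hf]

theorem comm_comm_comm_schr_41 (hε : 0 < ε) (hV₀ : ContDiff ℝ ∞ V₀) {f : Space n → ℂ}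
    (hf : ContDiff ℝ ∞ f) (a b c d : ℝ) :
    comm (schr ε V₀ e a) (comm (comm (schr ε V₀ e b) (schr ε V₀ e c)) (schr ε V₀ e d)) f
      = secOp V₀ ((2 : ℝ) • (e c - e b)) f := by
  rw [comm_congr_right (fun f hf => comm_comm_schr_left hε hV₀ hf b c d) (contDiff_schr hV₀ a) hf,
    comm_schr_forceFn hε hV₀ _ _ _ hf]

theorem comm_comm_comm_schr_42 (hε : 0 < ε) (hV₀ : ContDiff ℝ ∞ V₀) {f : Space n → ℂ}
    (hf : ContDiff ℝ ∞ f) (a b c d : ℝ) :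
    comm (comm (schr ε V₀ e a) (comm (schr ε V₀ e b) (schr ε V₀ e c))) (schr ε V₀ e d) f
      = secOp V₀ ((2 : ℝ) • (e c - e b)) f := by
  rw [comm_congr_left (fun f hf => comm_comm_schr_right hε hV₀ hf a b c) (contDiff_schr hV₀ d) hf,
    comm_neg_swap, comm_schr_forceFn hε hV₀ _ _ _ hf, ← secOp_neg hV₀ hf, ← smul_neg, neg_sub]

theorem comm_comm_comm_schr_43 (hε : 0 < ε) (hV₀ : ContDiff ℝ ∞ V₀) {f : Space n → ℂ}
    (hf : ContDiff ℝ ∞ f) (a b c d : ℝ) :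
    comm (comm (comm (schr ε V₀ e a) (schr ε V₀ e b)) (schr ε V₀ e c)) (schr ε V₀ e d) f
      = -secOp V₀ ((2 : ℝ) • (e b - e a)) f := by
  rw [comm_congr_left (fun f hf => comm_comm_schr_left hε hV₀ hf a b c) (contDiff_schr hV₀ d) hf,
    comm_neg_swap, comm_schr_forceFn hε hV₀ _ _ _ hf]

end

/-! ### The Magnus expansion in closed form -/

section
variable {n : ℕ}

theorem bernoulliFun_three (x : ℝ) : bernoulliFun 3 x = x ^ 3 - 3 / 2 * x ^ 2 + x / 2 := by
  simp [bernoulliFun, Polynomial.bernoulli_def, Finset.sum_range_succ]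
  norm_num [bernoulli, bernoulli'_two, Nat.choose]
  ring

theorem mu_zero (e : ℝ → Space n) (t h : ℝ) : mu 0 e t h = moment 0 (fun ζ => e (t + ζ)) h := by
  simp [mu, moment]

theorem mu_one {e : ℝ → Space n} (he : Continuous e) (t : ℝ) {h : ℝ} (hh : h ≠ 0) :
    mu 1 e t h = moment 1 (fun ζ => e (t + ζ)) h
      - (h / 2) • moment 0 (fun ζ => e (t + ζ)) h := by
  have hφ : Continuous fun ζ => e (t + ζ) := by fun_prop
  have h1 : ∀ ζ, (h ^ 1 * bernoulliFun 1 (ζ / h)) • e (t + ζ) = (ζ - h / 2) • e (t + ζ) := by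
    intro ζ
    rw [bernoulliFun_one]
    congr 1
    field_simp
  rw [mu]
  simp only [h1]
  refine integral_eq_of_hasDerivAt (F := fun ζ => moment 1 (fun ζ => e (t + ζ)) ζ
    - (h / 2) • moment 0 (fun ζ => e (t + ζ)) ζ) (fun x => ?_) (by fun_prop) (by simp) h
  refine ((hasDerivAt_moment 1 hφ x).sub
    ((hasDerivAt_moment 0 hφ x).const_smul (h / 2))).congr_deriv ?_
  module

theorem mu_two {e : ℝ → Space n} (he : Continuous e) (t : ℝ) {h : ℝ} (hh : h ≠ 0) :
    mu 2 e t h = moment 2 (fun ζ => e (t + ζ)) h - h • moment 1 (fun ζ => e (t + ζ)) h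
      + (h ^ 2 / 6) • moment 0 (fun ζ => e (t + ζ)) h := by
  have hφ : Continuous fun ζ => e (t + ζ) := by fun_prop
  have h1 : ∀ ζ, (h ^ 2 * bernoulliFun 2 (ζ / h)) • e (t + ζ)
      = (ζ ^ 2 - h * ζ + h ^ 2 / 6) • e (t + ζ) := by
    intro ζ
    rw [bernoulliFun_two]
    congr 1
    field_simp
  rw [mu]
  simp only [h1]
  refine integral_eq_of_hasDerivAt (F := fun ζ => moment 2 (fun ζ => e (t + ζ)) ζ
    - h • moment 1 (fun ζ => e (t + ζ)) ζ + (h ^ 2 / 6) • moment 0 (fun ζ => e (t + ζ)) ζ)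
    (fun x => ?_) (by fun_prop) (by simp) h
  refine (((hasDerivAt_moment 2 hφ x).sub ((hasDerivAt_moment 1 hφ x).const_smul h)).add
    ((hasDerivAt_moment 0 hφ x).const_smul (h ^ 2 / 6))).congr_deriv ?_
  module

theorem mu_three {e : ℝ → Space n} (he : Continuous e) (t : ℝ) {h : ℝ} (hh : h ≠ 0) :
    mu 3 e t h = moment 3 (fun ζ => e (t + ζ)) h
      - (3 / 2 * h) • moment 2 (fun ζ => e (t + ζ)) h
      + (h ^ 2 / 2) • moment 1 (fun ζ => e (t + ζ)) h := by
  have hφ : Continuous fun ζ => e (t + ζ) := by fun_prop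
  have h1 : ∀ ζ, (h ^ 3 * bernoulliFun 3 (ζ / h)) • e (t + ζ)
      = (ζ ^ 3 - 3 / 2 * h * ζ ^ 2 + h ^ 2 / 2 * ζ) • e (t + ζ) := by
    intro ζ
    rw [bernoulliFun_three]
    congr 1
    field_simp
  rw [mu]
  simp only [h1]
  refine integral_eq_of_hasDerivAt (F := fun ζ => moment 3 (fun ζ => e (t + ζ)) ζ
    - (3 / 2 * h) • moment 2 (fun ζ => e (t + ζ)) ζ
    + (h ^ 2 / 2) • moment 1 (fun ζ => e (t + ζ)) ζ) (fun x => ?_) (by fun_prop) (by simp) h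
  refine (((hasDerivAt_moment 3 hφ x).sub
    ((hasDerivAt_moment 2 hφ x).const_smul (3 / 2 * h))).add
    ((hasDerivAt_moment 1 hφ x).const_smul (h ^ 2 / 2))).congr_deriv ?_
  module

variable {ε : ℝ} {V₀ : Space n → ℝ} {e : ℝ → Space n}

theorem theta1_apply (he : Continuous e) (t h : ℝ) (f : Space n → ℂ) (x : Space n) :
    theta1 (schr ε V₀ e) t h f x = Complex.I * h * ε * lap f x
      - Complex.I * (ε : ℂ)⁻¹ * ((h * V₀ x + inner ℝ (mu 0 e t h) x : ℝ) : ℂ) * f x := by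
  have hφ : Continuous fun ζ => e (t + ζ) := by fun_prop
  rw [mu_zero]
  change ∫ ζ in (0 : ℝ)..h, (Complex.I * ε * lap f x
    + -(Complex.I * (ε : ℂ)⁻¹ * ((V₀ x + inner ℝ (e (t + ζ)) x : ℝ) : ℂ)) * f x) = _
  refine integral_eq_of_hasDerivAt (F := fun ζ => Complex.I * ζ * ε * lap f x
      - Complex.I * (ε : ℂ)⁻¹
        * ((ζ * V₀ x + inner ℝ (moment 0 (fun ζ => e (t + ζ)) ζ) x : ℝ) : ℂ) * f x)
    (fun ζ => ?_) (by fun_prop) (by simp) h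
  have h1 : HasDerivAt (fun ζ : ℝ => ((ζ * V₀ x
      + inner ℝ (moment 0 (fun ζ => e (t + ζ)) ζ) x : ℝ) : ℂ))
      ((V₀ x + inner ℝ (e (t + ζ)) x : ℝ) : ℂ) ζ := by
    refine HasDerivAt.ofReal_comp (((hasDerivAt_id ζ).mul_const _).add
      (((hasDerivAt_moment 0 hφ ζ).inner ℝ (hasDerivAt_const ζ x))) |>.congr_deriv ?_)
    simp
  have h2 : HasDerivAt (fun ζ : ℝ => (ζ : ℂ)) 1 ζ := Complex.ofRealCLM.hasDerivAt
  refine ((((h2.const_mul Complex.I).mul_const (ε : ℂ)).mul_const (lap f x)).sub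
    ((h1.const_mul (Complex.I * (ε : ℂ)⁻¹)).mul_const (f x))).congr_deriv ?_
  ring

theorem theta2_apply (hε : 0 < ε) (hV₀ : ContDiff ℝ ∞ V₀) (he : Continuous e) (t : ℝ) {h : ℝ}
    (hh : h ≠ 0) {f : Space n → ℂ} (hf : ContDiff ℝ ∞ f) (x : Space n) :
    theta2 (schr ε V₀ e) t h f x = -dirD (svec e t h) f x := by
  have hφ : Continuous fun ζ => fderiv ℝ f x (e (t + ζ)) := by fun_prop
  have hφ' : Continuous fun ζ => e (t + ζ) := by fun_prop
  change (-(1 / 2) : ℂ) * ∫ ζ in (0 : ℝ)..h, ∫ ξ in (0 : ℝ)..ζ,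
    comm (schr ε V₀ e (t + ξ)) (schr ε V₀ e (t + ζ)) f x = _
  have h1 : ∀ ζ ξ, comm (schr ε V₀ e (t + ξ)) (schr ε V₀ e (t + ζ)) f x
      = 2 * (fderiv ℝ f x (e (t + ζ)) - fderiv ℝ f x (e (t + ξ))) := fun ζ ξ => by
    rw [comm_schr_schr hε hV₀ _ _ hf, dirD, map_smul, map_sub, Complex.real_smul]
    norm_num
  simp only [h1, intervalIntegral.integral_const_mul]
  rw [integral_magnus2 hφ, moment_clm _ _ hφ', moment_clm _ _ hφ', dirD, svec, mu_one he t hh]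
  simp only [map_smul, map_sub, Complex.real_smul]
  push_cast
  ring

theorem theta4_apply (hε : 0 < ε) (hV₀ : ContDiff ℝ ∞ V₀) (he : Continuous e) (t : ℝ) {h : ℝ}
    (hh : h ≠ 0) {f : Space n → ℂ} (hf : ContDiff ℝ ∞ f) (x : Space n) :
    theta41 (schr ε V₀ e) t h f x + theta42 (schr ε V₀ e) t h f x + theta43 (schr ε V₀ e) t h f x
      = secOp V₀ (pvec e t h) f x := by
  obtain ⟨ℓ, hℓ⟩ := exists_clm_secOp hV₀ hf x
  have hφ : Continuous fun ζ => ℓ (e (t + ζ)) := by fun_prop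
  have hφ' : Continuous fun ζ => e (t + ζ) := by fun_prop
  have hs : ∀ a b, secOp V₀ ((2 : ℝ) • (a - b)) f x = 2 * (ℓ a - ℓ b) := fun a b => by
    rw [hℓ, map_smul, map_sub, Complex.real_smul]
    norm_num
  change (-(1 / 24) : ℂ) * (∫ ζ in (0 : ℝ)..h, ∫ ξ in (0 : ℝ)..ζ, ∫ χ in (0 : ℝ)..ζ,
      ∫ ν in (0 : ℝ)..χ, comm (schr ε V₀ e (t + ξ)) (comm (comm (schr ε V₀ e (t + ν))
        (schr ε V₀ e (t + χ))) (schr ε V₀ e (t + ζ))) f x)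
    + (-(1 / 24) : ℂ) * (∫ ζ in (0 : ℝ)..h, ∫ ξ in (0 : ℝ)..ζ, ∫ χ in (0 : ℝ)..ξ,
      ∫ ν in (0 : ℝ)..ξ, comm (comm (schr ε V₀ e (t + χ)) (comm (schr ε V₀ e (t + ν))
        (schr ε V₀ e (t + ξ)))) (schr ε V₀ e (t + ζ)) f x)
    + (-(1 / 8) : ℂ) * (∫ ζ in (0 : ℝ)..h, ∫ ξ in (0 : ℝ)..ζ, ∫ χ in (0 : ℝ)..ξ,
      ∫ ν in (0 : ℝ)..χ, comm (comm (comm (schr ε V₀ e (t + ν)) (schr ε V₀ e (t + χ)))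
        (schr ε V₀ e (t + ξ))) (schr ε V₀ e (t + ζ)) f x) = _
  simp only [comm_comm_comm_schr_41 hε hV₀ hf, comm_comm_comm_schr_42 hε hV₀ hf,
    comm_comm_comm_schr_43 hε hV₀ hf, Pi.neg_apply, hs, intervalIntegral.integral_neg,
    intervalIntegral.integral_const_mul]
  -- The identity is applied to the scalar function `ℓ ∘ e`, and then `ℓ` is pulled out of the
  -- moments so that `μ₃` of the vector field appears.
  have key := integral_magnus4 hφ h
  rw [moment_clm _ _ hφ', moment_clm _ _ hφ', moment_clm _ _ hφ', ← map_smul, ← map_smul,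
    ← map_sub, ← map_add, ← map_smul, ← mu_three he t hh] at key
  rw [hℓ, pvec, ← key]
  simp only [Complex.real_smul]
  push_cast
  ring

theorem theta3_apply (hε : 0 < ε) (hV₀ : ContDiff ℝ ∞ V₀) (he : Continuous e) (t : ℝ) {h : ℝ}
    (hh : h ≠ 0) {f : Space n → ℂ} (hf : ContDiff ℝ ∞ f) (x : Space n) :
    theta31 (schr ε V₀ e) t h f x + theta32 (schr ε V₀ e) t h f x
      = (Complex.I * (ε : ℂ)⁻¹ * ((inner ℝ (qvec e t h) (gradient V₀ x) : ℝ) : ℂ)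
        + cphase ε e t h) * f x := by
  have hφ : Continuous fun ζ => e (t + ζ) := by fun_prop
  have hF : ∀ a b c, mulOp (forceFn ε V₀ ((2 : ℝ) • (a - b)) c) f x
      = -(2 * (Complex.I * (ε : ℂ)⁻¹) * f x)
        * ((inner ℝ (a - b) (gradient V₀ x + c) : ℝ) : ℂ) := fun a b c => by
    simp only [mulOp, forceFn, Pi.smul_apply, Pi.add_apply, dirD_ofReal hV₀, smul_eq_mul,
      real_inner_smul_left, inner_add_right]
    push_cast
    ring
  have hF' : ∀ a b c, mulOp (forceFn ε V₀ ((2 : ℝ) • (a - b)) c) f x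
      = (2 * (Complex.I * (ε : ℂ)⁻¹) * f x)
        * ((inner ℝ (b - a) (gradient V₀ x + c) : ℝ) : ℂ) := fun a b c => by
    rw [hF, ← neg_sub b a, inner_neg_left]
    push_cast
    ring
  change (1 / 12 : ℂ) * (∫ ζ in (0 : ℝ)..h, ∫ ξ in (0 : ℝ)..ζ, ∫ χ in (0 : ℝ)..ζ,
      comm (schr ε V₀ e (t + ξ)) (comm (schr ε V₀ e (t + χ)) (schr ε V₀ e (t + ζ))) f x)
    + (1 / 4 : ℂ) * (∫ ζ in (0 : ℝ)..h, ∫ ξ in (0 : ℝ)..ζ, ∫ χ in (0 : ℝ)..ξ,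
      comm (comm (schr ε V₀ e (t + χ)) (schr ε V₀ e (t + ξ))) (schr ε V₀ e (t + ζ)) f x) = _
  have h1 : ∀ ζ ξ χ, comm (schr ε V₀ e (t + ξ)) (comm (schr ε V₀ e (t + χ))
      (schr ε V₀ e (t + ζ))) f x = (2 * (Complex.I * (ε : ℂ)⁻¹) * f x)
        * ((inner ℝ (e (t + ζ) - e (t + χ)) (gradient V₀ x + e (t + ξ)) : ℝ) : ℂ) :=
    fun ζ ξ χ => by rw [comm_comm_schr_right hε hV₀ hf, hF']
  have h2 : ∀ ζ ξ χ, comm (comm (schr ε V₀ e (t + χ)) (schr ε V₀ e (t + ξ)))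
      (schr ε V₀ e (t + ζ)) f x = -(2 * (Complex.I * (ε : ℂ)⁻¹) * f x)
        * ((inner ℝ (e (t + ξ) - e (t + χ)) (gradient V₀ x + e (t + ζ)) : ℝ) : ℂ) :=
    fun ζ ξ χ => by rw [comm_comm_schr_left hε hV₀ hf, hF]
  simp only [h1, h2, intervalIntegral.integral_const_mul, intervalIntegral.integral_ofReal]
  -- With weights 1/6 and 1/2 the two integrals give `μ₂` against the gradient, and the `corr` terms
  -- add up to `3/6 + 3/2 = 2`, the leading coefficient of `c`.
  rw [integral_magnus31 hφ, integral_magnus32 hφ, qvec, mu_two he t hh, cphase]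
  have c0 : ∀ ζ, ∫ ξ in (0 : ℝ)..ζ, e (t + ξ) = moment 0 (fun ζ => e (t + ζ)) ζ := fun ζ => by
    simp [moment]
  have c1 : ∫ ζ in (0 : ℝ)..h, ζ • e (t + ζ) = moment 1 (fun ζ => e (t + ζ)) h := by
    simp [moment]
  have c2 : ∫ ζ in (0 : ℝ)..h, ζ * inner ℝ (e (t + ζ)) (moment 0 (fun ζ => e (t + ζ)) ζ)
      = corr (fun ζ => e (t + ζ)) h := rfl
  rw [c0, c1]
  simp only [c0]
  rw [c2, ← real_inner_self_eq_norm_sq,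
    real_inner_comm (moment 1 (fun ζ => e (t + ζ)) h) (moment 0 (fun ζ => e (t + ζ)) h)]
  simp only [inner_add_left, inner_sub_left, real_inner_smul_left]
  push_cast
  ring

/-- The Magnus expansion in terms of the Bernoulli moments. -/
theorem Theta4_apply (hε : 0 < ε) (hV₀ : ContDiff ℝ ∞ V₀) (he : Continuous e) (t : ℝ) {h : ℝ}
    (hh : h ≠ 0) {f : Space n → ℂ} (hf : ContDiff ℝ ∞ f) (x : Space n) :
    Theta4 ε V₀ e t h f x = (kin ε e t h + pot ε V₀ e t h) f x + C2 e t h f x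
      + secOp V₀ (pvec e t h) f x := by
  change theta1 (schr ε V₀ e) t h f x + theta2 (schr ε V₀ e) t h f x
    + theta31 (schr ε V₀ e) t h f x + theta32 (schr ε V₀ e) t h f x
    + theta41 (schr ε V₀ e) t h f x + theta42 (schr ε V₀ e) t h f x
    + theta43 (schr ε V₀ e) t h f x = (Complex.I * h * ε * lap f x - dirD (stilde e t h) f x
      + (-(Complex.I * h * (ε : ℂ)⁻¹ * ((V₀ x + inner ℝ (rvec e t h) x : ℝ) : ℂ))
      + Complex.I * (ε : ℂ)⁻¹ * ((inner ℝ (qvec e t h) (gradient V₀ x) : ℝ) : ℂ)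
      + cphase ε e t h) * f x) + (-12 * ((h : ℂ) ^ 2)⁻¹) * dirD (pvec e t h) f x
      + secOp V₀ (pvec e t h) f x
  rw [← theta4_apply hε hV₀ he t hh hf x]
  have h3 := theta3_apply hε hV₀ he t hh hf x
  rw [theta1_apply he, theta2_apply hε hV₀ he t hh hf]
  have hr : ((h * V₀ x + inner ℝ (mu 0 e t h) x : ℝ) : ℂ)
      = h * ((V₀ x + inner ℝ (rvec e t h) x : ℝ) : ℂ) := by
    rw [rvec, real_inner_smul_left, ← Complex.ofReal_mul, mul_add, mul_inv_cancel_left₀ hh]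
  -- The part of `s` removed in `stilde` is exactly the derivative in `C2`, so together they restore
  -- `-sᵀ∇`.
  have hs : dirD (stilde e t h) f x
      = dirD (svec e t h) f x - 12 * ((h : ℂ) ^ 2)⁻¹ * dirD (pvec e t h) f x := by
    rw [dirD, stilde, map_sub, map_smul, Complex.real_smul]
    push_cast
    rfl
  rw [hr, hs]
  linear_combination h3

end

/-! ### Dependence on the values of the field at nonnegative times -/

section
variable {n : ℕ}

/-- The field is regular only on `[0, ∞)`. All times in the expansion are nonnegative, so these
congruences allow a globally continuous extension, as the calculus of moments requires. -/
theorem intOp_congr {a : ℝ} (ha : 0 ≤ a) {F G : ℝ → Op n} (h : ∀ ζ, 0 ≤ ζ → F ζ = G ζ) :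
    intOp a F = intOp a G := by
  funext f x
  refine intervalIntegral.integral_congr fun ζ hζ => ?_
  rw [Set.uIcc_of_le ha] at hζ
  simp only [h ζ hζ.1]

variable {e e' : ℝ → Space n} {t h : ℝ}

theorem theta1_congr {A A' : ℝ → Op n} (hA : ∀ ζ, 0 ≤ ζ → A (t + ζ) = A' (t + ζ))
    (hh : 0 ≤ h) : theta1 A t h = theta1 A' t h := by
  rw [theta1, theta1, intOp_congr hh hA]

theorem theta2_congr {A A' : ℝ → Op n} (hA : ∀ ζ, 0 ≤ ζ → A (t + ζ) = A' (t + ζ))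
    (hh : 0 ≤ h) : theta2 A t h = theta2 A' t h := by
  rw [theta2, theta2, intOp_congr hh fun ζ hζ => intOp_congr hζ fun ξ hξ =>
    by rw [hA ζ hζ, hA ξ hξ]]

theorem theta31_congr {A A' : ℝ → Op n} (hA : ∀ ζ, 0 ≤ ζ → A (t + ζ) = A' (t + ζ))
    (hh : 0 ≤ h) : theta31 A t h = theta31 A' t h := by
  rw [theta31, theta31, intOp_congr hh fun ζ hζ => intOp_congr hζ fun ξ hξ =>
    intOp_congr hζ fun χ hχ =>
    by rw [hA ζ hζ, hA ξ hξ, hA χ hχ]]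

theorem theta32_congr {A A' : ℝ → Op n} (hA : ∀ ζ, 0 ≤ ζ → A (t + ζ) = A' (t + ζ))
    (hh : 0 ≤ h) : theta32 A t h = theta32 A' t h := by
  rw [theta32, theta32, intOp_congr hh fun ζ hζ => intOp_congr hζ fun ξ hξ =>
    intOp_congr hξ fun χ hχ =>
    by rw [hA ζ hζ, hA ξ hξ, hA χ hχ]]

theorem theta41_congr {A A' : ℝ → Op n} (hA : ∀ ζ, 0 ≤ ζ → A (t + ζ) = A' (t + ζ))
    (hh : 0 ≤ h) : theta41 A t h = theta41 A' t h := by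
  rw [theta41, theta41, intOp_congr hh fun ζ hζ => intOp_congr hζ fun ξ hξ =>
    intOp_congr hζ fun χ hχ =>
    intOp_congr hχ fun ν hν =>
    by rw [hA ζ hζ, hA ξ hξ, hA χ hχ, hA ν hν]]

theorem theta42_congr {A A' : ℝ → Op n} (hA : ∀ ζ, 0 ≤ ζ → A (t + ζ) = A' (t + ζ))
    (hh : 0 ≤ h) : theta42 A t h = theta42 A' t h := by
  rw [theta42, theta42, intOp_congr hh fun ζ hζ => intOp_congr hζ fun ξ hξ =>
    intOp_congr hξ fun χ hχ =>
    intOp_congr hξ fun ν hν =>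
    by rw [hA ζ hζ, hA ξ hξ, hA χ hχ, hA ν hν]]

theorem theta43_congr {A A' : ℝ → Op n} (hA : ∀ ζ, 0 ≤ ζ → A (t + ζ) = A' (t + ζ))
    (hh : 0 ≤ h) : theta43 A t h = theta43 A' t h := by
  rw [theta43, theta43, intOp_congr hh fun ζ hζ => intOp_congr hζ fun ξ hξ =>
    intOp_congr hξ fun χ hχ =>
    intOp_congr hχ fun ν hν =>
    by rw [hA ζ hζ, hA ξ hξ, hA χ hχ, hA ν hν]]

theorem Theta4_congr (ε : ℝ) (V₀ : Space n → ℝ) (he : ∀ s, 0 ≤ s → e s = e' s) (ht : 0 ≤ t)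
    (hh : 0 ≤ h) : Theta4 ε V₀ e t h = Theta4 ε V₀ e' t h := by
  have hA : ∀ ζ, 0 ≤ ζ → schr ε V₀ e (t + ζ) = schr ε V₀ e' (t + ζ) := fun ζ hζ => by
    rw [schr, schr, he _ (add_nonneg ht hζ)]
  rw [Theta4, Theta4, theta1_congr hA hh, theta2_congr hA hh, theta31_congr hA hh,
    theta32_congr hA hh, theta41_congr hA hh, theta42_congr hA hh, theta43_congr hA hh]

theorem integral_congr_nonneg {E : Type*} [NormedAddCommGroup E] [NormedSpace ℝ E] {a : ℝ}
    (ha : 0 ≤ a) {F G : ℝ → E} (h : ∀ ζ, 0 ≤ ζ → F ζ = G ζ) :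
    ∫ ζ in (0 : ℝ)..a, F ζ = ∫ ζ in (0 : ℝ)..a, G ζ :=
  intervalIntegral.integral_congr fun ζ hζ => h ζ (by
    rw [Set.uIcc_of_le ha] at hζ
    exact hζ.1)

theorem mu_congr (k : ℕ) (he : ∀ s, 0 ≤ s → e s = e' s) (ht : 0 ≤ t) (hh : 0 ≤ h) :
    mu k e t h = mu k e' t h :=
  integral_congr_nonneg hh fun ζ hζ => by rw [he _ (add_nonneg ht hζ)]

theorem cphase_congr (ε : ℝ) (he : ∀ s, 0 ≤ s → e s = e' s) (ht : 0 ≤ t) (hh : 0 ≤ h) :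
    cphase ε e t h = cphase ε e' t h := by
  have hE : ∀ ζ, 0 ≤ ζ → e (t + ζ) = e' (t + ζ) := fun ζ hζ => he _ (add_nonneg ht hζ)
  have h1 : ∫ ζ in (0 : ℝ)..h, ζ * inner ℝ (e (t + ζ)) (∫ ξ in (0 : ℝ)..ζ, e (t + ξ))
      = ∫ ζ in (0 : ℝ)..h, ζ * inner ℝ (e' (t + ζ)) (∫ ξ in (0 : ℝ)..ζ, e' (t + ξ)) :=
    integral_congr_nonneg hh fun ζ hζ => by rw [hE ζ hζ, integral_congr_nonneg hζ hE]
  have h2 : ∫ ζ in (0 : ℝ)..h, ζ • e (t + ζ) = ∫ ζ in (0 : ℝ)..h, ζ • e' (t + ζ) :=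
    integral_congr_nonneg hh fun ζ hζ => by rw [hE ζ hζ]
  rw [cphase, cphase, h1, h2, integral_congr_nonneg hh hE]

theorem splitting_congr (ε : ℝ) (V₀ : Space n → ℝ) (he : ∀ s, 0 ≤ s → e s = e' s) (ht : 0 ≤ t)
    (hh : 0 ≤ h) : C2 e t h = C2 e' t h ∧ kin ε e t h = kin ε e' t h
      ∧ pot ε V₀ e t h = pot ε V₀ e' t h := by
  have hm := fun k => mu_congr k he ht hh
  have hc := cphase_congr ε he ht hh
  simp only [C2, kin, pot, stilde, svec, pvec, qvec, rvec, hm, hc, and_self]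

/-! ### Estimates of the coefficients -/

theorem exists_lipschitz_bound (he : ContDiffOn ℝ 2 e (Set.Ici 0)) {R : ℝ} (hR : 0 < R) :
    ∃ L : ℝ, ∀ s ∈ Set.Icc 0 R, ∀ s' ∈ Set.Icc 0 R, ‖e s' - e s‖ ≤ L * ‖s' - s‖ := by
  have he' : ContDiffOn ℝ 2 e (Set.Icc 0 R) := he.mono Set.Icc_subset_Ici_self
  obtain ⟨L, hL⟩ := isCompact_Icc.exists_bound_of_continuousOn
    (he'.continuousOn_derivWithin (uniqueDiffOn_Icc hR) (by norm_num))
  exact ⟨L, fun s hs s' hs' => (convex_Icc 0 R).norm_image_sub_le_of_norm_derivWithin_le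
    (he'.differentiableOn (by norm_num)) hL hs hs'⟩

/-- For `k ≥ 1` the Bernoulli polynomial has mean zero, so `e t` can be subtracted under the
integral and the Lipschitz bound gains one power of `h`. The constant is the maximum of `|B_k|` on
`[0, 1]`, independent of the field. -/
theorem exists_norm_mu_le (k : ℕ) (hk : k ≠ 0) : ∃ C : ℝ, 0 ≤ C ∧ ∀ (e : ℝ → Space n),
    Continuous e → ∀ L t h : ℝ, 0 < h → (∀ ζ ∈ Set.Icc 0 h, ‖e (t + ζ) - e t‖ ≤ L * ζ) →
    ‖mu k e t h‖ ≤ C * L * h ^ (k + 2) := by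
  obtain ⟨C, hC⟩ := (isCompact_Icc (a := (0 : ℝ)) (b := 1)).exists_bound_of_continuousOn
    (continuous_bernoulliFun k).continuousOn
  refine ⟨C, (norm_nonneg _).trans (hC 0 (by simp)), fun e he L t h hh hL => ?_⟩
  have hB : Continuous fun ζ : ℝ => h ^ k * bernoulliFun k (ζ / h) := by
    have := continuous_bernoulliFun k
    fun_prop
  have h0 : ∫ ζ in (0 : ℝ)..h, (h ^ k * bernoulliFun k (ζ / h)) • e t = 0 := by
    rw [intervalIntegral.integral_smul_const, intervalIntegral.integral_const_mul,
      intervalIntegral.integral_comp_div _ hh.ne', zero_div, div_self hh.ne',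
      integral_bernoulliFun_eq_zero hk]
    simp
  have h1 : mu k e t h = ∫ ζ in (0 : ℝ)..h,
      (h ^ k * bernoulliFun k (ζ / h)) • (e (t + ζ) - e t) := by
    simp only [smul_sub]
    rw [intervalIntegral.integral_sub, h0, sub_zero, mu]
    · exact Continuous.intervalIntegrable (by fun_prop) _ _
    · exact Continuous.intervalIntegrable (by fun_prop) _ _
  rw [h1]
  refine (intervalIntegral.norm_integral_le_of_norm_le_const (C := h ^ k * C * (L * h))
    fun ζ hζ => ?_).trans (le_of_eq ?_)
  · rw [Set.uIoc_of_le hh.le] at hζ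
    have hL0 : 0 ≤ L := nonneg_of_mul_nonneg_left
      ((norm_nonneg _).trans (hL h ⟨hh.le, le_rfl⟩)) hh
    have h2 : ‖bernoulliFun k (ζ / h)‖ ≤ C :=
      hC _ ⟨div_nonneg hζ.1.le hh.le, (div_le_one hh).2 hζ.2⟩
    rw [norm_smul, norm_mul, norm_pow, Real.norm_of_nonneg hh.le]
    refine mul_le_mul (mul_le_mul_of_nonneg_left h2 (by positivity))
      ((hL ζ ⟨hζ.1.le, hζ.2⟩).trans (mul_le_mul_of_nonneg_left hζ.2 hL0)) (norm_nonneg _)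
      (mul_nonneg (by positivity) ((norm_nonneg _).trans h2))
  · rw [sub_zero, abs_of_pos hh]
    ring

theorem norm_integral_le_mul {E : Type*} [NormedAddCommGroup E] [NormedSpace ℝ E] {a M : ℝ}
    (ha : 0 ≤ a) {F : ℝ → E} (h : ∀ ζ, 0 ≤ ζ → ζ ≤ a → ‖F ζ‖ ≤ M) :
    ‖∫ ζ in (0 : ℝ)..a, F ζ‖ ≤ M * a := by
  have := intervalIntegral.norm_integral_le_of_norm_le_const (a := 0) (b := a) (C := M) (f := F)
    fun ζ hζ => by
      rw [Set.uIoc_of_le ha] at hζ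
      exact h ζ hζ.1.le hζ.2
  rwa [sub_zero, abs_of_nonneg ha] at this

/-- A crude bound is enough: the phase only has to match the weight one of the rest of the
potential. The 4 is `2 + 1 + 1` from the three terms. -/
theorem norm_cphase_le {ε : ℝ} (hε : 0 < ε) {M : ℝ} (hh : h ∈ Set.Ioc (0 : ℝ) 1)
    (hM : ∀ ζ, 0 ≤ ζ → ζ ≤ h → ‖e (t + ζ)‖ ≤ M) : ‖cphase ε e t h‖ ≤ ε⁻¹ * (4 * M ^ 2) * h := by
  obtain ⟨h0, h1⟩ := hh
  have hM0 : 0 ≤ M := (norm_nonneg _).trans (hM 0 le_rfl h0.le)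
  have b0 : ∀ ζ, 0 ≤ ζ → ζ ≤ h → ‖∫ ξ in (0 : ℝ)..ζ, e (t + ξ)‖ ≤ M := fun ζ hζ hζh =>
    (norm_integral_le_mul hζ fun ξ hξ hξζ => hM ξ hξ (hξζ.trans hζh)).trans
      (mul_le_of_le_one_right hM0 (hζh.trans h1))
  have b1 : ‖∫ ζ in (0 : ℝ)..h, ζ • e (t + ζ)‖ ≤ M * h :=
    norm_integral_le_mul h0.le fun ζ hζ hζh => by
      rw [norm_smul, Real.norm_of_nonneg hζ]
      exact (mul_le_mul (hζh.trans h1) (hM ζ hζ hζh) (norm_nonneg _) zero_le_one).trans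
        (one_mul M).le
  have b2 : ‖∫ ζ in (0 : ℝ)..h, ζ * inner ℝ (e (t + ζ)) (∫ ξ in (0 : ℝ)..ζ, e (t + ξ))‖
      ≤ M * M * h :=
    norm_integral_le_mul h0.le fun ζ hζ hζh => by
      rw [norm_mul, Real.norm_of_nonneg hζ]
      refine (mul_le_mul (hζh.trans h1) ((norm_inner_le_norm _ _).trans (mul_le_mul (hM ζ hζ hζh)
        (b0 ζ hζ hζh) (norm_nonneg _) hM0)) (norm_nonneg _) zero_le_one).trans (one_mul _).le
  have b3 := b0 h h0.le le_rfl
  have b4 : ‖inner ℝ (∫ ζ in (0 : ℝ)..h, e (t + ζ)) (∫ ζ in (0 : ℝ)..h, ζ • e (t + ζ))‖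
      ≤ M * (M * h) :=
    (norm_inner_le_norm _ _).trans (mul_le_mul b3 b1 (norm_nonneg _) hM0)
  have b5 : ‖∫ ζ in (0 : ℝ)..h, e (t + ζ)‖ ^ 2 ≤ M ^ 2 := pow_le_pow_left₀ (norm_nonneg _) b3 2
  rw [cphase, norm_mul, norm_mul, Complex.norm_I, one_mul, norm_inv, Complex.norm_real,
    Complex.norm_real, Real.norm_of_nonneg hε.le, mul_assoc]
  refine mul_le_mul_of_nonneg_left ?_ (inv_nonneg.2 hε.le)
  have b6 : ‖h / 6 * ‖∫ ζ in (0 : ℝ)..h, e (t + ζ)‖ ^ 2‖ ≤ M ^ 2 * h := by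
    rw [Real.norm_of_nonneg (by positivity)]
    nlinarith [mul_le_mul_of_nonneg_left b5 h0.le, mul_nonneg h0.le (sq_nonneg M)]
  refine (norm_sub_le _ _).trans ((add_le_add ((norm_sub_le _ _).trans (add_le_add
    (norm_mul_le _ _) b4)) b6).trans ?_)
  rw [Real.norm_of_nonneg (by norm_num : (0 : ℝ) ≤ 2)]
  linarith [mul_le_mul_of_nonneg_left b2 (by norm_num : (0 : ℝ) ≤ 2)]

/-- The orders in `h` of the coefficients of the splitting. -/
theorem exists_coefficient_bounds {ε : ℝ} (hε : 0 < ε) (he : Continuous e)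
    (he2 : ContDiffOn ℝ 2 e (Set.Ici 0)) (T : ℝ) : ∃ K : ℝ, ∀ t ∈ Set.Icc 0 T,
    ∀ h ∈ Set.Ioc (0 : ℝ) 1, ‖stilde e t h‖ ≤ K * h ^ 3 ∧ ‖rvec e t h‖ ≤ K ∧
      ‖qvec e t h‖ ≤ K * h ^ 3 ∧ ‖pvec e t h‖ ≤ K * h ^ 5 ∧ ‖cphase ε e t h‖ ≤ K * h := by
  obtain hT | hT := lt_or_ge T 0
  · exact ⟨0, fun t ht => absurd (ht.1.trans ht.2) hT.not_ge⟩
  -- Since `h ≤ 1`, every time `t + ζ` lies in `[0, T + 1]`.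
  obtain ⟨L', hL'⟩ := exists_lipschitz_bound he2 (by linarith : 0 < T + 1)
  obtain ⟨M, hM⟩ := (isCompact_Icc (a := 0) (b := T + 1)).exists_bound_of_continuousOn
    he.continuousOn
  obtain ⟨c1, hc1, h1⟩ := exists_norm_mu_le (n := n) 1 one_ne_zero
  obtain ⟨c2, hc2, h2⟩ := exists_norm_mu_le (n := n) 2 two_ne_zero
  obtain ⟨c3, hc3, h3⟩ := exists_norm_mu_le (n := n) 3 three_ne_zero
  set L := |L'| with hL
  have hL0 : 0 ≤ L := abs_nonneg _
  have hM0 : 0 ≤ M := (norm_nonneg _).trans (hM 0 ⟨le_rfl, by linarith⟩)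
  have k1 : 0 ≤ c1 * L := mul_nonneg hc1 hL0
  have k2 : 0 ≤ c2 * L := mul_nonneg hc2 hL0
  have k3 : 0 ≤ c3 * L := mul_nonneg hc3 hL0
  have k4 : 0 ≤ ε⁻¹ * (4 * M ^ 2) := by positivity
  refine ⟨2 * (c1 * L) + c2 * L + 4 * (c3 * L) + M + ε⁻¹ * (4 * M ^ 2), fun t ht h hh => ?_⟩
  have hlip : ∀ ζ ∈ Set.Icc 0 h, ‖e (t + ζ) - e t‖ ≤ L * ζ := fun ζ hζ => by
    have := hL' t ⟨ht.1, by linarith [ht.2]⟩ (t + ζ)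
      ⟨add_nonneg ht.1 hζ.1, by linarith [ht.2, hζ.2, hh.2]⟩
    rw [add_sub_cancel_left, Real.norm_of_nonneg hζ.1] at this
    exact this.trans (mul_le_mul_of_nonneg_right (le_abs_self _) hζ.1)
  have hMt : ∀ ζ, 0 ≤ ζ → ζ ≤ h → ‖e (t + ζ)‖ ≤ M := fun ζ hζ hζh =>
    hM _ ⟨add_nonneg ht.1 hζ, by linarith [ht.2, hh.2]⟩
  have m1 := h1 e he L t h hh.1 hlip
  have m2 := h2 e he L t h hh.1 hlip
  have m3 := h3 e he L t h hh.1 hlip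
  have hp : ‖pvec e t h‖ ≤ 1 / 3 * (c3 * L * h ^ 5) := by
    rw [pvec, norm_smul, Real.norm_of_nonneg (by norm_num)]
    exact mul_le_mul_of_nonneg_left m3 (by norm_num)
  have p3 : 0 < h ^ 3 := pow_pos hh.1 3
  have p5 : 0 < h ^ 5 := pow_pos hh.1 5
  refine ⟨?_, ?_, ?_, ?_, ?_⟩
  · have hs : ‖svec e t h‖ ≤ 2 * (c1 * L * h ^ 3) := by
      rw [svec, norm_smul, Real.norm_of_nonneg (by norm_num)]
      exact mul_le_mul_of_nonneg_left m1 (by norm_num)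
    have hp' : ‖(12 * (h ^ 2)⁻¹) • pvec e t h‖ ≤ 4 * (c3 * L) * h ^ 3 := by
      have h2 : 0 < h := hh.1
      rw [norm_smul, Real.norm_of_nonneg (by positivity)]
      refine (mul_le_mul_of_nonneg_left hp (by positivity)).trans (le_of_eq ?_)
      field_simp
      ring
    refine (norm_sub_le _ _).trans ((add_le_add hs hp').trans ?_)
    nlinarith
  · have h0 : ‖mu 0 e t h‖ ≤ M * h := by
      rw [mu]
      refine norm_integral_le_mul hh.1.le fun ζ hζ hζh => ?_
      simpa using hMt ζ hζ hζh
    have hr : ‖rvec e t h‖ ≤ M := by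
      rw [rvec, norm_smul, norm_inv, Real.norm_of_nonneg hh.1.le, inv_mul_le_iff₀ hh.1, mul_comm]
      exact h0
    linarith
  -- The vector `q` is even of order four; order three is all that the splitting asks for.
  · have : c2 * L * h ^ 4 ≤ c2 * L * h ^ 3 :=
      mul_le_mul_of_nonneg_left (pow_le_pow_of_le_one hh.1.le hh.2 (by norm_num)) k2
    have m2' : ‖qvec e t h‖ ≤ c2 * L * h ^ 4 := m2
    nlinarith
  · refine hp.trans ?_
    nlinarith
  · refine (norm_cphase_le hε hh hMt).trans (mul_le_mul_of_nonneg_right ?_ hh.1.le)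
    linarith

end

/-! ### Taylor expansion of unitary groups -/

section
variable {n : ℕ}

/-- The group law `G σ = G τ ∘ G (σ - τ)` carries the derivative at zero to any time. -/
theorem IsUnitaryGroup.hasDerivAt {G : ℝ → (L2 n ≃ₗᵢ[ℂ] L2 n)} (hG : IsUnitaryGroup G)
    {v w : L2 n} (h : HasDerivAt (fun τ => G τ v) w 0) (τ : ℝ) :
    HasDerivAt (fun τ => G τ v) (G τ w) τ := by
  have h1 : HasDerivAt (fun σ => G τ (G σ v)) (G τ w) 0 :=
    (((G τ).toContinuousLinearEquiv : L2 n →L[ℂ] L2 n).restrictScalars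
      ℝ).hasFDerivAt.comp_hasDerivAt
      0 h
  rw [← sub_self τ] at h1
  refine (h1.comp_sub_const τ τ).congr_of_eventuallyEq (Filter.Eventually.of_forall fun σ => ?_)
  change G σ v = G τ (G (σ - τ) v)
  rw [← hG.add, add_sub_cancel]

/-- The derivative of the Taylor remainder is the remainder of one order less for the shifted
sequence. The mean value inequality on `[0, 1]` then propagates the bound, which starts from the
isometry property; the factor `1/N!` is given up. -/
theorem IsUnitaryGroup.norm_sub_taylor_le {G : ℝ → (L2 n ≃ₗᵢ[ℂ] L2 n)} (hG : IsUnitaryGroup G)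
    (N : ℕ) : ∀ v : ℕ → L2 n, (∀ k, HasDerivAt (fun τ => G τ (v k)) (v (k + 1)) 0) →
    ∀ τ ∈ Set.Icc (0 : ℝ) 1,
      ‖G τ (v 0) - ∑ k ∈ Finset.range N, (τ ^ k / k.factorial) • v k‖ ≤ ‖v N‖ := by
  induction N with
  | zero =>
    intro v _ τ _
    simp
  | succ N ih =>
    intro v hv τ hτ
    have ih' := ih (fun k => v (k + 1)) fun k => hv (k + 1)
    have hd : ∀ σ : ℝ, HasDerivAt
        (fun τ => G τ (v 0) - ∑ k ∈ Finset.range (N + 1), (τ ^ k / k.factorial) • v k)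
        (G σ (v 1) - ∑ k ∈ Finset.range N, (σ ^ k / k.factorial) • v (k + 1)) σ := fun σ => by
      refine (hG.hasDerivAt (hv 0) σ).sub ?_
      simp only [Finset.sum_range_succ' _ N, pow_zero, Nat.factorial_zero, Nat.cast_one, div_one]
      refine (HasDerivAt.fun_sum fun k _ => ?_).add_const _
      refine (((hasDerivAt_pow (k + 1) σ).div_const ((k + 1).factorial : ℝ)).smul_const
        (v (k + 1))).congr_deriv ?_
      congr 1
      rw [Nat.factorial_succ, Nat.add_sub_cancel]
      have : ((k + 1 : ℕ) : ℝ) ≠ 0 := by positivity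
      push_cast at this ⊢
      field_simp
    have key := norm_image_sub_le_of_norm_deriv_le_segment'
      (fun σ _ => (hd σ).hasDerivWithinAt) (fun σ hσ => ih' σ ⟨hσ.1, hσ.2.le⟩) τ hτ
    have h0 : G 0 (v 0) - ∑ k ∈ Finset.range (N + 1), ((0 : ℝ) ^ k / k.factorial) • v k = 0 := by
      rw [Finset.sum_range_succ', hG.zero]
      simp
    rw [h0, sub_zero, sub_zero] at key
    exact key.trans (mul_le_of_le_one_right (norm_nonneg _) hτ.2)

/-! ### Square-integrable members of families -/

open Classical in
/-- The class in `L²` of a square-integrable function. -/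
def toL2 (g : Space n → ℂ) : L2 n :=
  if h : MeasureTheory.MemLp g 2 MeasureTheory.volume then h.toLp g else 0

theorem toL2_coe {g : Space n → ℂ} (h : MeasureTheory.MemLp g 2 MeasureTheory.volume) :
    toL2 g =ᵐ[MeasureTheory.volume] g := by
  rw [toL2, dif_pos h]
  exact h.coeFn_toLp

theorem eq_toL2 {g : Space n → ℂ} (h : MeasureTheory.MemLp g 2 MeasureTheory.volume) {v : L2 n}
    (hv : v =ᵐ[MeasureTheory.volume] g) : v = toL2 g :=
  MeasureTheory.Lp.ext (hv.trans (toL2_coe h).symm)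

theorem toL2_add {f g : Space n → ℂ} (hf : MeasureTheory.MemLp f 2 MeasureTheory.volume)
    (hg : MeasureTheory.MemLp g 2 MeasureTheory.volume) : toL2 (f + g) = toL2 f + toL2 g :=
  (eq_toL2 (hf.add hg) ((MeasureTheory.Lp.coeFn_add _ _).trans
    ((toL2_coe hf).add (toL2_coe hg)))).symm

theorem toL2_sub {f g : Space n → ℂ} (hf : MeasureTheory.MemLp f 2 MeasureTheory.volume)
    (hg : MeasureTheory.MemLp g 2 MeasureTheory.volume) : toL2 (f - g) = toL2 f - toL2 g :=
  (eq_toL2 (hf.sub hg) ((MeasureTheory.Lp.coeFn_sub _ _).trans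
    ((toL2_coe hf).sub (toL2_coe hg)))).symm

theorem toL2_smul (c : ℂ) {f : Space n → ℂ} (hf : MeasureTheory.MemLp f 2 MeasureTheory.volume) :
    toL2 (c • f) = c • toL2 f :=
  (eq_toL2 (hf.const_smul c) ((MeasureTheory.Lp.coeFn_smul _ _).trans
    ((toL2_coe hf).const_smul c))).symm

variable {ι : Type*} {S : Set (Space n)}

theorem VanishesOff.isTest (hS : IsCompact S) {F : SmoothFam ι n} (hF : VanishesOff S F) (p : ι) :
    IsTest (F.1 p) :=
  ⟨F.2 p, HasCompactSupport.intro hS fun x hx => hF p x hx⟩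

theorem VanishesOff.memLp (hS : IsCompact S) {F : SmoothFam ι n} (hF : VanishesOff S F) (p : ι) :
    MeasureTheory.MemLp (F.1 p) 2 MeasureTheory.volume :=
  (F.2 p).continuous.memLp_of_hasCompactSupport (hF.isTest hS p).2

theorem exists_norm_toL2_le (hS : IsCompact S) {h : ι → ℝ} {k : ℕ} {F : SmoothFam ι n}
    (hh : ∀ p, 0 < h p)
    (hF : VanishesOff S F) (hk : F ∈ orderFam h n k) : ∃ K, ∀ p, ‖toL2 (F.1 p)‖ ≤ K * h p ^ k := by
  obtain ⟨K, hK⟩ := hk 0 S hS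
  -- On a compact support, the `L²` norm is at most the supremum times the square root of the
  -- volume.
  refine ⟨(MeasureTheory.volume S).toReal ^ ((2 : ℝ)⁻¹) * |K|, fun p => ?_⟩
  have hm := hF.memLp hS p
  have hpow : 0 ≤ h p ^ k := pow_nonneg (hh p).le k
  rw [toL2, dif_pos hm, MeasureTheory.Lp.norm_toLp]
  have hind : F.1 p = S.indicator (F.1 p) := by
    refine (Set.indicator_eq_self.2 fun x hx => ?_).symm
    by_contra hxS
    exact hx (hF p x hxS)
  have hfin : MeasureTheory.volume S ≠ ⊤ := hS.measure_lt_top.ne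
  have hb : MeasureTheory.eLpNorm (F.1 p) 2 MeasureTheory.volume
      ≤ MeasureTheory.volume S ^ ((2 : ENNReal).toReal⁻¹) * ENNReal.ofReal (|K| * h p ^ k) := by
    rw [hind, MeasureTheory.eLpNorm_indicator_eq_eLpNorm_restrict hS.measurableSet]
    refine (MeasureTheory.eLpNorm_le_of_ae_bound (C := |K| * h p ^ k) ?_).trans ?_
    · exact (MeasureTheory.ae_restrict_iff' hS.measurableSet).2 (Filter.Eventually.of_forall
        fun x hx => (hK p x hx).trans (mul_le_mul_of_nonneg_right (le_abs_self K) hpow))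
    · rw [MeasureTheory.Measure.restrict_apply_univ]
  have hne : MeasureTheory.volume S ^ ((2 : ENNReal).toReal⁻¹) * ENNReal.ofReal (|K| * h p ^ k)
      ≠ ⊤ := ENNReal.mul_ne_top (ENNReal.rpow_ne_top_of_nonneg (by simp) hfin) ENNReal.ofReal_ne_top
  refine (ENNReal.toReal_mono hne hb).trans (le_of_eq ?_)
  rw [ENNReal.toReal_mul, ← ENNReal.toReal_rpow, ENNReal.toReal_ofReal (by positivity), mul_assoc]
  simp

theorem vanishesOff_pow {A : Module.End ℂ (SmoothFam ι n)}
    (hA : ∀ F, VanishesOff S F → VanishesOff S (A F)) {F : SmoothFam ι n} (hF : VanishesOff S F)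
    (k : ℕ) : VanishesOff S ((A ^ k) F) := by
  induction k with
  | zero => exact hF
  | succ k ih =>
    rw [pow_succ']
    exact hA _ ih

theorem vanishesOff_expTrunc {A : Module.End ℂ (SmoothFam ι n)}
    (hA : ∀ F, VanishesOff S F → VanishesOff S (A F)) {F : SmoothFam ι n} (hF : VanishesOff S F)
    (N : ℕ) : VanishesOff S (expTrunc N A F) := fun p x hx => by
  rw [expTrunc, LinearMap.sum_apply, SmoothFam.sum_apply, Finset.sum_apply]
  exact Finset.sum_eq_zero fun k _ =>
    (congrArg (((k.factorial : ℂ)⁻¹) * ·) (vanishesOff_pow hA hF k p x hx)).trans (mul_zero _)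

theorem toL2_expTrunc (hS : IsCompact S) {A : Module.End ℂ (SmoothFam ι n)}
    (hA : ∀ F, VanishesOff S F → VanishesOff S (A F)) {F : SmoothFam ι n} (hF : VanishesOff S F)
    (N : ℕ) (p : ι) : toL2 ((expTrunc N A F).1 p)
      = ∑ k ∈ Finset.range N, ((k.factorial : ℂ)⁻¹) • toL2 (((A ^ k) F).1 p) := by
  induction N with
  | zero =>
    have h : (expTrunc 0 A F).1 p = 0 := rfl
    have h0 := toL2_smul 0 (hF.memLp hS p)
    rw [zero_smul, zero_smul] at h0
    rw [h, h0, Finset.sum_range_zero]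
  | succ N ih =>
    have h : (expTrunc (N + 1) A F).1 p
        = (expTrunc N A F).1 p + ((N.factorial : ℂ)⁻¹) • ((A ^ N) F).1 p := by
      rw [expTrunc, Finset.sum_range_succ]
      rfl
    have hm := (vanishesOff_pow hA hF N).memLp hS p
    rw [h, toL2_add ((vanishesOff_expTrunc hA hF N).memLp hS p) (hm.const_smul _),
      toL2_smul _ hm, ih, Finset.sum_range_succ]

/-- On test functions, the unitary exponential agrees with the exponential series up to the first
omitted power. -/
theorem IsExp.norm_sub_expTrunc_le (hS : IsCompact S) {A : Module.End ℂ (SmoothFam ι n)}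
    {a : ι → Op n} (hAa : Realizes A a) (hA : ∀ F, VanishesOff S F → VanishesOff S (A F))
    {F : SmoothFam ι n} (hF : VanishesOff S F) (N : ℕ) (p : ι) {U : L2 n ≃ₗᵢ[ℂ] L2 n}
    (hU : IsExp (a p) U) :
    ‖U (toL2 (F.1 p)) - toL2 ((expTrunc N A F).1 p)‖ ≤ ‖toL2 (((A ^ N) F).1 p)‖ := by
  obtain ⟨G, hG, hgen, rfl⟩ := hU
  -- Every iterate is again a test function, supported in `S`, so `Generates` applies to each of
  -- them and the generator is never needed beyond test functions.
  have hv : ∀ k, HasDerivAt (fun τ => G τ (toL2 (((A ^ k) F).1 p)))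
      (toL2 (((A ^ (k + 1)) F).1 p)) 0 := fun k => by
    have hk := vanishesOff_pow hA hF k
    obtain ⟨v, w, hv, hw, hd⟩ := hgen _ (hk.isTest hS p)
    have hk1 : ((A ^ (k + 1)) F).1 p = a p (((A ^ k) F).1 p) := by
      rw [pow_succ']
      exact hAa _ p
    rw [← hk1] at hw
    rwa [eq_toL2 (hk.memLp hS p) hv, eq_toL2 ((vanishesOff_pow hA hF (k + 1)).memLp hS p) hw] at hd
  have key := hG.norm_sub_taylor_le N _ hv 1 (by simp)
  have hs : ∑ k ∈ Finset.range N, ((k.factorial : ℂ)⁻¹) • toL2 (((A ^ k) F).1 p)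
      = ∑ k ∈ Finset.range N, ((1 : ℝ) ^ k / k.factorial) • toL2 (((A ^ k) F).1 p) :=
    Finset.sum_congr rfl fun k _ => by
      rw [one_pow, one_div, RCLike.real_smul_eq_coe_smul (K := ℂ)]
      simp
  rw [toL2_expTrunc hS hA hF, hs]
  exact key

end

/-! ### The error of the splitting -/

section
variable {n : ℕ}

theorem comm_C2_kin (ε : ℝ) (e : ℝ → Space n) (t h : ℝ) {f : Space n → ℂ}
    (hf : ContDiff ℝ ∞ f) : comm (C2 e t h) (kin ε e t h) f = 0 := by
  have hp := contDiff_dirD (pvec e t h) hf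
  have hL := contDiff_lap hf
  have hs := contDiff_dirD (stilde e t h) hf
  change (-12 * ((h : ℂ) ^ 2)⁻¹) • dirD (pvec e t h)
      ((Complex.I * h * ε) • lap f - dirD (stilde e t h) f)
    - ((Complex.I * h * ε) • lap ((-12 * ((h : ℂ) ^ 2)⁻¹) • dirD (pvec e t h) f)
      - dirD (stilde e t h) ((-12 * ((h : ℂ) ^ 2)⁻¹) • dirD (pvec e t h) f)) = 0
  rw [dirD_sub _ (smooth_smul _ hL) hs, dirD_smul _ _ hL, lap_smul _ hp, dirD_smul _ _ hp,
    lap_dirD _ hf, dirD_comm (pvec e t h) (stilde e t h) hf]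
  module

/-- The pairs `(t, h)` with `t ∈ [0, T]` and `h ∈ (0, 1]`. -/
abbrev StepIdx (T : ℝ) := {p : ℝ × ℝ // p.1 ∈ Set.Icc 0 T ∧ p.2 ∈ Set.Ioc (0 : ℝ) 1}

/-- The operators of the splitting, as operators on families indexed by time and step size. -/
theorem exists_splitting_operators {ε : ℝ} (hε : 0 < ε) {V₀ : Space n → ℝ}
    (hV₀ : ContDiff ℝ ∞ V₀) {e : ℝ → Space n} (he2 : ContDiffOn ℝ 2 e (Set.Ici 0)) (T : ℝ) :
    ∃ B C Θ : Module.End ℂ (SmoothFam (StepIdx T) n),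
      Realizes B (fun p => kin ε e p.1.1 p.1.2 + pot ε V₀ e p.1.1 p.1.2) ∧
      Realizes C (fun p => C2 e p.1.1 p.1.2) ∧
      Realizes Θ (fun p => Theta4 ε V₀ e p.1.1 p.1.2) ∧
      B ∈ orderOp (fun p => p.1.2) n 1 ∧ C ∈ orderOp (fun p => p.1.2) n 3 ∧
      Θ ∈ orderOp (fun p => p.1.2) n 1 ∧
      ∀ N, 7 ≤ N → expTrunc N ((1 / 2 : ℂ) • C) * expTrunc N B * expTrunc N ((1 / 2 : ℂ) • C)
        - expTrunc N Θ ∈ orderOp (fun p => p.1.2) n 7 := by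
  -- The field is extended to negative times by its value at zero.
  obtain ⟨e', he', he'e⟩ : ∃ e' : ℝ → Space n, Continuous e' ∧ ∀ s, 0 ≤ s → e s = e' s :=
    ⟨fun s => e (max s 0), he2.continuousOn.comp_continuous (by fun_prop)
      fun s => le_max_right s 0, fun s hs => congrArg e (max_eq_left hs).symm⟩
  obtain ⟨K, hK⟩ := exists_coefficient_bounds hε he'
    (he2.congr fun s hs => (he'e s hs).symm) T
  obtain ⟨B, C, Θ, hB, hC, hΘ, hB1, hC3, hΘ1, hsplit⟩ := exists_realizes_splitting
    (ι := StepIdx T) (h := fun p => p.1.2) (fun p => p.2.2) hε V₀ hV₀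
    (fun p => stilde e' p.1.1 p.1.2) (fun p => rvec e' p.1.1 p.1.2)
    (fun p => qvec e' p.1.1 p.1.2) (fun p => pvec e' p.1.1 p.1.2)
    (fun p => cphase ε e' p.1.1 p.1.2) (K := K)
    (fun p => (hK _ p.2.1 _ p.2.2).1) (fun p => (hK _ p.2.1 _ p.2.2).2.1)
    (fun p => (hK _ p.2.1 _ p.2.2).2.2.1) (fun p => (hK _ p.2.1 _ p.2.2).2.2.2.1)
    (fun p => (hK _ p.2.1 _ p.2.2).2.2.2.2)
  have hcongr := fun p : StepIdx T => splitting_congr ε V₀ he'e p.2.1.1 p.2.2.1.le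
  refine ⟨B, C, Θ, fun F p => ?_, fun F p => ?_, fun F p => funext fun x => ?_, hB1, hC3, hΘ1,
    hsplit⟩
  · change (B F).1 p = (kin ε e p.1.1 p.1.2 + pot ε V₀ e p.1.1 p.1.2) (F.1 p)
    rw [(hcongr p).2.1, (hcongr p).2.2]
    exact hB F p
  · change (C F).1 p = C2 e p.1.1 p.1.2 (F.1 p)
    rw [(hcongr p).1]
    exact hC F p
  · change (Θ F).1 p x = Theta4 ε V₀ e p.1.1 p.1.2 (F.1 p) x
    rw [Theta4_congr ε V₀ he'e p.2.1.1 p.2.2.1.le,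
      Theta4_apply hε hV₀ he' _ p.2.2.1.ne' (F.2 p), hΘ, hB F p, hC F p, secOp,
      show dirD (pvec e' p.1.1 p.1.2) (fun x => (V₀ x : ℂ)) = _ from
        funext fun y => dirD_ofReal hV₀ _ y]
    rfl

theorem exists_L2_error_bound {ε : ℝ} (hε : 0 < ε) {V₀ : Space n → ℝ} (hV₀ : ContDiff ℝ ∞ V₀)
    {e : ℝ → Space n} (he2 : ContDiffOn ℝ 2 e (Set.Ici 0)) {f : Space n → ℂ} (hf : IsTest f)
    (T : ℝ) : ∃ K : ℝ, ∀ t ∈ Set.Icc 0 T, ∀ h ∈ Set.Ioc (0 : ℝ) 1,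
      ∀ UC UB UΘ : L2 n ≃ₗᵢ[ℂ] L2 n, IsExp ((1 / 2 : ℂ) • C2 e t h) UC →
        IsExp (kin ε e t h + pot ε V₀ e t h) UB → IsExp (Theta4 ε V₀ e t h) UΘ →
        ‖UC (UB (UC (toL2 f))) - UΘ (toL2 f)‖ ≤ K * h ^ 7 := by
  obtain ⟨B, C, Θ, hB, hC, hΘ, hB1, hC3, hΘ1, hsplit⟩ :=
    exists_splitting_operators hε hV₀ he2 T
  have hh : ∀ p : StepIdx T, p.1.2 ∈ Set.Ioc (0 : ℝ) 1 := fun p => p.2.2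
  have hI := isFiltration_orderOp (n := n) hh
  have hS : IsCompact (tsupport f) := hf.2
  have hSc : IsClosed (tsupport f) := isClosed_tsupport f
  set A := (1 / 2 : ℂ) • C with hA
  have hAr : Realizes A fun p : StepIdx T => (1 / 2 : ℂ) • C2 e p.1.1 p.1.2 := hC.smul _
  have hA3 : A ∈ orderOp (fun p : StepIdx T => p.1.2) n 3 := Submodule.smul_mem _ _ hC3
  set F : SmoothFam (StepIdx T) n := constFam (StepIdx T) f hf.1 with hF
  have hF0 : F ∈ orderFam (fun p => p.1.2) n 0 := constFam_mem_orderFam _ _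
  have hFv : VanishesOff (tsupport f) F := fun _ x hx => image_eq_zero_of_notMem_tsupport hx
  have hAv := hA3.2 _ hSc
  have hBv := hB1.2 _ hSc
  have hΘv := hΘ1.2 _ hSc
  have hAE := hI.expTrunc_mem (hI.mono 0 3 (by norm_num) hA3) 7
  have hBE := hI.expTrunc_mem (hI.mono 0 1 (by norm_num) hB1) 7
  set F1 := expTrunc 7 A F with hF1
  set F2 := expTrunc 7 B F1 with hF2
  have hF1v : VanishesOff (tsupport f) F1 := vanishesOff_expTrunc hAv hFv 7
  have hF2v : VanishesOff (tsupport f) F2 := vanishesOff_expTrunc hBv hF1v 7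
  have hF10 : F1 ∈ orderFam (fun p => p.1.2) n 0 := hAE.1 0 F hF0
  have hF20 : F2 ∈ orderFam (fun p => p.1.2) n 0 := hBE.1 0 F1 hF10
  -- The first omitted power has weight 21 for the outer factors and weight 7 for `B` and `Θ`, so
  -- each exponential may be replaced by seven terms of its series.
  have hA7 := hI.mono 7 21 (by norm_num) (hI.pow_mem hA3 7)
  have hB7 := hI.pow_mem hB1 7
  have hΘ7 := hI.pow_mem hΘ1 7
  have hpos : ∀ p : StepIdx T, 0 < p.1.2 := fun p => p.2.2.1
  obtain ⟨K1, hK1⟩ := exists_norm_toL2_le hS hpos (vanishesOff_pow hAv hFv 7) (hA7.1 0 F hF0)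
  obtain ⟨K2, hK2⟩ := exists_norm_toL2_le hS hpos (vanishesOff_pow hBv hF1v 7) (hB7.1 0 F1 hF10)
  obtain ⟨K3, hK3⟩ := exists_norm_toL2_le hS hpos (vanishesOff_pow hAv hF2v 7) (hA7.1 0 F2 hF20)
  obtain ⟨K4, hK4⟩ := exists_norm_toL2_le hS hpos ((hsplit 7 le_rfl).2 _ hSc F hFv)
    ((hsplit 7 le_rfl).1 0 F hF0)
  obtain ⟨K5, hK5⟩ := exists_norm_toL2_le hS hpos (vanishesOff_pow hΘv hFv 7) (hΘ7.1 0 F hF0)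
  refine ⟨K1 + K2 + K3 + K4 + K5, fun t ht h hh UC UB UΘ hUC hUB hUΘ => ?_⟩
  let p : StepIdx T := ⟨(t, h), ht, hh⟩
  have b1 := (IsExp.norm_sub_expTrunc_le hS hAr hAv hFv 7 p hUC).trans (hK1 p)
  have b2 := (IsExp.norm_sub_expTrunc_le hS hB hBv hF1v 7 p hUB).trans (hK2 p)
  have b3 := (IsExp.norm_sub_expTrunc_le hS hAr hAv hF2v 7 p hUC).trans (hK3 p)
  have b5 := (IsExp.norm_sub_expTrunc_le hS hΘ hΘv hFv 7 p hUΘ).trans (hK5 p)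
  have h4 : ((expTrunc 7 A * expTrunc 7 B * expTrunc 7 A - expTrunc 7 Θ) F).1 p
      = (expTrunc 7 A F2).1 p - (expTrunc 7 Θ F).1 p := rfl
  have b4 := hK4 p
  rw [h4, toL2_sub ((vanishesOff_expTrunc hAv hF2v 7).memLp hS p)
    ((vanishesOff_expTrunc hΘv hFv 7).memLp hS p)] at b4
  rw [norm_sub_rev] at b5
  rw [← UB.norm_map, ← UC.norm_map] at b1
  rw [← UC.norm_map] at b2
  have hFp : F.1 p = f := rfl
  have hhp : p.1.2 = h := rfl
  rw [hFp, hhp] at *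
  -- The exponentials are traded for series one at a time. Errors made further inside are carried
  -- outward by isometries, and the fourth summand is the algebraic splitting error.
  have hsum : UC (UB (UC (toL2 f))) - UΘ (toL2 f)
      = UC (UB (UC (toL2 f) - toL2 (F1.1 p))) + UC (UB (toL2 (F1.1 p)) - toL2 (F2.1 p))
        + (UC (toL2 (F2.1 p)) - toL2 ((expTrunc 7 A F2).1 p))
        + (toL2 ((expTrunc 7 A F2).1 p) - toL2 ((expTrunc 7 Θ F).1 p))
        + (toL2 ((expTrunc 7 Θ F).1 p) - UΘ (toL2 f)) := by
    rw [map_sub, map_sub, map_sub]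
    abel
  rw [hsum]
  refine ((norm_add_le _ _).trans (add_le_add (norm_add₄_le.trans (add_le_add (add_le_add
    (add_le_add b1 b2) b3) b4)) b5)).trans_eq ?_
  simp only [mul_one, add_zero]
  ring

theorem exists_series_error_bound {ε : ℝ} (hε : 0 < ε) {V₀ : Space n → ℝ}
    (hV₀ : ContDiff ℝ ∞ V₀) {e : ℝ → Space n} (he2 : ContDiffOn ℝ 2 e (Set.Ici 0))
    {f : Space n → ℂ} (hf : ContDiff ℝ ∞ f) {N : ℕ} (hN : 7 ≤ N) {S : Set (Space n)}
    (hS : IsCompact S) (T : ℝ) : ∃ K : ℝ, ∀ t ∈ Set.Icc 0 T, ∀ h ∈ Set.Ioc (0 : ℝ) 1, ∀ x ∈ S,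
      ‖expSum N ((1 / 2 : ℂ) • C2 e t h) (expSum N (kin ε e t h + pot ε V₀ e t h)
          (expSum N ((1 / 2 : ℂ) • C2 e t h) f)) x - expSum N (Theta4 ε V₀ e t h) f x‖
        ≤ K * h ^ 7 := by
  obtain ⟨B, C, Θ, hB, hC, hΘ, -, -, -, hsplit⟩ := exists_splitting_operators hε hV₀ he2 T
  -- The constant family has order zero, so its image has order seven; the final `0` asks for the
  -- bound on values alone, without derivatives.
  obtain ⟨K, hK⟩ := (hsplit N hN).1 0 (constFam (StepIdx T) f hf)
    (constFam_mem_orderFam _ hf) 0 S hS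
  refine ⟨K, fun t ht h hh x hx => ?_⟩
  let p : StepIdx T := ⟨(t, h), ht, hh⟩
  set F := constFam (StepIdx T) f hf
  have hA := (hC.smul (1 / 2)).expSum N
  have h1 : (expTrunc N ((1 / 2 : ℂ) • C) (expTrunc N B (expTrunc N ((1 / 2 : ℂ) • C) F))).1 p
      = expSum N ((1 / 2 : ℂ) • C2 e t h) (expSum N (kin ε e t h + pot ε V₀ e t h)
        (expSum N ((1 / 2 : ℂ) • C2 e t h) f)) :=
    (hA _ p).trans (congrArg _ ((hB.expSum N _ p).trans (congrArg _ (hA _ p))))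
  have h2 : (expTrunc N Θ F).1 p = expSum N (Theta4 ε V₀ e t h) f := hΘ.expSum N F p
  rw [← h1, ← h2]
  exact hK p x hx

end

end

end Laser

theorem mainTheorem4 (n : ℕ) (ε : ℝ) (hε : 0 < ε)
    (V₀ : Laser.Space n → ℝ) (hV₀ : ContDiff ℝ ∞ V₀)
    (e : ℝ → Laser.Space n) (he : ContDiffOn ℝ 2 e (Set.Ici 0)) :
    -- `C₂` commutes with the modified kinetic term
    (∀ t : ℝ, 0 ≤ t → ∀ h : ℝ, 0 < h → ∀ f : Laser.Space n → ℂ, ContDiff ℝ ∞ f →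
      Laser.comm (Laser.C2 e t h) (Laser.kin ε e t h) f = 0) ∧
    -- `e^{C₂/2} e^{T₂ + W₁} e^{C₂/2} = e^{Θ₄} + O(h⁷)` for the unitary exponentials, strongly on
    -- test functions
    (∀ u : Laser.L2 n, (∃ f : Laser.Space n → ℂ, Laser.IsTest f ∧ u =ᵐ[MeasureTheory.volume] f) →
      ∀ T : ℝ, ∃ K : ℝ, ∀ t ∈ Set.Icc 0 T, ∀ h ∈ Set.Ioc (0 : ℝ) 1,
        ∀ UC UB UΘ : Laser.L2 n ≃ₗᵢ[ℂ] Laser.L2 n,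
          Laser.IsExp ((1 / 2 : ℂ) • Laser.C2 e t h) UC →
          Laser.IsExp (Laser.kin ε e t h + Laser.pot ε V₀ e t h) UB →
          Laser.IsExp (Laser.Theta4 ε V₀ e t h) UΘ →
          ‖UC (UB (UC u)) - UΘ u‖ ≤ K * h ^ 7) ∧
    -- the same identity for the exponential series, at any length `N ≥ 7`, on smooth functions
    (∀ f : Laser.Space n → ℂ, ContDiff ℝ ∞ f → ∀ N : ℕ, 7 ≤ N →
      ∀ S : Set (Laser.Space n), IsCompact S → ∀ T : ℝ, ∃ K : ℝ,
        ∀ t ∈ Set.Icc 0 T, ∀ h ∈ Set.Ioc (0 : ℝ) 1, ∀ x ∈ S,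
          ‖Laser.expSum N ((1 / 2 : ℂ) • Laser.C2 e t h)
              (Laser.expSum N (Laser.kin ε e t h + Laser.pot ε V₀ e t h)
                (Laser.expSum N ((1 / 2 : ℂ) • Laser.C2 e t h) f)) x
            - Laser.expSum N (Laser.Theta4 ε V₀ e t h) f x‖ ≤ K * h ^ 7) := by
  refine ⟨fun t _ h _ f hf => Laser.comm_C2_kin ε e t h hf, ?_, ?_⟩
  · rintro u ⟨f, hf, hu⟩ T
    rw [Laser.eq_toL2 (hf.1.continuous.memLp_of_hasCompactSupport hf.2) hu]
    exact Laser.exists_L2_error_bound hε hV₀ he hf T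
  · exact fun f hf N hN S hS T => Laser.exists_series_error_bound hε hV₀ he hf hN hS T
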